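/- Let $d\ge 1$ and let $\Omega=\{x\in\mathbb{R}^d:|x|<1\}$ be the open unit ball. For $x\in\Omega$ and $v\in\mathbb{R}^d$ let $\eta(x,v)\in\bar\Omega$ be the position at time $1$ of the trajectory that starts at $x$ with velocity $v$, moves along straight lines at constant velocity, and is specularly reflected at $\partial\Omega$: when it reaches $y\in\partial\Omega$ its velocity $w$ is replaced by $w-2(w\cdot n(y))\,n(y)$, where $n(y)=y$ is the outward unit normal. For $T>0$ let $$\mathfrak{D}_T=\Big\{\psi\in C^\infty([0,T)\times\bar\Omega)\ :\ \psi(T,\cdot)=0,\ \ \nabla_x\psi(t,x)\cdot n(x)=0\ \text{ for all } t\in[0,T),\ x\in\partial\Omega\Big\}.$$ For $s\in(0,1)$ and $\nu>0$ let $F$ be the normalized equilibrium of the fractional Fokker--Planck operator, i.e. $F\in L^1(\mathbb{R}^d)$, $\int F\,dv=1$ and $\nu\nabla_v\cdot(vF)-(-\Delta_v)^sF=0$ in the sense of distributions. Let $L^p_{F(v)}(\Omega\times\mathbb{R}^d)$ be the Lebesgue space of the measure $F(v)\,dx\,dv$. (1) For every $x\in\Omega$ the map $v\mapsto\eta(x,v)$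 is differentiable almost everywhere, its almost everywhere derivative $\nabla_v\eta(x,\cdot)$ is its distributional derivative, and $$\|\nabla_v\eta\|\in L^\infty(\Omega\times\mathbb{R}^d).$$ (2) For every $T>0$, $\psi\in\mathfrak{D}_T$, $t\in[0,T)$ and $x\in\Omega$, the map $v\mapsto\psi(t,\eta(x,v))$ and its gradient in $v$ are differentiable almost everywhere, and their almost everywhere derivatives are their distributional derivatives; in particular the distributional Hessian $D^2_v[\psi(t,\eta(x,v))]$ is a locally integrable function of $v$. For all $s\in(0,1)$, $\nu>0$, with $F$ as above, and all $0<p<3$, $$\big\|D^2_v[\psi(t,\eta(x,v))]\big\|\in L^p_{F(v)}(\Omega\times\mathbb{R}^d).$$ (3) For $\psi$ and $t$ as in (2) and every $\delta>0$ (with $\delta<2$), $$\sup_{v\in\mathbb{R}^d}\big\|D^2_v[\psi(t,\eta(x,v))]\big\|\in L^{2-\delta}(\Omega),$$ where the supremum is over the points $v$ at which the Hessian exists. -/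

import Mathlib

open MeasureTheory Set Filter Topology
open scoped ContDiff ENNReal

namespace SpecularBall

/-- Euclidean space of dimension `d`. The domain is its open unit ball `Metric.ball 0 1`; the
outward unit normal at a boundary point `y` is `y` itself. -/
abbrev E (d : ℕ) : Type := EuclideanSpace ℝ (Fin d)

/-! ### Specular trajectories in the unit ball -/

/-- Specular reflection of the velocity `v` at the boundary point `y` (unit normal `y`). -/
noncomputable def reflect {d : ℕ} (y v : E d) : E d := v - (2 * inner ℝ y v) • y

/-- The last time at which the straight line from `x` with velocity `v` is in the closed unit ball.
(For `v = 0` the set is unbounded and the value is `0`: such a point never moves.) -/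
noncomputable def exitTime {d : ℕ} (x v : E d) : ℝ := sSup {t : ℝ | 0 ≤ t ∧ ‖x + t • v‖ ≤ 1}

/-- Position and velocity just after the `n`-th reflection (for `n = 0`: the initial state). -/
noncomputable def bounce {d : ℕ} (x v : E d) : ℕ → E d × E d
  | 0 => (x, v)
  | n + 1 =>
    let y := (bounce x v n).1 + exitTime (bounce x v n).1 (bounce x v n).2 • (bounce x v n).2
    (y, reflect y (bounce x v n).2)

/-- Time of the `n`-th reflection (for `n = 0`: the initial time `0`). -/
noncomputable def bounceTime {d : ℕ} (x v : E d) (n : ℕ) : ℝ :=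
  ∑ j ∈ Finset.range n, exitTime (bounce x v j).1 (bounce x v j).2

/-- The number of reflections during the time interval `[0, 1]`: the least `n` such that the
`(n + 1)`-st reflection takes place after time `1` (it is `0` for `v = 0`). -/
noncomputable def numBounces {d : ℕ} (x v : E d) : ℕ := sInf {n : ℕ | 1 < bounceTime x v (n + 1)}

/-- The position at time `1` of the specular trajectory that starts at `x` with velocity `v`. -/
noncomputable def eta {d : ℕ} (x v : E d) : E d :=
  (bounce x v (numBounces x v)).1 +
    (1 - bounceTime x v (numBounces x v)) • (bounce x v (numBounces x v)).2

/-! ### Test functions -/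

/-- Functions `ψ (t, x)` that are smooth on `[0, T) × closed ball` (up to the boundary), vanish at
`t = T` and have vanishing normal derivative on the unit sphere. -/
structure IsTestFunction {d : ℕ} (T : ℝ) (ψ : ℝ → E d → ℝ) : Prop where
  smooth : ContDiffOn ℝ ∞ (fun z : ℝ × E d => ψ z.1 z.2) (Ico 0 T ×ˢ Metric.closedBall 0 1)
  terminal : ∀ x ∈ Metric.closedBall (0 : E d) 1, ψ T x = 0
  neumann : ∀ t ∈ Ico 0 T, ∀ x ∈ Metric.sphere (0 : E d) 1,
    fderivWithin ℝ (ψ t) (Metric.closedBall 0 1) x x = 0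

/-! ### The equilibrium of the fractional Fokker-Planck operator -/

/-- The normalizing constant of the fractional Laplacian. -/
noncomputable def fracConst (d : ℕ) [NeZero d] (s : ℝ) : ℝ :=
  (∫ ζ : E d, (1 - Real.cos (ζ 0)) / ‖ζ‖ ^ ((d : ℝ) + 2 * s))⁻¹

/-- The fractional Laplacian `(-Δ)^s`, as a principal value singular integral. -/
noncomputable def fracLaplacian {d : ℕ} [NeZero d] (s : ℝ) (φ : E d → ℝ) (v : E d) : ℝ :=
  fracConst d s * limUnder (𝓝[>] (0 : ℝ)) fun ε : ℝ =>
    ∫ w in {w : E d | ε < ‖v - w‖}, (φ v - φ w) / ‖v - w‖ ^ ((d : ℝ) + 2 * s)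

/-- `F` is a normalized equilibrium: `F` is integrable of total mass one and
`ν ∇ᵥ · (v F) - (-Δᵥ)^s F = 0` in the sense of distributions. -/
structure IsEquilibrium {d : ℕ} [NeZero d] (s ν : ℝ) (F : E d → ℝ) : Prop where
  integrable : Integrable F
  mass : ∫ v, F v = 1
  equation : ∀ φ : E d → ℝ, ContDiff ℝ ∞ φ → HasCompactSupport φ →
    ∫ v, F v * (-(ν * fderiv ℝ φ v v) - fracLaplacian s φ v) = 0

/-! ### Derivatives -/

/-- `f` is differentiable almost everywhere and its pointwise derivative is also its derivative in
the sense of distributions (so that the latter is a locally integrable function, without any part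
that is concentrated on a null set). -/
structure HasRegularDeriv {d : ℕ} {V : Type*} [NormedAddCommGroup V] [NormedSpace ℝ V]
    (f : E d → V) : Prop where
  ae_differentiable : ∀ᵐ v : E d, DifferentiableAt ℝ f v
  locallyIntegrable : LocallyIntegrable f
  locallyIntegrable_fderiv : LocallyIntegrable (fderiv ℝ f)
  integral_by_parts : ∀ φ : E d → ℝ, ContDiff ℝ ∞ φ → HasCompactSupport φ → ∀ a : E d,
    ∫ v, (fderiv ℝ φ v a) • f v = -∫ v, φ v • (fderiv ℝ f v a)

/-- The second derivative in `v` of `ψ (t, η (x, v))`, as a bilinear form (equal to `0` at the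
points `v` where the gradient in `v` is not differentiable). -/
noncomputable def hessian {d : ℕ} (ψ : ℝ → E d → ℝ) (t : ℝ) (x v : E d) : E d →L[ℝ] E d →L[ℝ] ℝ :=
  fderiv ℝ (fderiv ℝ fun w => ψ t (eta x w)) v

end SpecularBall

/-! A trajectory stays in the plane through the center spanned by `x` and `v`, and every reflection
turns its chord by the same angle. With `c = half x v = sin β` half the chord length, the chord
after `n` reflections is the first one rotated by `2nβ`. Hence `eta` agrees with an explicit branch
`etaN n`, smooth for `v ≠ 0` and for `n = 0`, on the set `branch n x` where the signed position `pos
n x v` on that chord lies in `[-c, c]`. These sets cover all velocities; two of them meet only if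
they are adjacent, and then exactly where time `1` is a reflection time.

First derivatives: the gradient of every branch is bounded by `20` on its set (`norm_etaD_le`),
because `n ≥ 2` reflections force speed at least `n c` (`mul_half_le_norm`); one reflection is
treated by a different formula. So `eta x` is Lipschitz and Rademacher's theorem gives (1).

Second derivatives: `etaDD` may be as large as `c⁻²`, but `etaDD_decomposition` shows that this part
is a multiple of the midpoint `midN` of the current chord, up to an error of order `c⁻¹`. The
position `η` differs from `midN` by at most `c` times a unit vector, and the Neumann condition makes
the radial derivative of `ψ` at `η` of order `1 - ‖η‖² ≤ c²`. So the derivative of `ψ` along `midN`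
is of order `c` and the Hessian of `ψ ∘ η` is of order `c⁻¹` on each branch (`norm_hessN_le`).
Across an interface the gradients of adjacent branches differ by a multiple of the normal
(`fderiv_etaN_succ_apply`), which the Neumann condition also annihilates (`gradN_eq`). The gradient
of `ψ ∘ η` is therefore Lipschitz in `v`, and its distributional derivative has no part on the
interfaces.

Integrability: for fixed `v ≠ 0`, `c² = 1 - ‖x‖² + (x · v/‖v‖)² ≤ δ²` confines `x` to a slab of
width `δ` inside a boundary shell of width `δ²`, of volume `O(δ³)` uniformly in `v`
(`volume_half_le`). So `c⁻¹` is in weak `L³`, which gives (2) for every finite weight absolutely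
continuous in `v`. Uniformly in `v` only `c⁻¹ ≤ (1 - ‖x‖²)^(-1/2)` remains; the shell has volume
`O(δ²)`, hence weak `L²` and (3). -/

namespace SpecularBall

/-! ### Rotation by a multiple of the chord angle

A chord of half-length `c = sin β` of the unit circle subtends the angle `2 β`. The functions below
are `cos (2 n β)`, `sin (2 n β) / cos β` and the first two derivatives of the latter, as polynomials
in `c`. -/

/-- `cos (2 n β)` and `sin (2 n β) / cos β` as polynomials in `c = sin β`. -/
noncomputable def rot (c : ℝ) : ℕ → ℝ × ℝ
  | 0 => (1, 0)
  | n + 1 => ((1 - 2 * c ^ 2) * (rot c n).1 - 2 * c * (1 - c ^ 2) * (rot c n).2,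
      (1 - 2 * c ^ 2) * (rot c n).2 + 2 * c * (rot c n).1)

/-- `cos (2 n β)` as a polynomial in `c = sin β`. -/
noncomputable def rotCos (n : ℕ) (c : ℝ) : ℝ := (rot c n).1

/-- `sin (2 n β) / cos β` as a polynomial in `c = sin β`. -/
noncomputable def rotSin (n : ℕ) (c : ℝ) : ℝ := (rot c n).2

/-- The derivative of `rotSin n`. -/
noncomputable def rotSinDeriv (c : ℝ) : ℕ → ℝ
  | 0 => 0
  | n + 1 => -rotSinDeriv c n + (4 * n + 2) * (rotCos n c - c * rotSin n c)

/-- The second derivative of `rotSin n`. -/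
noncomputable def rotSinDeriv₂ (c : ℝ) : ℕ → ℝ
  | 0 => 0
  | n + 1 => -rotSinDeriv₂ c n +
      (4 * n + 2) * (-(2 * n + 1) * rotSin n c - c * rotSinDeriv c n)

@[simp] lemma rotCos_zero (c : ℝ) : rotCos 0 c = 1 := rfl

@[simp] lemma rotSin_zero (c : ℝ) : rotSin 0 c = 0 := rfl

lemma rotCos_succ (n : ℕ) (c : ℝ) : rotCos (n + 1) c =
    (1 - 2 * c ^ 2) * rotCos n c - 2 * c * (1 - c ^ 2) * rotSin n c := rfl

lemma rotSin_succ (n : ℕ) (c : ℝ) : rotSin (n + 1) c =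
    (1 - 2 * c ^ 2) * rotSin n c + 2 * c * rotCos n c := rfl

/-- With `c = sin β`, `S_n + S_{n+1} = 2 sin((2n+1)β)`, whose derivative in `c` is `(4n+2)
cos((2n+1)β) / cos β = (4n+2)(C_n - c S_n)`. This recursion involves no division by `1 - c²`, so it
survives at chords through the center. -/
lemma rotSinDeriv_succ (n : ℕ) (c : ℝ) : rotSinDeriv c (n + 1) =
    -rotSinDeriv c n + (4 * n + 2) * (rotCos n c - c * rotSin n c) := rfl

lemma rotSinDeriv₂_succ (n : ℕ) (c : ℝ) : rotSinDeriv₂ c (n + 1) = -rotSinDeriv₂ c n +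
    (4 * n + 2) * (-(2 * n + 1) * rotSin n c - c * rotSinDeriv c n) := rfl

lemma rotCos_sq_add (n : ℕ) (c : ℝ) : rotCos n c ^ 2 + (1 - c ^ 2) * rotSin n c ^ 2 = 1 := by
  induction n with
  | zero => simp
  | succ n ih => rw [rotCos_succ, rotSin_succ]; linear_combination ih

/-- The quotient rule for `sin(2nβ) / cos β`, multiplied out so that it makes sense at `c = 1`. -/
lemma mul_rotSinDeriv (n : ℕ) (c : ℝ) :
    (1 - c ^ 2) * rotSinDeriv c n = 2 * n * rotCos n c + c * rotSin n c := by
  induction n with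
  | zero => simp [rotSinDeriv]
  | succ n ih =>
    rw [rotCos_succ, rotSin_succ, rotSinDeriv_succ]; push_cast; linear_combination -ih

/-- The derivative in `c` of `mul_rotSinDeriv`: a second order equation of Chebyshev type. -/
lemma mul_rotSinDeriv₂ (n : ℕ) (c : ℝ) : (1 - c ^ 2) * rotSinDeriv₂ c n =
    -(4 * n ^ 2 - 1) * rotSin n c + 3 * c * rotSinDeriv c n := by
  induction n with
  | zero => simp [rotSinDeriv₂, rotSinDeriv]
  | succ n ih =>
    rw [rotSin_succ, rotSinDeriv_succ, rotSinDeriv₂_succ]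
    push_cast
    linear_combination -ih - (4 * n + 2) * c * mul_rotSinDeriv n c

/-- Both statements go through one induction since the recursion mixes the two functions. -/
lemma hasDerivAt_rot (n : ℕ) (c : ℝ) :
    HasDerivAt (rotCos n) (-(2 * n) * rotSin n c) c ∧
      HasDerivAt (rotSin n) (rotSinDeriv c n) c := by
  induction n with
  | zero =>
    exact ⟨(show HasDerivAt (rotCos 0) 0 c from hasDerivAt_const c (1 : ℝ)).congr_deriv (by simp),
      hasDerivAt_const c (0 : ℝ)⟩
  | succ n ih =>
    obtain ⟨h1, h2⟩ := ih
    have hq : HasDerivAt (fun c : ℝ => c ^ 2) (2 * c) c := by simpa using hasDerivAt_pow 2 c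
    have hg := mul_rotSinDeriv n c
    have hid := hasDerivAt_id' c
    constructor
    · have := (((hq.const_mul 2).const_sub 1).mul h1).sub
        (((hid.const_mul 2).mul (hq.const_sub 1)).mul h2)
      refine (this.congr_deriv ?_)
      rw [rotSin_succ]
      push_cast
      simp only [Pi.mul_apply]
      linear_combination (-2 * c) * hg
    · have := (((hq.const_mul 2).const_sub 1).mul h2).add ((hid.const_mul 2).mul h1)
      refine (this.congr_deriv ?_)
      rw [rotSinDeriv_succ]
      linear_combination 2 * hg

lemma hasDerivAt_rotCos (n : ℕ) (c : ℝ) : HasDerivAt (rotCos n) (-(2 * n) * rotSin n c) c :=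
  (hasDerivAt_rot n c).1

lemma hasDerivAt_rotSin (n : ℕ) (c : ℝ) : HasDerivAt (rotSin n) (rotSinDeriv c n) c :=
  (hasDerivAt_rot n c).2

lemma hasDerivAt_rotSinDeriv (n : ℕ) (c : ℝ) :
    HasDerivAt (fun c => rotSinDeriv c n) (rotSinDeriv₂ c n) c := by
  induction n with
  | zero => exact hasDerivAt_const c (0 : ℝ)
  | succ n ih =>
    have := ih.neg.add ((((hasDerivAt_rotCos n c).sub
      ((hasDerivAt_id' c).mul (hasDerivAt_rotSin n c))).const_mul (4 * (n : ℝ) + 2)))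
    refine this.congr_deriv ?_
    rw [rotSinDeriv₂_succ]
    ring

lemma abs_rotCos_le {c : ℝ} (hc : |c| ≤ 1) (n : ℕ) : |rotCos n c| ≤ 1 := by
  have h := rotCos_sq_add n c
  have hq : 0 ≤ 1 - c ^ 2 := by nlinarith [sq_abs c, abs_nonneg c]
  rw [← sq_le_one_iff_abs_le_one]
  nlinarith [mul_nonneg hq (sq_nonneg (rotSin n c))]

lemma mul_abs_rotSin_le {c w : ℝ} (hw : 0 ≤ w) (h : w ^ 2 = 1 - c ^ 2) (n : ℕ) :
    w * |rotSin n c| ≤ 1 := by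
  have h1 := rotCos_sq_add n c
  rw [← abs_of_nonneg hw, ← abs_mul, ← sq_le_one_iff_abs_le_one, mul_pow, h]
  nlinarith [sq_nonneg (rotCos n c)]

/-- Complements `mul_abs_rotSin_le`: it does not degenerate at chords through the center (`c = 1`)
and it gains a factor `c` on short chords. -/
lemma abs_rotSin_le {c : ℝ} (h0 : 0 ≤ c) (hc : c ≤ 1) (n : ℕ) : |rotSin n c| ≤ 2 * n * c := by
  induction n with
  | zero => simp
  | succ n ih =>
    rw [rotSin_succ]
    have hC := abs_rotCos_le (c := c) (by rwa [abs_of_nonneg h0]) n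
    have h1 : |1 - 2 * c ^ 2| ≤ 1 := by rw [abs_le]; constructor <;> nlinarith
    calc |(1 - 2 * c ^ 2) * rotSin n c + 2 * c * rotCos n c|
        ≤ |1 - 2 * c ^ 2| * |rotSin n c| + 2 * c * |rotCos n c| := by
          refine (abs_add_le _ _).trans_eq ?_
          rw [abs_mul, abs_mul (2 * c), abs_of_nonneg (by positivity : 0 ≤ 2 * c)]
      _ ≤ 1 * (2 * n * c) + 2 * c * 1 := by gcongr
      _ = 2 * ((n + 1 : ℕ) : ℝ) * c := by push_cast; ring

lemma mul_abs_rotSinDeriv_le {c w : ℝ} (hw : 0 ≤ w) (h : w ^ 2 = 1 - c ^ 2) (n : ℕ) :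
    w * |rotSinDeriv c n| ≤ 2 * n ^ 2 := by
  induction n with
  | zero => simp [rotSinDeriv]
  | succ n ih =>
    -- With `w = cos β` the left side is `|cos((2n+1)β)|`; the square given to `nlinarith` below is
    -- that of `sin((2n+1)β)`. The increments `4n+2` then add up to `2(n+1)²`.
    have h2 : w * |rotCos n c - c * rotSin n c| ≤ 1 := by
      rw [← abs_of_nonneg hw, ← abs_mul, ← sq_le_one_iff_abs_le_one, mul_pow, h]
      have h1 := rotCos_sq_add n c
      have hq : 0 ≤ 1 - c ^ 2 := h ▸ sq_nonneg w
      nlinarith [sq_nonneg (c * rotCos n c + (1 - c ^ 2) * rotSin n c)]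
    rw [rotSinDeriv_succ]
    calc w * |-rotSinDeriv c n + (4 * n + 2) * (rotCos n c - c * rotSin n c)|
        ≤ w * (|rotSinDeriv c n| + (4 * n + 2) * |rotCos n c - c * rotSin n c|) := by
          gcongr
          refine (abs_add_le _ _).trans_eq ?_
          rw [abs_neg, abs_mul, abs_of_nonneg (by positivity : 0 ≤ 4 * (n : ℝ) + 2)]
      _ = w * |rotSinDeriv c n| + (4 * n + 2) * (w * |rotCos n c - c * rotSin n c|) := by ring
      _ ≤ 2 * n ^ 2 + (4 * n + 2) * 1 := by gcongr
      _ = 2 * ((n + 1 : ℕ) : ℝ) ^ 2 := by push_cast; ring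

/-- Against `mul_abs_rotSinDeriv_le`, a second factor `w` lowers the growth from `n²` to `n`. -/
lemma sq_mul_abs_rotSinDeriv_le {c w : ℝ} (h0 : 0 ≤ c) (hc : c ≤ 1) (h : w ^ 2 = 1 - c ^ 2)
    (n : ℕ) : w ^ 2 * |rotSinDeriv c n| ≤ 4 * n := by
  have hC := abs_rotCos_le (c := c) (by rwa [abs_of_nonneg h0]) n
  have hS := abs_rotSin_le h0 hc n
  have hc2 : c * c ≤ 1 := by nlinarith
  calc w ^ 2 * |rotSinDeriv c n| = |2 * n * rotCos n c + c * rotSin n c| := by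
        rw [← mul_rotSinDeriv, abs_mul, ← h, abs_of_nonneg (sq_nonneg w)]
    _ ≤ 2 * n * |rotCos n c| + c * |rotSin n c| := by
        refine (abs_add_le _ _).trans_eq ?_
        rw [abs_mul, abs_mul c, abs_of_nonneg h0, abs_of_nonneg (by positivity : 0 ≤ 2 * (n : ℝ))]
    _ ≤ 2 * n * 1 + c * (2 * n * c) := by gcongr
    _ = 2 * n + 2 * n * (c * c) := by ring
    _ ≤ 2 * n + 2 * n * 1 := by gcongr
    _ = 4 * n := by ring

lemma pow_three_mul_abs_rotSinDeriv₂_le {c w : ℝ} (h0 : 0 ≤ c) (hc : c ≤ 1) (hw : 0 ≤ w)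
    (h : w ^ 2 = 1 - c ^ 2) (n : ℕ) : w ^ 3 * |rotSinDeriv₂ c n| ≤ 11 * n ^ 2 := by
  rcases n.eq_zero_or_pos with rfl | hn
  · simp [rotSinDeriv₂]
  have hn1 : (1 : ℝ) ≤ n := by exact_mod_cast hn
  have hS := mul_abs_rotSin_le hw h n
  have hG := mul_abs_rotSinDeriv_le hw h n
  have h4 : 0 ≤ 4 * (n : ℝ) ^ 2 - 1 := by nlinarith
  calc w ^ 3 * |rotSinDeriv₂ c n|
      = w * |-(4 * n ^ 2 - 1) * rotSin n c + 3 * c * rotSinDeriv c n| := by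
        rw [← mul_rotSinDeriv₂, abs_mul, ← h, abs_of_nonneg (sq_nonneg w)]; ring
    _ ≤ w * ((4 * n ^ 2 - 1) * |rotSin n c| + 3 * c * |rotSinDeriv c n|) := by
        gcongr
        refine (abs_add_le _ _).trans_eq ?_
        rw [abs_mul, abs_mul (3 * c), abs_neg, abs_of_nonneg (by positivity : 0 ≤ 3 * c),
          abs_of_nonneg h4]
    _ = (4 * n ^ 2 - 1) * (w * |rotSin n c|) + 3 * c * (w * |rotSinDeriv c n|) := by ring
    _ ≤ (4 * n ^ 2 - 1) * 1 + 3 * 1 * (2 * n ^ 2) := by gcongr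
    _ ≤ 11 * n ^ 2 := by nlinarith

/-! ### Directional derivatives -/

/-- `f` is differentiable at `v` and its derivative there is the map `D`. -/
def HasDirDeriv {V W : Type*} [NormedAddCommGroup V] [NormedSpace ℝ V] [NormedAddCommGroup W]
    [NormedSpace ℝ W] (f : V → W) (D : V → W) (v : V) : Prop :=
  ∃ f' : V →L[ℝ] W, HasFDerivAt f f' v ∧ ∀ a, f' a = D a

namespace HasDirDeriv

variable {V W : Type*} [NormedAddCommGroup V] [NormedSpace ℝ V] [NormedAddCommGroup W]
  [NormedSpace ℝ W] {v : V} {f g : V → W} {D D' : V → W} {r s : V → ℝ} {R S : V → ℝ}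

lemma fderiv_apply (h : HasDirDeriv f D v) (a : V) : fderiv ℝ f v a = D a := by
  obtain ⟨f', h1, h2⟩ := h
  rw [h1.fderiv, h2]

lemma congr (h : HasDirDeriv f D v) (h' : ∀ a, D a = D' a) : HasDirDeriv f D' v :=
  let ⟨f', h1, h2⟩ := h
  ⟨f', h1, fun a => (h2 a).trans (h' a)⟩

lemma const (w : W) (v : V) : HasDirDeriv (fun _ => w) (fun _ : V => 0) v :=
  ⟨0, hasFDerivAt_const w v, fun _ => rfl⟩

lemma add (hf : HasDirDeriv f D v) (hg : HasDirDeriv g D' v) :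
    HasDirDeriv (fun w => f w + g w) (fun a => D a + D' a) v := by
  obtain ⟨f', h1, h2⟩ := hf
  obtain ⟨g', h3, h4⟩ := hg
  exact ⟨_, h1.add h3, fun a => by simp [h2, h4]⟩

lemma sub (hf : HasDirDeriv f D v) (hg : HasDirDeriv g D' v) :
    HasDirDeriv (fun w => f w - g w) (fun a => D a - D' a) v := by
  obtain ⟨f', h1, h2⟩ := hf
  obtain ⟨g', h3, h4⟩ := hg
  exact ⟨_, h1.sub h3, fun a => by simp [h2, h4]⟩

lemma neg (hf : HasDirDeriv f D v) : HasDirDeriv (fun w => -f w) (fun a => -D a) v := by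
  obtain ⟨f', h1, h2⟩ := hf
  exact ⟨_, h1.neg, fun a => by simp [h2]⟩

lemma smul (hr : HasDirDeriv r R v) (hf : HasDirDeriv f D v) :
    HasDirDeriv (fun w => r w • f w) (fun a => R a • f v + r v • D a) v := by
  obtain ⟨f', h1, h2⟩ := hf
  obtain ⟨r', h3, h4⟩ := hr
  exact ⟨_, h3.smul h1, fun a => by simp [h2, h4, add_comm]⟩

lemma mul (hr : HasDirDeriv r R v) (hs : HasDirDeriv s S v) :
    HasDirDeriv (fun w => r w * s w) (fun a => R a * s v + r v * S a) v := by
  obtain ⟨f', h1, h2⟩ := hr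
  obtain ⟨r', h3, h4⟩ := hs
  exact ⟨_, h1.mul h3, fun a => by simp [h2, h4]; ring⟩

lemma const_mul (c : ℝ) (hs : HasDirDeriv s S v) :
    HasDirDeriv (fun w => c * s w) (fun a => c * S a) v :=
  ((const c v).mul hs).congr fun a => by ring

lemma scomp {φ : ℝ → ℝ} {φ' : ℝ} (hφ : HasDerivAt φ φ' (r v)) (hr : HasDirDeriv r R v) :
    HasDirDeriv (fun w => φ (r w)) (fun a => φ' * R a) v := by
  obtain ⟨f', h1, h2⟩ := hr
  exact ⟨_, hφ.comp_hasFDerivAt v h1, fun a => by simp [h2]⟩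

lemma inner_const {V W : Type*} [NormedAddCommGroup V] [NormedSpace ℝ V] [NormedAddCommGroup W]
    [InnerProductSpace ℝ W] {v : V} {f : V → W} {D : V → W} (hf : HasDirDeriv f D v) (b : W) :
    HasDirDeriv (fun w => inner ℝ (f w) b) (fun a => inner ℝ (D a) b) v := by
  obtain ⟨f', h1, h2⟩ := hf
  refine ⟨_, h1.inner ℝ (hasFDerivAt_const b v), fun a => ?_⟩
  simp [h2]

end HasDirDeriv

/-! ### Geometry of a chord -/

variable {V : Type*} [NormedAddCommGroup V] [InnerProductSpace ℝ V]

/-- The direction of `v`. -/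
noncomputable def dir (v : V) : V := ‖v‖⁻¹ • v

/-- The position of `x` on its chord with direction `v`, measured from the midpoint. -/
noncomputable def along (x v : V) : ℝ := inner ℝ x (dir v)

/-- The midpoint of the chord through `x` with direction `v`. -/
noncomputable def mid (x v : V) : V := x - along x v • dir v

/-- Half of the length of the chord through `x` with direction `v`. -/
noncomputable def half (x v : V) : ℝ := √(1 - ‖x‖ ^ 2 + along x v ^ 2)

/-- The position at time `1` on the chord with number `n`, measured from the midpoint. -/
noncomputable def pos (n : ℕ) (x v : V) : ℝ := along x v + ‖v‖ - 2 * n * half x v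

/-- The position at time `1` after `n` reflections, as an expression that is smooth in `v`. -/
noncomputable def etaN (n : ℕ) (x v : V) : V :=
  (rotCos n (half x v) - pos n x v * rotSin n (half x v)) • mid x v +
    (pos n x v * rotCos n (half x v) + (1 - half x v ^ 2) * rotSin n (half x v)) • dir v

/-- The derivative of `along x` at `v` in direction `a`. -/
noncomputable def alongD (x v a : V) : ℝ := inner ℝ (mid x v) a * ‖v‖⁻¹

/-- The derivative of `half x` at `v` in direction `a`. -/
noncomputable def halfD (x v a : V) : ℝ := along x v * (half x v)⁻¹ * alongD x v a

/-- The derivative of `pos n x` at `v` in direction `a`. -/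
noncomputable def posD (n : ℕ) (x v a : V) : ℝ :=
  alongD x v a + inner ℝ (dir v) a - 2 * n * halfD x v a

/-- The derivative of `dir` at `v` in direction `a`. -/
noncomputable def dirD (v a : V) : V := ‖v‖⁻¹ • (a - inner ℝ (dir v) a • dir v)

/-- The derivative of `mid x` at `v` in direction `a`. -/
noncomputable def midD (x v a : V) : V := -(alongD x v a • dir v + along x v • dirD v a)

section

variable {x v : V}

lemma norm_dir (hv : v ≠ 0) : ‖dir v‖ = 1 := norm_smul_inv_norm (𝕜 := ℝ) hv

lemma norm_dir_le (v : V) : ‖dir v‖ ≤ 1 := by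
  rcases eq_or_ne v 0 with rfl | hv
  · simp [dir]
  · exact (norm_dir hv).le

lemma norm_smul_dir (v : V) : ‖v‖ • dir v = v := by
  rcases eq_or_ne v 0 with rfl | hv
  · simp [dir]
  · rw [dir, smul_inv_smul₀ (norm_ne_zero_iff.2 hv)]

lemma inner_dir_dir (hv : v ≠ 0) : inner ℝ (dir v) (dir v) = (1 : ℝ) := by
  rw [real_inner_self_eq_norm_sq, norm_dir hv, one_pow]

lemma inner_mid_dir (hv : v ≠ 0) : inner ℝ (mid x v) (dir v) = (0 : ℝ) := by
  rw [mid, inner_sub_left, real_inner_smul_left, inner_dir_dir hv, along]; ring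

lemma norm_mid_sq (hv : v ≠ 0) : ‖mid x v‖ ^ 2 = ‖x‖ ^ 2 - along x v ^ 2 := by
  rw [mid, norm_sub_sq_real, real_inner_smul_right, norm_smul, norm_dir hv, ← along,
    Real.norm_eq_abs, mul_one, sq_abs]
  ring

lemma half_sq (hx : ‖x‖ < 1) (v : V) : half x v ^ 2 = 1 - ‖x‖ ^ 2 + along x v ^ 2 :=
  Real.sq_sqrt (by nlinarith [norm_nonneg x, sq_nonneg (along x v)])

lemma half_pos (hx : ‖x‖ < 1) (v : V) : 0 < half x v :=
  Real.sqrt_pos.2 (by nlinarith [norm_nonneg x, sq_nonneg (along x v)])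

lemma norm_mid_sq_eq (hx : ‖x‖ < 1) (hv : v ≠ 0) : ‖mid x v‖ ^ 2 = 1 - half x v ^ 2 := by
  rw [half_sq hx, norm_mid_sq hv]; ring

lemma abs_along_lt (hx : ‖x‖ < 1) (v : V) : |along x v| < half x v := by
  rw [← abs_of_pos (half_pos hx v), ← sq_lt_sq, half_sq hx]
  nlinarith [norm_nonneg x]

lemma half_le_one (x v : V) : half x v ≤ 1 := by
  have h : |along x v| ≤ ‖x‖ := (abs_real_inner_le_norm _ _).trans
    (mul_le_of_le_one_right (norm_nonneg x) (norm_dir_le v))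
  rw [half, Real.sqrt_le_one]
  nlinarith [sq_abs (along x v), abs_nonneg (along x v), norm_nonneg x]

lemma hasDirDeriv_norm (hv : v ≠ 0) :
    HasDirDeriv (fun w : V => ‖w‖) (fun a => inner ℝ (dir v) a) v := by
  have hN : ‖v‖ ≠ 0 := norm_ne_zero_iff.2 hv
  have h := ((hasFDerivAt_id v).norm_sq).sqrt (by simpa using hN)
  have he : (fun w : V => √(‖id w‖ ^ 2)) = fun w => ‖w‖ := by
    funext w; exact Real.sqrt_sq (norm_nonneg w)
  rw [he] at h
  refine ⟨_, h, fun a => ?_⟩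
  simp only [id, Real.sqrt_sq (norm_nonneg v), dir, real_inner_smul_left]
  simp
  field_simp

lemma hasDirDeriv_norm_inv (hv : v ≠ 0) : HasDirDeriv (fun w : V => ‖w‖⁻¹)
    (fun a => -(‖v‖⁻¹ * ‖v‖⁻¹) * inner ℝ (dir v) a) v := by
  have hN : ‖v‖ ≠ 0 := norm_ne_zero_iff.2 hv
  exact (HasDirDeriv.scomp (hasDerivAt_inv hN) (hasDirDeriv_norm hv)).congr
    fun a => by rw [← mul_inv, sq]

lemma hasDirDeriv_id (v : V) : HasDirDeriv (fun w : V => w) (fun a => a) v :=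
  ⟨_, hasFDerivAt_id v, fun _ => rfl⟩

lemma hasDirDeriv_dir (hv : v ≠ 0) : HasDirDeriv (dir : V → V) (dirD v) v :=
  ((hasDirDeriv_norm_inv hv).smul (hasDirDeriv_id v)).congr fun a => by
    rw [dirD, dir]; module

lemma hasDirDeriv_along (hv : v ≠ 0) : HasDirDeriv (along x) (alongD x v) v := by
  have h := ((hasDirDeriv_dir hv).inner_const x).congr (D' := alongD x v) fun a => by
    simp only [alongD, dirD, mid, inner_sub_left, real_inner_smul_left, along]
    rw [real_inner_comm (dir v) x, real_inner_comm a x]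
    ring
  simp_rw [real_inner_comm x] at h
  exact h

lemma hasDirDeriv_mid (hv : v ≠ 0) : HasDirDeriv (mid x) (midD x v) v :=
  ((HasDirDeriv.const x v).sub ((hasDirDeriv_along hv).smul (hasDirDeriv_dir hv))).congr fun a => by
    rw [midD]; module

lemma hasDirDeriv_half (hx : ‖x‖ < 1) (hv : v ≠ 0) : HasDirDeriv (half x) (halfD x v) v := by
  have h0 : (1 - ‖x‖ ^ 2 + along x v ^ 2 : ℝ) ≠ 0 := by
    rw [← half_sq hx]; exact (pow_pos (half_pos hx v) 2).ne'
  have h := HasDirDeriv.scomp (r := along x) (φ := fun r => √(1 - ‖x‖ ^ 2 + r ^ 2))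
    (((hasDerivAt_pow 2 (along x v)).const_add (1 - ‖x‖ ^ 2)).sqrt h0) (hasDirDeriv_along hv)
  refine h.congr fun a => ?_
  rw [halfD, half]
  have : √(1 - ‖x‖ ^ 2 + along x v ^ 2) ≠ 0 := (half_pos hx v).ne'
  push_cast
  field_simp

lemma hasDirDeriv_pos (n : ℕ) (hx : ‖x‖ < 1) (hv : v ≠ 0) :
    HasDirDeriv (pos n x) (posD n x v) v :=
  ((hasDirDeriv_along hv).add (hasDirDeriv_norm hv)).sub
    ((hasDirDeriv_half hx hv).const_mul (2 * n))

lemma hasDirDeriv_rotCos (n : ℕ) (hx : ‖x‖ < 1) (hv : v ≠ 0) :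
    HasDirDeriv (fun w => rotCos n (half x w))
      (fun a => -(2 * n) * rotSin n (half x v) * halfD x v a) v :=
  HasDirDeriv.scomp (hasDerivAt_rotCos n _) (hasDirDeriv_half hx hv)

lemma hasDirDeriv_rotSin (n : ℕ) (hx : ‖x‖ < 1) (hv : v ≠ 0) :
    HasDirDeriv (fun w => rotSin n (half x w))
      (fun a => rotSinDeriv (half x v) n * halfD x v a) v :=
  HasDirDeriv.scomp (hasDerivAt_rotSin n _) (hasDirDeriv_half hx hv)

lemma hasDirDeriv_rotSinDeriv (n : ℕ) (hx : ‖x‖ < 1) (hv : v ≠ 0) :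
    HasDirDeriv (fun w => rotSinDeriv (half x w) n)
      (fun a => rotSinDeriv₂ (half x v) n * halfD x v a) v :=
  HasDirDeriv.scomp (hasDerivAt_rotSinDeriv n _) (hasDirDeriv_half hx hv)

end

/-! ### The first derivative of a branch in closed form. -/

/-- The coefficient of the identity in the derivative of `etaN n x`. -/
noncomputable def coefB (n : ℕ) (x v : V) : ℝ :=
  (pos n x v * rotCos n (half x v) + (1 - half x v ^ 2) * rotSin n (half x v) -
    along x v * (rotCos n (half x v) - pos n x v * rotSin n (half x v))) * ‖v‖⁻¹

/-- The coefficient of the radial variation in the plane of motion. -/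
noncomputable def coefD (n : ℕ) (x v : V) : ℝ :=
  (pos n x v - (2 * n * pos n x v * (half x v)⁻¹ + 1) * along x v) * ‖v‖⁻¹

/-- The coefficient of `mid ⊗ mid` in the derivative of `etaN n x`. -/
noncomputable def coefE (n : ℕ) (x v : V) : ℝ :=
  -(pos n x v * (half x v)⁻¹ * along x v * rotSinDeriv (half x v) n + rotSin n (half x v)) * ‖v‖⁻¹

/-- The derivative of `etaN n x` at `v` in direction `b`. -/
noncomputable def etaD (n : ℕ) (x v b : V) : V :=
  coefB n x v • b + ((rotCos n (half x v) - coefB n x v) * inner ℝ (dir v) b) • dir v -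
    (rotSin n (half x v) * inner ℝ (dir v) b) • mid x v +
    (coefE n x v * inner ℝ (mid x v) b) • mid x v +
    (coefD n x v * rotSin n (half x v) * inner ℝ (mid x v) b) • dir v

section

variable {x v : V}

/-- By `mul_coefE`, `etaD` has a transparent shape: it multiplies vectors orthogonal to the plane of
motion by `coefB`, sends `dir v` to `dirN n x v` and `mid x v` to `coefD • midN n x v`. Writing it
with `coefE` avoids dividing by `‖mid x v‖²`, which vanishes for chords through the center. -/
lemma hasDirDeriv_etaN (n : ℕ) (hx : ‖x‖ < 1) (hv : v ≠ 0) :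
    HasDirDeriv (etaN n x) (etaD n x v) v := by
  have hc := hasDirDeriv_half hx hv
  have hu := hasDirDeriv_pos n hx hv
  have hC := hasDirDeriv_rotCos n hx hv
  have hS := hasDirDeriv_rotSin n hx hv
  have h := ((hC.sub (hu.mul hS)).smul (hasDirDeriv_mid (x := x) hv)).add
    (((hu.mul hC).add (((HasDirDeriv.const 1 v).sub (hc.mul hc)).mul hS)).smul
      (hasDirDeriv_dir hv))
  simp only [← sq] at h
  refine h.congr fun a => ?_
  have hg := mul_rotSinDeriv n (half x v)
  have hc0 := (half_pos hx v).ne'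
  have hN : ‖v‖ ≠ 0 := norm_ne_zero_iff.2 hv
  simp only [etaD, coefB, coefD, coefE, midD, dirD, posD, halfD, alongD]
  generalize rotSinDeriv (half x v) n = G at *
  generalize rotSin n (half x v) = S at *
  generalize rotCos n (half x v) = C at *
  generalize half x v = c at *
  generalize ‖v‖ = N at *
  generalize (inner ℝ (mid x v) a : ℝ) = am at *
  generalize (inner ℝ (dir v) a : ℝ) = av at *
  generalize pos n x v = u at *
  generalize along x v = μ at *
  match_scalars
  · field_simp
    ring
  · field_simp
    linear_combination (am * μ) * hg
  · field_simp
    ring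

end

/-! ### Scalar estimates after at least two reflections -/

lemma abs_mul_le_of_le {a b A B : ℝ} (ha : |a| ≤ A) (hb : |b| ≤ B) : |a * b| ≤ A * B := by
  rw [abs_mul]
  exact mul_le_mul ha hb (abs_nonneg _) ((abs_nonneg _).trans ha)

lemma abs_add_le_of_le {a b A B : ℝ} (ha : |a| ≤ A) (hb : |b| ≤ B) : |a + b| ≤ A + B :=
  (abs_add_le _ _).trans (add_le_add ha hb)

lemma abs_sub_le_of_le {a b A B : ℝ} (ha : |a| ≤ A) (hb : |b| ≤ B) : |a - b| ≤ A + B :=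
  (abs_sub _ _).trans (add_le_add ha hb)

/-- Bounds for the scalars that describe a trajectory with at least two reflections (`k` is the
inverse of the speed, `i` the inverse of the half-length `c` of a chord, `w` the distance of the
chord from the center) and for the derivatives `μ'`, `c'`, `av` of `μ`, `c` and of the speed. -/
structure ChordBounds (n c w k i u μ S C G H μ' c' av : ℝ) : Prop where
  hn : 2 ≤ n
  hc : 0 < c
  hc1 : c ≤ 1
  hw : 0 ≤ w
  hw2 : w ^ 2 = 1 - c ^ 2
  hk : 0 < k
  hi : c * i = 1
  hnck : n * c * k ≤ 1
  hu : |u| ≤ c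
  hμ : |μ| ≤ c
  hC : |C| ≤ 1
  hwS : w * |S| ≤ 1
  hS : |S| ≤ 2 * n * c
  hwG : w * |G| ≤ 2 * n ^ 2
  hw2G : w ^ 2 * |G| ≤ 4 * n
  hw3H : w ^ 3 * |H| ≤ 11 * n ^ 2
  hμ' : |μ'| ≤ w * k
  hc' : |c'| ≤ w * k
  hav : |av| ≤ 1

namespace ChordBounds

variable {n c w k i u μ S C G H μ' c' av : ℝ}


lemma one_le_i (h : ChordBounds n c w k i u μ S C G H μ' c' av) : 1 ≤ i := by
  nlinarith [h.hi, h.hc, h.hc1]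

lemma w_le_one (h : ChordBounds n c w k i u μ S C G H μ' c' av) : w ≤ 1 := by
  nlinarith [h.hw2, h.hw, h.hc]

/-- The number of reflections is paid for by the speed: in all estimates below a factor `n` is
absorbed by `k`, at the price of `i`, or of nothing if a factor `c` is present as well. -/
lemma nk_le (h : ChordBounds n c w k i u μ S C G H μ' c' av) : n * k ≤ i := by
  have : n * k = (n * c * k) * i := by linear_combination (-n * k) * h.hi
  rw [this]
  nlinarith [h.hnck, h.one_le_i]

lemma two_mul_k_le (h : ChordBounds n c w k i u μ S C G H μ' c' av) : 2 * k ≤ i := by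
  nlinarith [h.nk_le, h.hn, h.hk]

lemma k_le (h : ChordBounds n c w k i u μ S C G H μ' c' av) : k ≤ i := by
  nlinarith [h.two_mul_k_le, h.hk]

lemma ck_le (h : ChordBounds n c w k i u μ S C G H μ' c' av) : c * k ≤ 1 := by
  nlinarith [h.hnck, h.hn, mul_pos h.hc h.hk]

lemma abs_μ'_le (h : ChordBounds n c w k i u μ S C G H μ' c' av) : |μ'| ≤ k := by
  nlinarith [h.hμ', h.w_le_one, h.hk]

lemma abs_c'_le (h : ChordBounds n c w k i u μ S C G H μ' c' av) : |c'| ≤ k := by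
  nlinarith [h.hc', h.w_le_one, h.hk]

lemma abs_S_mul_c'_le (h : ChordBounds n c w k i u μ S C G H μ' c' av) : |S * c'| ≤ k := by
  rw [abs_mul]
  calc |S| * |c'| ≤ |S| * (w * k) := by gcongr; exact h.hc'
    _ = (w * |S|) * k := by ring
    _ ≤ 1 * k := by have := h.hk; gcongr; exact h.hwS
    _ = k := one_mul k

lemma abs_C'_le (h : ChordBounds n c w k i u μ S C G H μ' c' av) :
    |-(2 * n) * S * c'| ≤ 2 * (n * k) := by
  have hn := h.hn
  have : |-(2 * n)| ≤ 2 * n := by rw [abs_neg, abs_of_nonneg (by linarith)]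
  rw [mul_assoc]
  refine (abs_mul_le_of_le this h.abs_S_mul_c'_le).trans_eq (by ring)

lemma abs_u'_le (h : ChordBounds n c w k i u μ S C G H μ' c' av) :
    |μ' + av - 2 * n * c'| ≤ 4 * i := by
  have hn := h.hn
  have h2 : |2 * n| ≤ 2 * n := by rw [abs_of_nonneg (by linarith)]
  refine (abs_sub_le_of_le (abs_add_le_of_le h.abs_μ'_le h.hav)
    (abs_mul_le_of_le h2 h.abs_c'_le)).trans ?_
  nlinarith [h.nk_le, h.k_le, h.one_le_i, h.two_mul_k_le]

lemma abs_B_le (h : ChordBounds n c w k i u μ S C G H μ' c' av) :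
    |(u * C + (1 - c ^ 2) * S - μ * (C - u * S)) * k| ≤ 3 := by
  have hc := h.hc
  -- `|μ u| ≤ c²` puts the expression between `1 - 2c²` and `1`.
  have h1 : |1 - c ^ 2 + μ * u| ≤ 1 := by
    have := abs_mul_le_of_le h.hμ h.hu
    have := h.hw2
    rw [abs_le] at *
    constructor <;> nlinarith [sq_nonneg w]
  have e : u * C + (1 - c ^ 2) * S - μ * (C - u * S) =
    (u * C - μ * C) + (1 - c ^ 2 + μ * u) * S := by ring
  rw [e]
  refine (abs_mul_le_of_le (abs_add_le_of_le (abs_sub_le_of_le (abs_mul_le_of_le h.hu h.hC)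
    (abs_mul_le_of_le h.hμ h.hC)) (abs_mul_le_of_le h1 h.hS)) (abs_of_pos h.hk).le).trans ?_
  nlinarith [h.hnck, h.hn, mul_pos h.hc h.hk]

lemma abs_D_le (h : ChordBounds n c w k i u μ S C G H μ' c' av) :
    |(u - (2 * n * u * i + 1) * μ) * k| ≤ 3 := by
  have hn := h.hn
  have hi : 0 ≤ i := zero_le_one.trans h.one_le_i
  have h2 : |2 * n| ≤ 2 * n := by rw [abs_of_nonneg (by linarith)]
  have h1 : |2 * n * u * i + 1| ≤ 2 * n * c * i + 1 :=
    abs_add_le_of_le (abs_mul_le_of_le (abs_mul_le_of_le h2 h.hu) (abs_of_nonneg hi).le)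
      abs_one.le
  refine (abs_mul_le_of_le (abs_sub_le_of_le h.hu (abs_mul_le_of_le h1 h.hμ))
    (abs_of_pos h.hk).le).trans ?_
  have e : (c + (2 * n * c * i + 1) * c) * k = 2 * (c * k) + 2 * (n * c * k) * (c * i) := by ring
  rw [e, h.hi]
  nlinarith [h.hnck, h.hn, mul_pos h.hc h.hk]

lemma abs_u_mul_i_le (h : ChordBounds n c w k i u μ S C G H μ' c' av) : |u * i| ≤ 1 :=
  (abs_mul_le_of_le h.hu (abs_of_nonneg (zero_le_one.trans h.one_le_i)).le).trans_eq h.hi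

lemma abs_E_aux (h : ChordBounds n c w k i u μ S C G H μ' c' av) :
    |(u * i * μ * G + S) * k| ≤ (c * |G| + |S|) * k := by
  refine (abs_mul_le_of_le (abs_add_le_of_le (abs_mul_le_of_le (abs_mul_le_of_le
    h.abs_u_mul_i_le h.hμ) le_rfl) le_rfl) (abs_of_pos h.hk).le).trans_eq (by ring)

lemma sq_mul_abs_E_le (h : ChordBounds n c w k i u μ S C G H μ' c' av) :
    w ^ 2 * |(u * i * μ * G + S) * k| ≤ 6 := by
  have hk := h.hk
  have hc := h.hc
  have hw := h.hw
  have hw1 : w ^ 2 ≤ 1 := by nlinarith [h.w_le_one]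
  calc w ^ 2 * |(u * i * μ * G + S) * k| ≤ w ^ 2 * ((c * |G| + |S|) * k) := by
        gcongr; exact h.abs_E_aux
    _ = (c * (w ^ 2 * |G|) + w ^ 2 * |S|) * k := by ring
    _ ≤ (c * (4 * n) + 1 * (2 * n * c)) * k := by
        have h1 := h.hw2G
        have h2 := h.hS
        gcongr
    _ = 6 * (n * c * k) := by ring
    _ ≤ 6 := by linarith [h.hnck]

/-- Trades one factor `w` of `sq_mul_abs_E_le` for `c k`. This is the form needed when `coefE` meets
the part `along • dirD` of `midD`, which is bounded by `c k` without a factor `w`. -/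
lemma mul_abs_E_mul_le (h : ChordBounds n c w k i u μ S C G H μ' c' av) :
    w * |(u * i * μ * G + S) * k| * (c * k) ≤ 3 := by
  have hk := h.hk
  have hc := h.hc
  have hw := h.hw
  calc w * |(u * i * μ * G + S) * k| * (c * k) ≤ w * ((c * |G| + |S|) * k) * (c * k) := by
        gcongr; exact h.abs_E_aux
    _ = (c * (w * |G|) + w * |S|) * k * (c * k) := by ring
    _ ≤ (c * (2 * n ^ 2) + 1 * (2 * n * c)) * k * (c * k) := by
        have h1 := h.hwG
        have h2 := h.hS
        have h3 := h.w_le_one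
        gcongr
    _ = 2 * (n * c * k) ^ 2 + 2 * (n * c * k) * (c * k) := by ring
    _ ≤ 3 := by
        have h1 : n * c * k * (c * k) ≤ 1 / 2 := by
          have : c * k ≤ 1 / 2 := by nlinarith [h.hnck, h.hn, mul_pos h.hc h.hk]
          calc n * c * k * (c * k) ≤ 1 * (1 / 2) := by gcongr; exact h.hnck
            _ = 1 / 2 := by ring
        have h2 : (n * c * k) ^ 2 ≤ 1 := pow_le_one₀ (by have := h.hn; positivity) h.hnck
        linarith

lemma mul_abs_G_mul_c'_le (h : ChordBounds n c w k i u μ S C G H μ' c' av) :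
    |G * c'| * w ≤ 4 * i := by
  have hk := h.hk
  have hw := h.hw
  rw [abs_mul]
  calc |G| * |c'| * w ≤ |G| * (w * k) * w := by gcongr; exact h.hc'
    _ = (w ^ 2 * |G|) * k := by ring
    _ ≤ 4 * n * k := mul_le_mul_of_nonneg_right h.hw2G hk.le
    _ ≤ 4 * i := by linarith [h.nk_le]

/-- The coefficient of the identity loses one power of the chord length when differentiated, whereas
those of `abs_D'_le` and `sq_mul_abs_E'_le` lose two. This gap is what makes the singular part
directional. -/
lemma abs_B'_le (h : ChordBounds n c w k i u μ S C G H μ' c' av) {B : ℝ} (hB : |B| ≤ 3) :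
    |(av * C - c * c' * S + (u - μ) * (-(2 * n) * S * c') + μ' * u * S +
      μ * (μ' + av - 2 * n * c') * S + μ * u * (G * c') - B * av) * k| ≤ 20 * i := by
  have hc := h.hc
  have hk := h.hk
  have hw := h.hw
  have hn := h.hn
  have hi := h.one_le_i
  have t1 : |av * C| ≤ 1 * 1 := abs_mul_le_of_le h.hav h.hC
  have t2 : |c * c' * S| ≤ c * k := by
    rw [mul_assoc, mul_comm c']
    exact abs_mul_le_of_le (abs_of_pos hc).le h.abs_S_mul_c'_le
  have t3 : |(u - μ) * (-(2 * n) * S * c')| ≤ (c + c) * (2 * (n * k)) :=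
    abs_mul_le_of_le (abs_sub_le_of_le h.hu h.hμ) h.abs_C'_le
  have t4 : |μ' * u * S| ≤ c * k := by
    rw [abs_mul, abs_mul]
    calc |μ'| * |u| * |S| ≤ w * k * c * |S| := by gcongr; exacts [h.hμ', h.hu]
      _ = (w * |S|) * (c * k) := by ring
      _ ≤ 1 * (c * k) := by gcongr; exact h.hwS
      _ = c * k := one_mul _
  have t5 : |μ * (μ' + av - 2 * n * c') * S| ≤ c * (4 * i) * (2 * n * c) :=
    abs_mul_le_of_le (abs_mul_le_of_le h.hμ h.abs_u'_le) h.hS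
  have t6 : |μ * u * (G * c')| ≤ c * c * (2 * n ^ 2 * k) := by
    refine abs_mul_le_of_le (abs_mul_le_of_le h.hμ h.hu) ?_
    rw [abs_mul]
    calc |G| * |c'| ≤ |G| * (w * k) := by gcongr; exact h.hc'
      _ = w * |G| * k := by ring
      _ ≤ 2 * n ^ 2 * k := mul_le_mul_of_nonneg_right h.hwG hk.le
  have t7 : |B * av| ≤ 3 * 1 := abs_mul_le_of_le hB h.hav
  refine (abs_mul_le_of_le (abs_sub_le_of_le (abs_add_le_of_le (abs_add_le_of_le
    (abs_add_le_of_le (abs_add_le_of_le (abs_sub_le_of_le t1 t2) t3) t4) t5) t6) t7)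
    (abs_of_pos hk).le).trans ?_
  have e : (1 * 1 + c * k + (c + c) * (2 * (n * k)) + c * k + c * (4 * i) * (2 * n * c) +
      c * c * (2 * n ^ 2 * k) + 3 * 1) * k = 4 * k + 2 * (c * k * k) + 4 * (n * c * k) * k +
      8 * (c * i) * (n * c * k) + 2 * (n * c * k) ^ 2 := by ring
  rw [e, h.hi]
  have h1 : (n * c * k) ^ 2 ≤ 1 := pow_le_one₀ (by positivity) h.hnck
  have h2 : c * k * k ≤ k := by nlinarith [h.ck_le]
  have h3 : n * c * k * k ≤ k := by nlinarith [h.hnck]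
  linarith [h.hnck, h.two_mul_k_le]

/-- Two powers of `i` appear because `D` contains `u i`: the derivative of `u` is already of order
`i`, and so is the relative change of `c`. -/
lemma abs_D'_le (h : ChordBounds n c w k i u μ S C G H μ' c' av) {D : ℝ} (hD : |D| ≤ 3) :
    |((μ' + av - 2 * n * c') - 2 * n * ((μ' + av - 2 * n * c') * i - u * i * i * c') * μ -
      (2 * n * u * i + 1) * μ' - D * av) * k| ≤ 20 * i ^ 2 := by
  have hc := h.hc
  have hk := h.hk
  have hn := h.hn
  have hi := h.one_le_i
  have hi0 : 0 ≤ i := by linarith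
  have h2 : |2 * n| ≤ 2 * n := by rw [abs_of_nonneg (by linarith)]
  have t1 := h.abs_u'_le
  have t2 : |u * i * i * c'| ≤ 1 * i * k :=
    abs_mul_le_of_le (abs_mul_le_of_le h.abs_u_mul_i_le (abs_of_nonneg hi0).le) h.abs_c'_le
  have t3 := abs_mul_le_of_le (abs_mul_le_of_le h2 (abs_sub_le_of_le
    (abs_mul_le_of_le t1 (abs_of_nonneg hi0).le) t2)) h.hμ
  have t4 : |(2 * n * u * i + 1) * μ'| ≤ (2 * n * 1 + 1) * k := by
    refine abs_mul_le_of_le (abs_add_le_of_le ?_ abs_one.le) h.abs_μ'_le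
    rw [mul_assoc]
    exact abs_mul_le_of_le h2 h.abs_u_mul_i_le
  have t5 : |D * av| ≤ 3 * 1 := abs_mul_le_of_le hD h.hav
  refine (abs_mul_le_of_le (abs_sub_le_of_le (abs_sub_le_of_le (abs_sub_le_of_le t1 t3) t4) t5)
    (abs_of_pos hk).le).trans ?_
  have e : (4 * i + 2 * n * (4 * i * i + 1 * i * k) * c + (2 * n * 1 + 1) * k + 3 * 1) * k =
      4 * i * k + 8 * (c * i) * (n * k) * i + 2 * (c * i) * (n * k) * k + 2 * (n * k) * k + k * k +
        3 * k := by ring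
  rw [e, h.hi]
  have h3 : k * k ≤ i * i := mul_le_mul h.k_le h.k_le hk.le hi0
  have h4 : n * k * k ≤ i * i := mul_le_mul h.nk_le h.k_le hk.le hi0
  have h5 : n * k * i ≤ i * i := mul_le_mul h.nk_le le_rfl hi0 hi0
  have h6 : i * k ≤ i * i := mul_le_mul le_rfl h.k_le hk.le hi0
  nlinarith [h.k_le]

lemma sq_mul_abs_E'_le (h : ChordBounds n c w k i u μ S C G H μ' c' av) {E : ℝ}
    (hE : w ^ 2 * |E| ≤ 6) :
    w ^ 2 * |(((μ' + av - 2 * n * c') * i - u * i * i * c') * μ * G + u * i * μ' * G +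
      u * i * μ * (H * c') + G * c' + E * av) * k| ≤ 45 * i ^ 2 := by
  have hc := h.hc
  have hk := h.hk
  have hw := h.hw
  have hn := h.hn
  have hi := h.one_le_i
  have hi0 : 0 ≤ i := by linarith
  have t2 : |u * i * i * c'| ≤ 1 * i * k :=
    abs_mul_le_of_le (abs_mul_le_of_le h.abs_u_mul_i_le (abs_of_nonneg hi0).le) h.abs_c'_le
  have t3 : |((μ' + av - 2 * n * c') * i - u * i * i * c') * μ * G| ≤
      (4 * i * i + 1 * i * k) * c * |G| :=
    abs_mul_le_of_le (abs_mul_le_of_le (abs_sub_le_of_le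
      (abs_mul_le_of_le h.abs_u'_le (abs_of_nonneg hi0).le) t2) h.hμ) le_rfl
  have t4 : |u * i * μ' * G| ≤ 1 * k * |G| :=
    abs_mul_le_of_le (abs_mul_le_of_le h.abs_u_mul_i_le h.abs_μ'_le) le_rfl
  have t5 : |u * i * μ * (H * c')| ≤ 1 * c * (|H| * (w * k)) :=
    abs_mul_le_of_le (abs_mul_le_of_le h.abs_u_mul_i_le h.hμ) (abs_mul_le_of_le le_rfl h.hc')
  have t6 : |G * c'| ≤ |G| * k := abs_mul_le_of_le le_rfl h.abs_c'_le
  have t7 : |E * av| ≤ |E| * 1 := abs_mul_le_of_le le_rfl h.hav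
  have h3 : n * k * k ≤ i * i := mul_le_mul h.nk_le h.k_le hk.le hi0
  have h5 : n * k * i ≤ i * i := mul_le_mul h.nk_le le_rfl hi0 hi0
  calc _ ≤ w ^ 2 * (((4 * i * i + 1 * i * k) * c * |G| + 1 * k * |G| + 1 * c * (|H| * (w * k)) +
        |G| * k + |E| * 1) * k) := by
        gcongr
        exact abs_mul_le_of_le (abs_add_le_of_le (abs_add_le_of_le (abs_add_le_of_le
          (abs_add_le_of_le t3 t4) t5) t6) t7) (abs_of_pos hk).le
    _ = ((4 * (c * i) * i + c * i * k + 2 * k) * (w ^ 2 * |G|) + c * k * (w ^ 3 * |H|) +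
        w ^ 2 * |E|) * k := by ring
    _ ≤ ((4 * 1 * i + 1 * k + 2 * k) * (4 * n) + c * k * (11 * n ^ 2) + 6) * k := by
        have h1 := h.hw2G
        have h2 := h.hw3H
        rw [h.hi]
        gcongr
    _ = 16 * (n * k * i) + 12 * (n * k * k) + 11 * (n * c * k * (n * k)) + 6 * k := by ring
    _ ≤ 16 * (i * i) + 12 * (i * i) + 11 * (1 * i) + 6 * i := by
        have h1 := h.hnck
        have h2 := h.nk_le
        have h4 := h.k_le
        gcongr
    _ ≤ 45 * i ^ 2 := by nlinarith

end ChordBounds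

variable {V : Type*} [NormedAddCommGroup V] [InnerProductSpace ℝ V] {x v : V}

/-! ### The second derivative of the smooth branches -/

/-- The derivative of `coefB n x` at `v` in direction `a`. -/
noncomputable def coefBD (n : ℕ) (x v a : V) : ℝ :=
  (inner ℝ (dir v) a * rotCos n (half x v) - half x v * halfD x v a * rotSin n (half x v) +
    (pos n x v - along x v) * (-(2 * n) * rotSin n (half x v) * halfD x v a) +
    alongD x v a * pos n x v * rotSin n (half x v) +
    along x v * posD n x v a * rotSin n (half x v) +
    along x v * pos n x v * (rotSinDeriv (half x v) n * halfD x v a) -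
    coefB n x v * inner ℝ (dir v) a) * ‖v‖⁻¹

/-- The derivative of `coefD n x` at `v` in direction `a`. -/
noncomputable def coefDD (n : ℕ) (x v a : V) : ℝ :=
  (posD n x v a - 2 * n * (posD n x v a * (half x v)⁻¹ -
    pos n x v * (half x v)⁻¹ * (half x v)⁻¹ * halfD x v a) * along x v -
    (2 * n * pos n x v * (half x v)⁻¹ + 1) * alongD x v a - coefD n x v * inner ℝ (dir v) a) *
    ‖v‖⁻¹

/-- The derivative of `coefE n x` at `v` in direction `a`. -/
noncomputable def coefED (n : ℕ) (x v a : V) : ℝ :=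
  -(((posD n x v a * (half x v)⁻¹ - pos n x v * (half x v)⁻¹ * (half x v)⁻¹ * halfD x v a) *
    along x v * rotSinDeriv (half x v) n +
    pos n x v * (half x v)⁻¹ * alongD x v a * rotSinDeriv (half x v) n +
    pos n x v * (half x v)⁻¹ * along x v * (rotSinDeriv₂ (half x v) n * halfD x v a) +
    rotSinDeriv (half x v) n * halfD x v a + coefE n x v * inner ℝ (dir v) a) * ‖v‖⁻¹)

lemma hasDirDeriv_half_inv (hx : ‖x‖ < 1) (hv : v ≠ 0) : HasDirDeriv (fun w => (half x w)⁻¹)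
    (fun a => -((half x v)⁻¹ * (half x v)⁻¹) * halfD x v a) v :=
  (HasDirDeriv.scomp (hasDerivAt_inv (half_pos hx v).ne') (hasDirDeriv_half hx hv)).congr
    fun a => by rw [← mul_inv, sq]

lemma hasDirDeriv_coefB (n : ℕ) (hx : ‖x‖ < 1) (hv : v ≠ 0) :
    HasDirDeriv (coefB n x) (coefBD n x v) v := by
  have hc := hasDirDeriv_half hx hv
  have hu := hasDirDeriv_pos n hx hv
  have hC := hasDirDeriv_rotCos n hx hv
  have hS := hasDirDeriv_rotSin n hx hv
  have hμ := hasDirDeriv_along (x := x) hv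
  have h := (((hu.mul hC).add (((HasDirDeriv.const 1 v).sub (hc.mul hc)).mul hS)).sub
    (hμ.mul (hC.sub (hu.mul hS)))).mul (hasDirDeriv_norm_inv hv)
  simp only [← sq (half x _)] at h
  refine h.congr fun a => ?_
  have hg := mul_rotSinDeriv n (half x v)
  simp only [coefBD, coefB]
  rw [show posD n x v a = alongD x v a + inner ℝ (dir v) a - 2 * n * halfD x v a from rfl]
  linear_combination (‖v‖⁻¹ * halfD x v a) * hg

lemma hasDirDeriv_coefD (n : ℕ) (hx : ‖x‖ < 1) (hv : v ≠ 0) :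
    HasDirDeriv (coefD n x) (coefDD n x v) v := by
  have hc := hasDirDeriv_half_inv hx hv
  have hu := hasDirDeriv_pos n hx hv
  have hμ := hasDirDeriv_along (x := x) hv
  have h := (hu.sub ((((hu.const_mul (2 * n)).mul hc).add (HasDirDeriv.const 1 v)).mul hμ)).mul
    (hasDirDeriv_norm_inv hv)
  refine h.congr fun a => ?_
  simp only [coefDD, coefD]
  ring

lemma hasDirDeriv_coefE (n : ℕ) (hx : ‖x‖ < 1) (hv : v ≠ 0) :
    HasDirDeriv (coefE n x) (coefED n x v) v := by
  have hc := hasDirDeriv_half_inv hx hv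
  have hu := hasDirDeriv_pos n hx hv
  have hS := hasDirDeriv_rotSin n hx hv
  have hG := hasDirDeriv_rotSinDeriv n hx hv
  have hμ := hasDirDeriv_along (x := x) hv
  have h := (((hu.mul hc).mul hμ).mul hG).add hS |>.neg.mul (hasDirDeriv_norm_inv hv)
  refine h.congr fun a => ?_
  simp only [coefED, coefE]
  ring

/-- Since `‖mid x v‖² = 1 - half x v ^ 2`, this says that `coefE` continues `(coefD · C - coefB) /
‖mid‖²` through `mid = 0`. It lets the `coefD` terms of `etaD` combine into a multiple of `midN`. -/
lemma mul_coefE (n : ℕ) (hx : ‖x‖ < 1) (v : V) :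
    (1 - half x v ^ 2) * coefE n x v = coefD n x v * rotCos n (half x v) - coefB n x v := by
  have hg := mul_rotSinDeriv n (half x v)
  have hc := mul_inv_cancel₀ (half_pos hx v).ne'
  rw [coefE, coefD, coefB]
  linear_combination (-(pos n x v * (half x v)⁻¹ * along x v) * ‖v‖⁻¹) * hg -
    (pos n x v * along x v * rotSin n (half x v) * ‖v‖⁻¹) * hc

/-- The derivative of `mul_coefE`, obtained by differentiating its two sides and comparing. -/
lemma mul_coefED (n : ℕ) (hx : ‖x‖ < 1) (hv : v ≠ 0) (a : V) :
    (1 - half x v ^ 2) * coefED n x v a = coefDD n x v a * rotCos n (half x v) +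
      coefD n x v * (-(2 * n) * rotSin n (half x v) * halfD x v a) - coefBD n x v a +
      2 * half x v * halfD x v a * coefE n x v := by
  have hc := hasDirDeriv_half hx hv
  have h1 := ((HasDirDeriv.const 1 v).sub (hc.mul hc)).mul (hasDirDeriv_coefE n hx hv)
  have h2 := ((hasDirDeriv_coefD n hx hv).mul (hasDirDeriv_rotCos n hx hv)).sub
    (hasDirDeriv_coefB n hx hv)
  have e : (fun w => (1 - half x w * half x w) * coefE n x w) =
      fun w => coefD n x w * rotCos n (half x w) - coefB n x w := by
    funext w; rw [← mul_coefE n hx w]; ring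
  rw [e] at h1
  have := (h1.fderiv_apply a).symm.trans (h2.fderiv_apply a)
  linear_combination this

/-- The derivative of `etaD n x · b` at `v` in direction `a`. -/
noncomputable def etaDD (n : ℕ) (x v a b : V) : V :=
  coefBD n x v a • b +
    ((-(2 * n) * rotSin n (half x v) * halfD x v a - coefBD n x v a) * inner ℝ (dir v) b) • dir v +
    ((rotCos n (half x v) - coefB n x v) * inner ℝ (dirD v a) b) • dir v +
    ((rotCos n (half x v) - coefB n x v) * inner ℝ (dir v) b) • dirD v a -
    (rotSinDeriv (half x v) n * halfD x v a * inner ℝ (dir v) b) • mid x v -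
    (rotSin n (half x v) * inner ℝ (dirD v a) b) • mid x v -
    (rotSin n (half x v) * inner ℝ (dir v) b) • midD x v a +
    (coefED n x v a * inner ℝ (mid x v) b) • mid x v +
    (coefE n x v * inner ℝ (midD x v a) b) • mid x v +
    (coefE n x v * inner ℝ (mid x v) b) • midD x v a +
    (coefDD n x v a * rotSin n (half x v) * inner ℝ (mid x v) b) • dir v +
    (coefD n x v * (rotSinDeriv (half x v) n * halfD x v a) * inner ℝ (mid x v) b) • dir v +
    (coefD n x v * rotSin n (half x v) * inner ℝ (midD x v a) b) • dir v +
    (coefD n x v * rotSin n (half x v) * inner ℝ (mid x v) b) • dirD v a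

lemma hasDirDeriv_etaD (n : ℕ) (hx : ‖x‖ < 1) (hv : v ≠ 0) (b : V) :
    HasDirDeriv (fun w => etaD n x w b) (fun a => etaDD n x v a b) v := by
  have hB := hasDirDeriv_coefB n hx hv
  have hD := hasDirDeriv_coefD n hx hv
  have hE := hasDirDeriv_coefE n hx hv
  have hC := hasDirDeriv_rotCos n hx hv
  have hS := hasDirDeriv_rotSin n hx hv
  have hp := hasDirDeriv_dir hv
  have hm := hasDirDeriv_mid (x := x) hv
  have hpb := hp.inner_const b
  have hmb := hm.inner_const b
  have h := ((((hB.smul (HasDirDeriv.const b v)).add (((hC.sub hB).mul hpb).smul hp)).sub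
    ((hS.mul hpb).smul hm)).add ((hE.mul hmb).smul hm)).add (((hD.mul hS).mul hmb).smul hp)
  refine h.congr fun a => ?_
  rw [etaDD]
  module

/-! ### Estimates -/

lemma abs_inner_le_of_unit {p b : V} {r : ℝ} (hb : ‖b‖ = 1) (hp : ‖p‖ ≤ r) :
    |inner ℝ p b| ≤ r :=
  (abs_real_inner_le_norm p b).trans (by rwa [hb, mul_one])

lemma norm_sub_inner_smul_le {p : V} (hp : ‖p‖ = 1) (a : V) : ‖a - inner ℝ p a • p‖ ≤ ‖a‖ := by
  have h : ‖a - inner ℝ p a • p‖ ^ 2 = ‖a‖ ^ 2 - (inner ℝ p a) ^ 2 := by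
    rw [norm_sub_sq_real, real_inner_smul_right, norm_smul, hp, real_inner_comm, Real.norm_eq_abs,
      mul_one, sq_abs]
    ring
  refine (sq_le_sq₀ (norm_nonneg _) (norm_nonneg _)).1 ?_
  nlinarith [sq_nonneg (inner ℝ p a)]

lemma norm_dirD_le (hv : v ≠ 0) {a : V} (ha : ‖a‖ = 1) : ‖dirD v a‖ ≤ ‖v‖⁻¹ := by
  rw [dirD, norm_smul, norm_inv, norm_norm]
  exact mul_le_of_le_one_right (by positivity) (ha ▸ norm_sub_inner_smul_le (norm_dir hv) a)

lemma abs_alongD_le (x v : V) {a : V} (ha : ‖a‖ = 1) : |alongD x v a| ≤ ‖mid x v‖ * ‖v‖⁻¹ := by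
  rw [alongD, abs_mul, abs_of_nonneg (inv_nonneg.2 (norm_nonneg v))]
  gcongr
  exact abs_inner_le_of_unit ha le_rfl

lemma norm_midD_le (hx : ‖x‖ < 1) (hv : v ≠ 0) {a : V} (ha : ‖a‖ = 1) :
    ‖midD x v a‖ ≤ ‖mid x v‖ * ‖v‖⁻¹ + half x v * ‖v‖⁻¹ := by
  rw [midD, norm_neg]
  refine norm_add_le_of_le ?_ ?_
  · rw [norm_smul, norm_dir hv, mul_one]
    exact abs_alongD_le x v ha
  · rw [norm_smul]
    exact mul_le_mul (abs_along_lt hx v).le (norm_dirD_le hv ha) (norm_nonneg _)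
      (half_pos hx v).le

lemma abs_halfD_le (hx : ‖x‖ < 1) (v : V) {a : V} (ha : ‖a‖ = 1) :
    |halfD x v a| ≤ ‖mid x v‖ * ‖v‖⁻¹ := by
  have hc := half_pos hx v
  have h1 : |along x v * (half x v)⁻¹| ≤ 1 := by
    rw [← div_eq_mul_inv, abs_div, abs_of_pos hc]
    exact (div_le_one hc).2 (abs_along_lt hx v).le
  rw [halfD, abs_mul]
  exact (mul_le_of_le_one_left (abs_nonneg _) h1).trans (abs_alongD_le x v ha)

/-- From `pos n ≥ -c` and `along ≤ c`, `‖v‖ ≥ 2(n-1)c ≥ n c`. The last step needs `n ≥ 2`; a single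
reflection of a particle close to the boundary can occur at a speed far below `c`. -/
lemma mul_half_le_norm {n : ℕ} (hn : 2 ≤ n) (hx : ‖x‖ < 1) (hu : |pos n x v| ≤ half x v) :
    n * half x v ≤ ‖v‖ := by
  have hn' : (2 : ℝ) ≤ n := by exact_mod_cast hn
  have h1 := (abs_le.1 hu).1
  have h2 := (abs_le.1 (abs_along_lt hx v).le).2
  rw [pos] at h1
  nlinarith [half_pos hx v]

lemma chordBounds {n : ℕ} (hn : 2 ≤ n) (hx : ‖x‖ < 1) (hv : v ≠ 0) (hu : |pos n x v| ≤ half x v)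
    {a : V} (ha : ‖a‖ = 1) :
    ChordBounds n (half x v) ‖mid x v‖ ‖v‖⁻¹ (half x v)⁻¹ (pos n x v) (along x v)
      (rotSin n (half x v)) (rotCos n (half x v)) (rotSinDeriv (half x v) n)
      (rotSinDeriv₂ (half x v) n) (alongD x v a) (halfD x v a) (inner ℝ (dir v) a) := by
  have hc := half_pos hx v
  have hc1 := half_le_one x v
  have hw := norm_nonneg (mid x v)
  have hw2 := norm_mid_sq_eq hx hv
  have hN := norm_pos_iff.2 hv
  exact {
    hn := by exact_mod_cast hn
    hc := hc
    hc1 := hc1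
    hw := hw
    hw2 := hw2
    hk := inv_pos.2 hN
    hi := mul_inv_cancel₀ hc.ne'
    hnck := by
      rw [← div_eq_mul_inv]
      exact (div_le_one hN).2 (mul_half_le_norm hn hx hu)
    hu := hu
    hμ := (abs_along_lt hx v).le
    hC := abs_rotCos_le (by rwa [abs_of_pos hc]) n
    hwS := mul_abs_rotSin_le hw hw2 n
    hS := abs_rotSin_le hc.le hc1 n
    hwG := mul_abs_rotSinDeriv_le hw hw2 n
    hw2G := sq_mul_abs_rotSinDeriv_le hc.le hc1 hw2 n
    hw3H := pow_three_mul_abs_rotSinDeriv₂_le hc.le hc1 hw hw2 n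
    hμ' := abs_alongD_le x v ha
    hc' := abs_halfD_le hx v ha
    hav := abs_inner_le_of_unit ha (norm_dir_le v) }

/-! ### First and second derivative after at least two reflections. -/

variable {V : Type*} [NormedAddCommGroup V] [InnerProductSpace ℝ V] {x v : V}

lemma norm_smul_le_of_abs_le {r A B : ℝ} {y : V} (hr : |r| ≤ A) (hy : ‖y‖ ≤ B) :
    ‖r • y‖ ≤ A * B := by
  rw [norm_smul]
  exact mul_le_mul hr hy (norm_nonneg _) ((abs_nonneg r).trans hr)

lemma norm_etaD_le_of_two_le {n : ℕ} (hn : 2 ≤ n) (hx : ‖x‖ < 1) (hv : v ≠ 0)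
    (hu : |pos n x v| ≤ half x v) {b : V} (hb : ‖b‖ = 1) : ‖etaD n x v b‖ ≤ 20 := by
  have h := chordBounds hn hx hv hu hb
  have hB : |coefB n x v| ≤ 3 := h.abs_B_le
  have hD : |coefD n x v| ≤ 3 := h.abs_D_le
  have hE : ‖mid x v‖ ^ 2 * |coefE n x v| ≤ 6 := by
    rw [coefE, neg_mul, abs_neg]; exact h.sq_mul_abs_E_le
  have hbv := h.hav
  have hbm : |inner ℝ (mid x v) b| ≤ ‖mid x v‖ := abs_inner_le_of_unit hb le_rfl
  have hp := (norm_dir hv).le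
  rw [etaD]
  have t1 : ‖coefB n x v • b‖ ≤ 3 * 1 := norm_smul_le_of_abs_le hB hb.le
  have t2 : ‖((rotCos n (half x v) - coefB n x v) * inner ℝ (dir v) b) • dir v‖ ≤
      (1 + 3) * 1 * 1 := norm_smul_le_of_abs_le
    (abs_mul_le_of_le (abs_sub_le_of_le h.hC hB) hbv) hp
  have t3 : ‖(rotSin n (half x v) * inner ℝ (dir v) b) • mid x v‖ ≤ 1 := by
    refine (norm_smul_le_of_abs_le (abs_mul_le_of_le le_rfl hbv) le_rfl).trans ?_
    linarith [h.hwS]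
  have t4 : ‖(coefE n x v * inner ℝ (mid x v) b) • mid x v‖ ≤ 6 := by
    refine (norm_smul_le_of_abs_le (abs_mul_le_of_le le_rfl hbm) le_rfl).trans ?_
    linarith
  have t5 : ‖(coefD n x v * rotSin n (half x v) * inner ℝ (mid x v) b) • dir v‖ ≤ 3 * 1 * 1 := by
    rw [mul_assoc]
    refine norm_smul_le_of_abs_le (abs_mul_le_of_le hD ?_) hp
    refine (abs_mul_le_of_le le_rfl hbm).trans ?_
    linarith [h.hwS]
  exact (norm_add_le_of_le (norm_add_le_of_le (norm_sub_le_of_le (norm_add_le_of_le t1 t2) t3) t4)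
    t5).trans (by norm_num)

/-- The part of `etaDD` that is of the order of the inverse of the length of a chord. -/
noncomputable def etaDDRest (n : ℕ) (x v a b : V) : V :=
  coefBD n x v a • b +
    ((-(2 * n) * rotSin n (half x v) * halfD x v a - coefBD n x v a) * inner ℝ (dir v) b) • dir v +
    ((rotCos n (half x v) - coefB n x v) * inner ℝ (dirD v a) b) • dir v +
    ((rotCos n (half x v) - coefB n x v) * inner ℝ (dir v) b) • dirD v a -
    (rotSinDeriv (half x v) n * halfD x v a * inner ℝ (dir v) b) • mid x v -
    (rotSin n (half x v) * inner ℝ (dirD v a) b) • mid x v -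
    (rotSin n (half x v) * inner ℝ (dir v) b) • midD x v a +
    (coefE n x v * inner ℝ (midD x v a) b) • mid x v +
    (coefE n x v * inner ℝ (mid x v) b) • midD x v a +
    (coefD n x v * (rotSinDeriv (half x v) n * halfD x v a) * inner ℝ (mid x v) b) • dir v +
    (coefD n x v * rotSin n (half x v) * inner ℝ (midD x v a) b) • dir v +
    (coefD n x v * rotSin n (half x v) * inner ℝ (mid x v) b) • dirD v a

/-- Separates the two terms in which `coefE` and `coefD` themselves are differentiated, the only
ones that may be of order `c⁻²`. -/
lemma etaDD_eq (n : ℕ) (x v a b : V) : etaDD n x v a b = etaDDRest n x v a b +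
    ((coefED n x v a * inner ℝ (mid x v) b) • mid x v +
      (coefDD n x v a * rotSin n (half x v) * inner ℝ (mid x v) b) • dir v) := by
  rw [etaDD, etaDDRest]; abel

lemma norm_etaDDRest_le {n : ℕ} (hn : 2 ≤ n) (hx : ‖x‖ < 1) (hv : v ≠ 0)
    (hu : |pos n x v| ≤ half x v) {a b : V} (ha : ‖a‖ = 1) (hb : ‖b‖ = 1) :
    ‖etaDDRest n x v a b‖ ≤ 100 * (half x v)⁻¹ := by
  have h := chordBounds hn hx hv hu ha
  have hB : |coefB n x v| ≤ 3 := h.abs_B_le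
  have hD : |coefD n x v| ≤ 3 := h.abs_D_le
  have hE : ‖mid x v‖ ^ 2 * |coefE n x v| ≤ 6 := by
    rw [coefE, neg_mul, abs_neg]; exact h.sq_mul_abs_E_le
  have hE2 : ‖mid x v‖ * |coefE n x v| * (half x v * ‖v‖⁻¹) ≤ 3 := by
    rw [coefE, neg_mul, abs_neg]; exact h.mul_abs_E_mul_le
  have hB' : |coefBD n x v a| ≤ 20 * (half x v)⁻¹ := h.abs_B'_le hB
  have hbv : |inner ℝ (dir v) b| ≤ 1 := abs_inner_le_of_unit hb (norm_dir_le v)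
  have hbm : |inner ℝ (mid x v) b| ≤ ‖mid x v‖ := abs_inner_le_of_unit hb le_rfl
  have hp := (norm_dir hv).le
  have hp' := norm_dirD_le hv ha
  have hm' := norm_midD_le hx hv ha
  have hbp' : |inner ℝ (dirD v a) b| ≤ ‖v‖⁻¹ := abs_inner_le_of_unit hb hp'
  have hbm' := abs_inner_le_of_unit hb hm'
  have hC := h.hC
  have hwS := h.hwS
  have hSc := h.hS
  have hGc := h.mul_abs_G_mul_c'_le
  have hC' := h.abs_C'_le
  have hi := h.one_le_i
  have hnk := h.nk_le
  have h2k := h.two_mul_k_le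
  have hki := h.k_le
  have hk := h.hk
  have hck := h.ck_le
  have hnck := h.hnck
  have hc := h.hc
  rw [etaDDRest]
  generalize rotSinDeriv (half x v) n = G at *
  generalize rotSin n (half x v) = S at *
  generalize rotCos n (half x v) = C at *
  generalize halfD x v a = c' at *
  generalize coefBD n x v a = B' at *
  generalize coefB n x v = B at *
  generalize coefD n x v = D at *
  generalize coefE n x v = E at *
  have hS2 : |S| * (‖mid x v‖ * ‖v‖⁻¹ + half x v * ‖v‖⁻¹) ≤ 3 * (half x v)⁻¹ := by
    calc |S| * (‖mid x v‖ * ‖v‖⁻¹ + half x v * ‖v‖⁻¹)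
        = (‖mid x v‖ * |S|) * ‖v‖⁻¹ + |S| * (half x v * ‖v‖⁻¹) := by ring
      _ ≤ 1 * ‖v‖⁻¹ + (2 * n * half x v) * (half x v * ‖v‖⁻¹) := by gcongr
      _ = ‖v‖⁻¹ + 2 * half x v * (n * half x v * ‖v‖⁻¹) := by ring
      _ ≤ ‖v‖⁻¹ + 2 * 1 * 1 := by gcongr; exact h.hc1
      _ ≤ 3 * (half x v)⁻¹ := by linarith
  have hEm : |E| * (‖mid x v‖ * ‖v‖⁻¹ + half x v * ‖v‖⁻¹) * ‖mid x v‖ ≤ 9 * (half x v)⁻¹ := by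
    calc |E| * (‖mid x v‖ * ‖v‖⁻¹ + half x v * ‖v‖⁻¹) * ‖mid x v‖
        = (‖mid x v‖ ^ 2 * |E|) * ‖v‖⁻¹ + ‖mid x v‖ * |E| * (half x v * ‖v‖⁻¹) := by ring
      _ ≤ 6 * ‖v‖⁻¹ + 3 := by gcongr
      _ ≤ 9 * (half x v)⁻¹ := by linarith
  have t1 : ‖B' • b‖ ≤ 20 * (half x v)⁻¹ * 1 := norm_smul_le_of_abs_le hB' hb.le
  have t2 : ‖((-(2 * n) * S * c' - B') * inner ℝ (dir v) b) • dir v‖ ≤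
      (2 * (n * ‖v‖⁻¹) + 20 * (half x v)⁻¹) * 1 * 1 :=
    norm_smul_le_of_abs_le (abs_mul_le_of_le (abs_sub_le_of_le hC' hB') hbv) hp
  have t3 : ‖((C - B) * inner ℝ (dirD v a) b) • dir v‖ ≤ (1 + 3) * ‖v‖⁻¹ * 1 :=
    norm_smul_le_of_abs_le (abs_mul_le_of_le (abs_sub_le_of_le hC hB) hbp') hp
  have t4 : ‖((C - B) * inner ℝ (dir v) b) • dirD v a‖ ≤ (1 + 3) * 1 * ‖v‖⁻¹ :=
    norm_smul_le_of_abs_le (abs_mul_le_of_le (abs_sub_le_of_le hC hB) hbv) hp'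
  have t5 : ‖(G * c' * inner ℝ (dir v) b) • mid x v‖ ≤ 4 * (half x v)⁻¹ := by
    refine (norm_smul_le_of_abs_le (abs_mul_le_of_le le_rfl hbv) le_rfl).trans ?_
    rwa [mul_one]
  have t6 : ‖(S * inner ℝ (dirD v a) b) • mid x v‖ ≤ 1 * ‖v‖⁻¹ := by
    refine (norm_smul_le_of_abs_le (abs_mul_le_of_le le_rfl hbp') le_rfl).trans ?_
    calc |S| * ‖v‖⁻¹ * ‖mid x v‖ = (‖mid x v‖ * |S|) * ‖v‖⁻¹ := by ring
      _ ≤ 1 * ‖v‖⁻¹ := by gcongr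
  have t7 : ‖(S * inner ℝ (dir v) b) • midD x v a‖ ≤ 3 * (half x v)⁻¹ := by
    refine (norm_smul_le_of_abs_le (abs_mul_le_of_le le_rfl hbv) hm').trans ?_
    rwa [mul_one]
  have t8 : ‖(E * inner ℝ (midD x v a) b) • mid x v‖ ≤ 9 * (half x v)⁻¹ :=
    (norm_smul_le_of_abs_le (abs_mul_le_of_le le_rfl hbm') le_rfl).trans hEm
  have t9 : ‖(E * inner ℝ (mid x v) b) • midD x v a‖ ≤ 9 * (half x v)⁻¹ := by
    refine (norm_smul_le_of_abs_le (abs_mul_le_of_le le_rfl hbm) hm').trans ?_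
    linarith
  have t10 : ‖(D * (G * c') * inner ℝ (mid x v) b) • dir v‖ ≤ 3 * (4 * (half x v)⁻¹) * 1 := by
    rw [mul_assoc]
    exact norm_smul_le_of_abs_le
      (abs_mul_le_of_le hD ((abs_mul_le_of_le le_rfl hbm).trans hGc)) hp
  have t11 : ‖(D * S * inner ℝ (midD x v a) b) • dir v‖ ≤ 3 * (3 * (half x v)⁻¹) * 1 := by
    rw [mul_assoc]
    exact norm_smul_le_of_abs_le
      (abs_mul_le_of_le hD ((abs_mul_le_of_le le_rfl hbm').trans hS2)) hp
  have t12 : ‖(D * S * inner ℝ (mid x v) b) • dirD v a‖ ≤ 3 * 1 * ‖v‖⁻¹ := by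
    rw [mul_assoc]
    refine norm_smul_le_of_abs_le
      (abs_mul_le_of_le hD ((abs_mul_le_of_le le_rfl hbm).trans ?_)) hp'
    linarith
  refine (norm_add_le_of_le (norm_add_le_of_le (norm_add_le_of_le (norm_add_le_of_le
    (norm_add_le_of_le (norm_sub_le_of_le (norm_sub_le_of_le (norm_sub_le_of_le (norm_add_le_of_le
    (norm_add_le_of_le (norm_add_le_of_le t1 t2) t3) t4) t5) t6) t7) t8) t9) t10) t11) t12).trans ?_
  linarith

/-- The midpoint of the chord with number `n`. -/
noncomputable def midN (n : ℕ) (x v : V) : V :=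
  rotCos n (half x v) • mid x v + ((1 - half x v ^ 2) * rotSin n (half x v)) • dir v

/-- The direction of the trajectory on the chord with number `n`. -/
noncomputable def dirN (n : ℕ) (x v : V) : V :=
  rotCos n (half x v) • dir v - rotSin n (half x v) • mid x v

lemma etaN_eq (n : ℕ) (x v : V) : etaN n x v = midN n x v + pos n x v • dirN n x v := by
  rw [etaN, midN, dirN]; module

/-- The derivative of a branch maps `mid` to `coefD • midN`, so the large derivative of `coefD`
enters only along `midN`. All that is left involves the derivative of `coefB` or of vectors and is
of order `c⁻¹`. -/
lemma etaDD_decomposition_of_two_le {n : ℕ} (hn : 2 ≤ n) (hx : ‖x‖ < 1) (hv : v ≠ 0)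
    (hu : |pos n x v| ≤ half x v) {a b : V} (ha : ‖a‖ = 1) (hb : ‖b‖ = 1) :
    ∃ K : ℝ, |K| ≤ 400 * (half x v)⁻¹ ^ 2 ∧
      ‖etaDD n x v a b - K • midN n x v‖ ≤ 400 * (half x v)⁻¹ := by
  have h := chordBounds hn hx hv hu ha
  have hB : |coefB n x v| ≤ 3 := h.abs_B_le
  have hD : |coefD n x v| ≤ 3 := h.abs_D_le
  have hE : ‖mid x v‖ ^ 2 * |coefE n x v| ≤ 6 := by
    rw [coefE, neg_mul, abs_neg]; exact h.sq_mul_abs_E_le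
  have hB' : |coefBD n x v a| ≤ 20 * (half x v)⁻¹ := h.abs_B'_le hB
  have hD' : |coefDD n x v a| ≤ 20 * (half x v)⁻¹ ^ 2 := h.abs_D'_le hD
  have hE' : ‖mid x v‖ ^ 2 * |coefED n x v a| ≤ 45 * (half x v)⁻¹ ^ 2 := by
    rw [coefED, abs_neg]; exact h.sq_mul_abs_E'_le hE
  have hrest := norm_etaDDRest_le hn hx hv hu ha hb
  have hbm : |inner ℝ (mid x v) b| ≤ ‖mid x v‖ := abs_inner_le_of_unit hb le_rfl
  have hp := (norm_dir hv).le
  have hi := h.one_le_i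
  have hc := h.hc
  have hii := h.hi
  rw [etaDD_eq]
  -- For long chords `c⁻²` and `c⁻¹` are comparable and nothing has to be split off; for short ones
  -- `‖mid x v‖ ≥ 1/2` and division by `‖mid x v‖² = 1 - c²` is harmless.
  rcases le_total (1 / 2) (half x v) with hc2 | hc2
  · have hi2 : (half x v)⁻¹ ≤ 2 := by nlinarith
    refine ⟨0, by simp; positivity, ?_⟩
    rw [zero_smul, sub_zero]
    have t1 : ‖(coefED n x v a * inner ℝ (mid x v) b) • mid x v‖ ≤ 45 * (half x v)⁻¹ ^ 2 := by
      refine (norm_smul_le_of_abs_le (abs_mul_le_of_le le_rfl hbm) le_rfl).trans ?_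
      linarith
    have t2 : ‖(coefDD n x v a * rotSin n (half x v) * inner ℝ (mid x v) b) • dir v‖ ≤
        20 * (half x v)⁻¹ ^ 2 * 1 * 1 := by
      rw [mul_assoc]
      refine norm_smul_le_of_abs_le
        (abs_mul_le_of_le hD' ((abs_mul_le_of_le le_rfl hbm).trans ?_)) hp
      linarith [h.hwS]
    refine (norm_add_le_of_le hrest (norm_add_le_of_le t1 t2)).trans ?_
    nlinarith
  · have hw := h.hw
    have hw2 := h.hw2
    have hw3 : 3 / 4 ≤ ‖mid x v‖ ^ 2 := by nlinarith
    have hw1 : 1 / 2 ≤ ‖mid x v‖ := by nlinarith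
    have hE0 : |coefE n x v| ≤ 8 := by nlinarith [abs_nonneg (coefE n x v)]
    have hwp : 0 < ‖mid x v‖ := by linarith
    have hwi : ‖mid x v‖⁻¹ ≤ 2 := by
      rw [inv_le_comm₀ hwp two_pos]; linarith
    have hq : 1 - half x v ^ 2 ≠ 0 := by rw [← hw2]; positivity
    have hr : |inner ℝ (mid x v) b * (1 - half x v ^ 2)⁻¹| ≤ ‖mid x v‖⁻¹ := by
      rw [← hw2]
      refine (abs_mul_le_of_le hbm (abs_of_nonneg (by positivity)).le).trans_eq ?_
      field_simp
    refine ⟨coefDD n x v a * (inner ℝ (mid x v) b * (1 - half x v ^ 2)⁻¹), ?_, ?_⟩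
    · refine (abs_mul_le_of_le hD' hr).trans ?_
      have : 0 ≤ (half x v)⁻¹ ^ 2 := by positivity
      nlinarith
    -- `mul_coefED` expresses `coefED` through `coefDD`; with this `K` every occurrence of `coefDD`
    -- cancels.
    have e : etaDDRest n x v a b + ((coefED n x v a * inner ℝ (mid x v) b) • mid x v +
        (coefDD n x v a * rotSin n (half x v) * inner ℝ (mid x v) b) • dir v) -
        (coefDD n x v a * (inner ℝ (mid x v) b * (1 - half x v ^ 2)⁻¹)) • midN n x v =
        etaDDRest n x v a b +
          ((coefD n x v * (-(2 * n) * rotSin n (half x v) * halfD x v a) - coefBD n x v a +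
            2 * half x v * halfD x v a * coefE n x v) *
            (inner ℝ (mid x v) b * (1 - half x v ^ 2)⁻¹)) • mid x v := by
      have h1 := mul_coefED n hx hv a
      have h2 := mul_inv_cancel₀ hq
      rw [midN]
      match_scalars
      · ring
      · linear_combination (inner ℝ (mid x v) b * (1 - half x v ^ 2)⁻¹) * h1 -
          (coefED n x v a * inner ℝ (mid x v) b) * h2
      · linear_combination (-(coefDD n x v a * rotSin n (half x v) * inner ℝ (mid x v) b)) * h2
    rw [e]
    have t1 : |2 * half x v * halfD x v a * coefE n x v| ≤ 2 * half x v * ‖v‖⁻¹ * 8 :=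
      abs_mul_le_of_le (abs_mul_le_of_le (abs_of_nonneg (by positivity)).le h.abs_c'_le) hE0
    have t2 := norm_smul_le_of_abs_le (abs_mul_le_of_le (abs_add_le_of_le (abs_sub_le_of_le
      (abs_mul_le_of_le hD h.abs_C'_le) hB') t1) hr) (le_refl ‖mid x v‖)
    refine (norm_add_le_of_le hrest t2).trans ?_
    rw [mul_assoc _ ‖mid x v‖⁻¹, inv_mul_cancel₀ hwp.ne', mul_one]
    linarith [h.nk_le, h.ck_le]

variable {V : Type*} [NormedAddCommGroup V] [InnerProductSpace ℝ V] {x v : V}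

/-! ### One reflection -/

lemma rotCos_one (c : ℝ) : rotCos 1 c = 1 - 2 * c ^ 2 := by
  simpa using rotCos_succ 0 c

lemma rotSin_one (c : ℝ) : rotSin 1 c = 2 * c := by
  simpa using rotSin_succ 0 c

lemma rotSinDeriv_one (c : ℝ) : rotSinDeriv c 1 = 2 := by
  simp [rotSinDeriv]

lemma abs_half_le_one (x v : V) : |half x v| ≤ 1 := by
  rw [half, abs_of_nonneg (Real.sqrt_nonneg _)]
  exact half_le_one x v

/-- The distance from `x` to the boundary in direction `v`. -/
noncomputable def dist₁ (x v : V) : ℝ := half x v - along x v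

/-- The first point of reflection. -/
noncomputable def hit (x v : V) : V := x + dist₁ x v • dir v

/-- A scale invariant measure of the time between the reflection and its neighbours. -/
noncomputable def coefQ (x v : V) : ℝ :=
  (‖v‖ - dist₁ x v) * dist₁ x v * ((half x v)⁻¹ * ‖v‖⁻¹)

/-- The vector that multiplies `coefQ` in the derivative after one reflection. -/
noncomputable def vecY (x v b : V) : V :=
  (half x v * half x v) • (b - inner ℝ (dir v) b • dir v) -
    inner ℝ (mid x v) b • (mid x v + (2 * half x v) • dir v)

lemma hit_eq (x v : V) : hit x v = mid x v + half x v • dir v := by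
  rw [hit, mid, dist₁]; module

/-- The first two terms are the reflection in the tangent plane at the point of impact. The factor
`‖v‖⁻¹`, no longer controlled by `c⁻¹`, occurs only inside `coefQ`, where the path lengths before
and after the impact compensate it. -/
lemma etaD_one (hx : ‖x‖ < 1) (hv : v ≠ 0) (b : V) : etaD 1 x v b =
    b - (2 * inner ℝ (hit x v) b) • hit x v - (2 * coefQ x v) • vecY x v b := by
  have hc0 := (half_pos hx v).ne'
  have hN : ‖v‖ ≠ 0 := norm_ne_zero_iff.2 hv
  simp only [etaD, hit_eq, vecY, coefQ, coefB, coefD, coefE, rotCos_one, rotSin_one, rotSinDeriv_one, pos, dist₁,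
    inner_add_left, real_inner_smul_left]
  generalize half x v = c at *
  generalize ‖v‖ = N at *
  generalize (inner ℝ (mid x v) b : ℝ) = am at *
  generalize (inner ℝ (dir v) b : ℝ) = av at *
  generalize along x v = μ at *
  match_scalars
  · field_simp
    ring
  · field_simp
    ring
  · field_simp
    ring

/-- The derivative of `dist₁ x` at `v` in direction `a`. -/
noncomputable def distD (x v a : V) : ℝ := halfD x v a - alongD x v a

/-- The derivative of `hit x` at `v` in direction `a`. -/
noncomputable def hitD (x v a : V) : V := distD x v a • dir v + dist₁ x v • dirD v a

/-- The derivative of `coefQ x` at `v` in direction `a`. -/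
noncomputable def coefQD (x v a : V) : ℝ :=
  ((inner ℝ (dir v) a - distD x v a) * dist₁ x v + (‖v‖ - dist₁ x v) * distD x v a) *
    ((half x v)⁻¹ * ‖v‖⁻¹) - coefQ x v * ((half x v)⁻¹ * halfD x v a + ‖v‖⁻¹ * inner ℝ (dir v) a)

/-- The derivative of `vecY x · b` at `v` in direction `a`. -/
noncomputable def vecYD (x v a b : V) : V :=
  (2 * half x v * halfD x v a) • (b - inner ℝ (dir v) b • dir v) -
    (half x v * half x v) • (inner ℝ (dirD v a) b • dir v + inner ℝ (dir v) b • dirD v a) -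
    inner ℝ (midD x v a) b • (mid x v + (2 * half x v) • dir v) -
    inner ℝ (mid x v) b • (midD x v a + (2 * halfD x v a) • dir v + (2 * half x v) • dirD v a)

lemma hasDirDeriv_hit (hx : ‖x‖ < 1) (hv : v ≠ 0) : HasDirDeriv (hit x) (hitD x v) v :=
  ((HasDirDeriv.const x v).add (((hasDirDeriv_half hx hv).sub (hasDirDeriv_along hv)).smul
    (hasDirDeriv_dir hv))).congr fun a => by rw [zero_add]; rfl

lemma hasDirDeriv_coefQ (hx : ‖x‖ < 1) (hv : v ≠ 0) :
    HasDirDeriv (coefQ x) (coefQD x v) v := by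
  have hρ := (hasDirDeriv_half hx hv).sub (hasDirDeriv_along (x := x) hv)
  have h := (((hasDirDeriv_norm hv).sub hρ).mul hρ).mul
    ((hasDirDeriv_half_inv hx hv).mul (hasDirDeriv_norm_inv hv))
  refine h.congr fun a => ?_
  rw [coefQD, coefQ, distD, dist₁]
  ring

lemma hasDirDeriv_vecY (hx : ‖x‖ < 1) (hv : v ≠ 0) (b : V) :
    HasDirDeriv (fun w => vecY x w b) (fun a => vecYD x v a b) v := by
  have hc := hasDirDeriv_half hx hv
  have hp := hasDirDeriv_dir hv
  have hm := hasDirDeriv_mid (x := x) hv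
  have h := ((hc.mul hc).smul ((HasDirDeriv.const b v).sub ((hp.inner_const b).smul hp))).sub
    ((hm.inner_const b).smul (hm.add ((hc.const_mul 2).smul hp)))
  refine h.congr fun a => ?_
  rw [vecYD]
  module

/-- A second formula for the derivative that is also given by `etaDD 1`, from which the bounds can
be read off. -/
lemma hasDirDeriv_etaD_one (hx : ‖x‖ < 1) (hv : v ≠ 0) (b : V) :
    HasDirDeriv (fun w => etaD 1 x w b) (fun a => -((2 * inner ℝ (hitD x v a) b) • hit x v) -
      (2 * inner ℝ (hit x v) b) • hitD x v a - (2 * coefQD x v a) • vecY x v b -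
      (2 * coefQ x v) • vecYD x v a b) v := by
  have hy := hasDirDeriv_hit hx hv
  have h := ((HasDirDeriv.const b v).sub (((hy.inner_const b).const_mul 2).smul hy)).sub
    (((hasDirDeriv_coefQ hx hv).const_mul 2).smul (hasDirDeriv_vecY hx hv b))
  obtain ⟨f', h1, h2⟩ := h
  refine ⟨f', h1.congr_of_eventuallyEq ?_, fun a => ?_⟩
  · filter_upwards [isOpen_ne.mem_nhds hv] with w hw using etaD_one hx hw b
  · rw [h2]; module

/-- Elementary bounds at a trajectory with one reflection. -/
lemma one_reflection_bounds (hx : ‖x‖ < 1) (hv : v ≠ 0) (hu : |pos 1 x v| ≤ half x v) :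
    0 < dist₁ x v ∧ dist₁ x v ≤ 2 * half x v ∧ 0 ≤ ‖v‖ - dist₁ x v ∧
      ‖v‖ - dist₁ x v ≤ 2 * half x v ∧ dist₁ x v * ‖v‖⁻¹ ≤ 1 ∧
      (‖v‖ - dist₁ x v) * ‖v‖⁻¹ ≤ 1 ∧ 1 ≤ (half x v)⁻¹ := by
  have h1 := abs_lt.1 (abs_along_lt hx v)
  have h2 := abs_le.1 hu
  have hN := norm_pos_iff.2 hv
  rw [pos] at h2
  push_cast at h2
  have hρ : 0 < dist₁ x v := by rw [dist₁]; linarith [h1.2]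
  have hs : 0 ≤ ‖v‖ - dist₁ x v := by rw [dist₁]; linarith [h2.1]
  refine ⟨hρ, by rw [dist₁]; linarith [h1.1], hs, by rw [dist₁]; linarith [h2.2], ?_, ?_,
    (one_le_inv₀ (half_pos hx v)).2 (half_le_one x v)⟩
  · rw [← div_eq_mul_inv, div_le_one hN]; linarith
  · rw [← div_eq_mul_inv, div_le_one hN]; linarith

lemma norm_hit (hx : ‖x‖ < 1) (hv : v ≠ 0) : ‖hit x v‖ = 1 := by
  have h : ‖hit x v‖ ^ 2 = 1 := by
    rw [hit_eq, norm_add_sq_real, norm_mid_sq_eq hx hv, real_inner_smul_right, inner_mid_dir hv,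
      norm_smul, norm_dir hv, Real.norm_eq_abs, mul_one, sq_abs]
    ring
  exact (pow_eq_one_iff_of_nonneg (norm_nonneg _) two_ne_zero).1 h

lemma norm_mid_le_one (hx : ‖x‖ < 1) (hv : v ≠ 0) : ‖mid x v‖ ≤ 1 := by
  have h := norm_mid_sq_eq hx hv
  nlinarith [sq_nonneg (half x v), norm_nonneg (mid x v)]

lemma norm_vecY_le (hx : ‖x‖ < 1) (hv : v ≠ 0) {b : V} (hb : ‖b‖ = 1) : ‖vecY x v b‖ ≤ 4 := by
  have hac := abs_half_le_one x v
  have hm := norm_mid_le_one hx hv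
  have t1 : ‖(half x v * half x v) • (b - inner ℝ (dir v) b • dir v)‖ ≤ 1 * 1 * 1 :=
    norm_smul_le_of_abs_le (abs_mul_le_of_le hac hac)
      (hb ▸ norm_sub_inner_smul_le (norm_dir hv) b)
  have t2 : ‖(2 * half x v) • dir v‖ ≤ 2 * 1 * 1 := norm_smul_le_of_abs_le
    (abs_mul_le_of_le (abs_of_pos two_pos).le hac) (norm_dir hv).le
  refine (norm_sub_le_of_le t1 (norm_smul_le_of_abs_le (abs_inner_le_of_unit hb hm)
    (norm_add_le_of_le hm t2))).trans (by norm_num)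

lemma coefQ_nonneg_le (hx : ‖x‖ < 1) (hv : v ≠ 0) (hu : |pos 1 x v| ≤ half x v) :
    0 ≤ coefQ x v ∧ coefQ x v ≤ 2 := by
  obtain ⟨h1, h2, h3, h4, h5, h6, h7⟩ := one_reflection_bounds hx hv hu
  have hN := norm_pos_iff.2 hv
  have hc := half_pos hx v
  refine ⟨by rw [coefQ]; positivity, ?_⟩
  calc coefQ x v = (‖v‖ - dist₁ x v) * (dist₁ x v * ‖v‖⁻¹) * (half x v)⁻¹ := by
        rw [coefQ]; ring
    _ ≤ (2 * half x v) * 1 * (half x v)⁻¹ := by gcongr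
    _ = 2 := by field_simp

lemma norm_etaD_one_le (hx : ‖x‖ < 1) (hv : v ≠ 0) (hu : |pos 1 x v| ≤ half x v) {b : V}
    (hb : ‖b‖ = 1) : ‖etaD 1 x v b‖ ≤ 20 := by
  obtain ⟨hQ0, hQ⟩ := coefQ_nonneg_le hx hv hu
  have hy := (norm_hit hx hv).le
  rw [etaD_one hx hv]
  have t1 : ‖(2 * inner ℝ (hit x v) b) • hit x v‖ ≤ 2 * 1 * 1 := norm_smul_le_of_abs_le
    (abs_mul_le_of_le (abs_of_pos two_pos).le (abs_inner_le_of_unit hb hy)) hy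
  have t2 : ‖(2 * coefQ x v) • vecY x v b‖ ≤ 2 * 2 * 4 := norm_smul_le_of_abs_le
    (abs_mul_le_of_le (abs_of_pos two_pos).le ((abs_of_nonneg hQ0).trans_le hQ))
    (norm_vecY_le hx hv hb)
  exact (norm_sub_le_of_le (norm_sub_le_of_le hb.le t1) t2).trans (by norm_num)

/-- `distD = -(dist₁ / half) * alongD`: the derivative of the distance to the boundary is
proportional to that distance, and `dist₁ ≤ ‖v‖` after a reflection absorbs the inverse speed. -/
lemma abs_distD_le (hx : ‖x‖ < 1) (hv : v ≠ 0) {a : V} (ha : ‖a‖ = 1) :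
    |distD x v a| ≤ dist₁ x v * (half x v)⁻¹ * ‖v‖⁻¹ := by
  have hc := half_pos hx v
  have hρ : 0 < dist₁ x v := by
    have := abs_lt.1 (abs_along_lt hx v)
    rw [dist₁]; linarith [this.2]
  have e : distD x v a = -(dist₁ x v * (half x v)⁻¹) * alongD x v a := by
    rw [distD, halfD, dist₁]; field_simp; ring
  rw [e]
  refine abs_mul_le_of_le ?_ ((abs_alongD_le x v ha).trans
    (mul_le_of_le_one_left (by positivity) (norm_mid_le_one hx hv)))
  rw [abs_neg, abs_of_pos (by positivity)]

lemma norm_vecYD_le (hx : ‖x‖ < 1) (hv : v ≠ 0) {a b : V} (ha : ‖a‖ = 1) (hb : ‖b‖ = 1) :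
    ‖vecYD x v a b‖ ≤ 16 * ‖v‖⁻¹ := by
  have hc := half_pos hx v
  have hc1 := half_le_one x v
  have hm := norm_mid_le_one hx hv
  have hp := (norm_dir hv).le
  have hk : 0 ≤ ‖v‖⁻¹ := by positivity
  have hac := abs_half_le_one x v
  have h2 : |(2 : ℝ)| ≤ 2 := (abs_of_pos two_pos).le
  have hc' : |halfD x v a| ≤ ‖v‖⁻¹ := (abs_halfD_le hx v ha).trans (mul_le_of_le_one_left hk hm)
  have hp' := norm_dirD_le hv ha
  have hm' : ‖midD x v a‖ ≤ 2 * ‖v‖⁻¹ := by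
    refine (norm_midD_le hx hv ha).trans ?_
    rw [two_mul]
    exact add_le_add (mul_le_of_le_one_left hk hm) (mul_le_of_le_one_left hk hc1)
  have hbv : |inner ℝ (dir v) b| ≤ 1 := abs_inner_le_of_unit hb hp
  have t1 : ‖(2 * half x v * halfD x v a) • (b - inner ℝ (dir v) b • dir v)‖ ≤
      2 * 1 * ‖v‖⁻¹ * 1 := norm_smul_le_of_abs_le (abs_mul_le_of_le (abs_mul_le_of_le h2 hac) hc')
        (hb ▸ norm_sub_inner_smul_le (norm_dir hv) b)
  have t2 : ‖(half x v * half x v) •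
      (inner ℝ (dirD v a) b • dir v + inner ℝ (dir v) b • dirD v a)‖ ≤
      1 * 1 * (‖v‖⁻¹ * 1 + 1 * ‖v‖⁻¹) := norm_smul_le_of_abs_le (abs_mul_le_of_le hac hac)
    (norm_add_le_of_le (norm_smul_le_of_abs_le (abs_inner_le_of_unit hb hp') hp)
      (norm_smul_le_of_abs_le hbv hp'))
  have t3 : ‖inner ℝ (midD x v a) b • (mid x v + (2 * half x v) • dir v)‖ ≤
      2 * ‖v‖⁻¹ * (1 + 2 * 1 * 1) := norm_smul_le_of_abs_le (abs_inner_le_of_unit hb hm')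
    (norm_add_le_of_le hm (norm_smul_le_of_abs_le (abs_mul_le_of_le h2 hac) hp))
  have t4 : ‖inner ℝ (mid x v) b •
      (midD x v a + (2 * halfD x v a) • dir v + (2 * half x v) • dirD v a)‖ ≤
      1 * (2 * ‖v‖⁻¹ + 2 * ‖v‖⁻¹ * 1 + 2 * 1 * ‖v‖⁻¹) :=
    norm_smul_le_of_abs_le (abs_inner_le_of_unit hb hm) (norm_add_le_of_le (norm_add_le_of_le hm'
      (norm_smul_le_of_abs_le (abs_mul_le_of_le h2 hc') hp))
      (norm_smul_le_of_abs_le (abs_mul_le_of_le h2 hac) hp'))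
  refine (norm_sub_le_of_le (norm_sub_le_of_le (norm_sub_le_of_le t1 t2) t3) t4).trans ?_
  linarith

lemma etaD_one_decomposition (hx : ‖x‖ < 1) (hv : v ≠ 0) (hu : |pos 1 x v| ≤ half x v) {a b : V}
    (ha : ‖a‖ = 1) (hb : ‖b‖ = 1) : ∃ K : ℝ, |K| ≤ 400 * (half x v)⁻¹ ^ 2 ∧
      ‖etaDD 1 x v a b - K • midN 1 x v‖ ≤ 400 * (half x v)⁻¹ := by
  obtain ⟨h1, h2, h3, h4, h5, h6, h7⟩ := one_reflection_bounds hx hv hu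
  obtain ⟨hQ0, hQ2⟩ := coefQ_nonneg_le hx hv hu
  have hN := norm_pos_iff.2 hv
  have hc := half_pos hx v
  have hc1 := half_le_one x v
  have hi : half x v * (half x v)⁻¹ = 1 := mul_inv_cancel₀ hc.ne'
  have hm := norm_mid_le_one hx hv
  have hp := (norm_dir hv).le
  have hy := (norm_hit hx hv).le
  have hk : 0 ≤ ‖v‖⁻¹ := by positivity
  have hi0 : 0 ≤ (half x v)⁻¹ := by positivity
  have hac := abs_half_le_one x v
  have hto : |(2 : ℝ)| ≤ 2 := (abs_of_pos two_pos).le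
  have hav : |inner ℝ (dir v) a| ≤ 1 := abs_inner_le_of_unit ha hp
  have hbm : |inner ℝ (mid x v) b| ≤ 1 := abs_inner_le_of_unit hb hm
  have hρ' := abs_distD_le hx hv ha
  have hρ'1 : |distD x v a| ≤ (half x v)⁻¹ := by
    refine hρ'.trans ?_
    calc dist₁ x v * (half x v)⁻¹ * ‖v‖⁻¹ = dist₁ x v * ‖v‖⁻¹ * (half x v)⁻¹ := by ring
      _ ≤ 1 * (half x v)⁻¹ := by gcongr
      _ = (half x v)⁻¹ := one_mul _
  have hc' : |halfD x v a| ≤ ‖v‖⁻¹ := (abs_halfD_le hx v ha).trans (mul_le_of_le_one_left hk hm)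
  -- The path lengths before and after the impact are each at most the total length `‖v‖`.
  have hQk : coefQ x v * ‖v‖⁻¹ ≤ (half x v)⁻¹ := by
    calc coefQ x v * ‖v‖⁻¹
        = ((‖v‖ - dist₁ x v) * ‖v‖⁻¹) * (dist₁ x v * ‖v‖⁻¹) * (half x v)⁻¹ := by
          rw [coefQ]; ring
      _ ≤ 1 * 1 * (half x v)⁻¹ := by gcongr
      _ = (half x v)⁻¹ := by ring
  have hQ' : |coefQD x v a| ≤ 5 * (half x v)⁻¹ ^ 2 := by
    have t1 : |(inner ℝ (dir v) a - distD x v a) * dist₁ x v * ((half x v)⁻¹ * ‖v‖⁻¹)| ≤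
        2 * (half x v)⁻¹ ^ 2 := by
      refine (abs_mul_le_of_le (abs_mul_le_of_le (abs_sub_le_of_le hav hρ'1) (abs_of_pos h1).le)
        (abs_of_nonneg (by positivity)).le).trans ?_
      calc (1 + (half x v)⁻¹) * dist₁ x v * ((half x v)⁻¹ * ‖v‖⁻¹)
          = (1 + (half x v)⁻¹) * (dist₁ x v * ‖v‖⁻¹) * (half x v)⁻¹ := by ring
        _ ≤ ((half x v)⁻¹ + (half x v)⁻¹) * 1 * (half x v)⁻¹ := by gcongr
        _ = 2 * (half x v)⁻¹ ^ 2 := by ring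
    have t2 : |(‖v‖ - dist₁ x v) * distD x v a * ((half x v)⁻¹ * ‖v‖⁻¹)| ≤
        (half x v)⁻¹ ^ 2 := by
      refine (abs_mul_le_of_le (abs_mul_le_of_le (abs_of_nonneg h3).le hρ')
        (abs_of_nonneg (by positivity)).le).trans ?_
      calc (‖v‖ - dist₁ x v) * (dist₁ x v * (half x v)⁻¹ * ‖v‖⁻¹) * ((half x v)⁻¹ * ‖v‖⁻¹)
          = ((‖v‖ - dist₁ x v) * ‖v‖⁻¹) * (dist₁ x v * ‖v‖⁻¹) * (half x v)⁻¹ ^ 2 := by ring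
        _ ≤ 1 * 1 * (half x v)⁻¹ ^ 2 := by gcongr
        _ = (half x v)⁻¹ ^ 2 := by ring
    have t3 : |coefQ x v * ((half x v)⁻¹ * halfD x v a + ‖v‖⁻¹ * inner ℝ (dir v) a)| ≤
        2 * (half x v)⁻¹ ^ 2 := by
      refine (abs_mul_le_of_le (abs_of_nonneg hQ0).le (abs_add_le_of_le
        (abs_mul_le_of_le (abs_of_nonneg hi0).le hc')
        (abs_mul_le_of_le (abs_of_nonneg hk).le hav))).trans ?_
      calc coefQ x v * ((half x v)⁻¹ * ‖v‖⁻¹ + ‖v‖⁻¹ * 1)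
          = (coefQ x v * ‖v‖⁻¹) * ((half x v)⁻¹ + 1) := by ring
        _ ≤ (half x v)⁻¹ * ((half x v)⁻¹ + (half x v)⁻¹) := by gcongr
        _ = 2 * (half x v)⁻¹ ^ 2 := by ring
    rw [coefQD, add_mul]
    refine (abs_sub_le_of_le (abs_add_le_of_le t1 t2) t3).trans ?_
    linarith
  have hy' : ‖hitD x v a‖ ≤ 2 * (half x v)⁻¹ := by
    rw [hitD]
    refine (norm_add_le_of_le (norm_smul_le_of_abs_le hρ'1 hp)
      (norm_smul_le_of_abs_le (abs_of_pos h1).le (norm_dirD_le hv ha))).trans ?_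
    linarith
  have hDD := ((hasDirDeriv_etaD 1 hx hv b).fderiv_apply a).symm.trans
    ((hasDirDeriv_etaD_one hx hv b).fderiv_apply a)
  -- The vector `mid + 2c • dir` in `vecY` agrees with `midN 1` up to order `c²`, so the part of
  -- `vecY` not along `midN 1` has a factor `c²`, more than enough to turn `coefQD = O(c⁻²)` into
  -- `O(c⁻¹)`.
  refine ⟨2 * coefQD x v a * inner ℝ (mid x v) b, ?_, ?_⟩
  · refine (abs_mul_le_of_le (abs_mul_le_of_le hto hQ') hbm).trans ?_
    nlinarith [sq_nonneg (half x v)⁻¹]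
  have e : etaDD 1 x v a b - (2 * coefQD x v a * inner ℝ (mid x v) b) • midN 1 x v =
      -((2 * inner ℝ (hitD x v a) b) • hit x v) - (2 * inner ℝ (hit x v) b) • hitD x v a -
      (2 * coefQD x v a * half x v) • (half x v • (b - inner ℝ (dir v) b • dir v) -
        (2 * half x v * inner ℝ (mid x v) b) • mid x v -
        (2 * half x v ^ 2 * inner ℝ (mid x v) b) • dir v) -
      (2 * coefQ x v) • vecYD x v a b := by
    rw [hDD, vecY, midN, rotCos_one, rotSin_one]
    module
  rw [e]
  have t1 : ‖(2 * inner ℝ (hitD x v a) b) • hit x v‖ ≤ 2 * (2 * (half x v)⁻¹) * 1 :=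
    norm_smul_le_of_abs_le (abs_mul_le_of_le hto (abs_inner_le_of_unit hb hy')) hy
  have t2 : ‖(2 * inner ℝ (hit x v) b) • hitD x v a‖ ≤ 2 * 1 * (2 * (half x v)⁻¹) :=
    norm_smul_le_of_abs_le (abs_mul_le_of_le hto (abs_inner_le_of_unit hb hy)) hy'
  have t3 : ‖half x v • (b - inner ℝ (dir v) b • dir v) -
      (2 * half x v * inner ℝ (mid x v) b) • mid x v -
      (2 * half x v ^ 2 * inner ℝ (mid x v) b) • dir v‖ ≤ 1 * 1 + 2 * 1 * 1 * 1 + 2 * 1 * 1 * 1 := by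
    refine norm_sub_le_of_le (norm_sub_le_of_le (norm_smul_le_of_abs_le hac
      (hb ▸ norm_sub_inner_smul_le (norm_dir hv) b)) (norm_smul_le_of_abs_le
      (abs_mul_le_of_le (abs_mul_le_of_le hto hac) hbm) hm)) (norm_smul_le_of_abs_le
      (abs_mul_le_of_le (abs_mul_le_of_le hto ?_) hbm) hp)
    rw [abs_pow]
    exact pow_le_one₀ (abs_nonneg _) hac
  have t4 := norm_smul_le_of_abs_le (abs_mul_le_of_le (abs_mul_le_of_le hto hQ')
    (abs_of_pos hc).le) t3
  have t5 := norm_smul_le_of_abs_le (abs_mul_le_of_le hto (abs_of_nonneg hQ0).le)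
    (norm_vecYD_le hx hv ha hb)
  refine (norm_sub_le_of_le (norm_sub_le_of_le (norm_sub_le_of_le ((norm_neg _).trans_le t1) t2)
    t4) t5).trans ?_
  have e4 : 2 * (5 * (half x v)⁻¹ ^ 2) * half x v = 10 * (half x v)⁻¹ := by
    linear_combination (10 * (half x v)⁻¹) * hi
  rw [e4]
  linarith

/-! ### Summary of the estimates -/

lemma etaN_zero (x v : V) : etaN 0 x v = x + v := by
  simp only [etaN, rotCos_zero, rotSin_zero, pos, mid]
  have h := norm_smul_dir v
  simp only [mul_zero, sub_zero, mul_one, add_zero, one_smul, Nat.cast_zero, zero_mul]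
  rw [add_smul, h]
  abel

lemma etaD_zero (hx : ‖x‖ < 1) (hv : v ≠ 0) (b : V) : etaD 0 x v b = b := by
  rw [← (hasDirDeriv_etaN 0 hx hv).fderiv_apply, show etaN 0 x = fun v => x + v from
    funext (etaN_zero x), fderiv_const_add, fderiv_fun_id]
  rfl

lemma etaDD_zero (hx : ‖x‖ < 1) (hv : v ≠ 0) (a b : V) : etaDD 0 x v a b = 0 := by
  rw [← (hasDirDeriv_etaD 0 hx hv b).fderiv_apply]
  have : (fun w => etaD 0 x w b) =ᶠ[𝓝 v] fun _ => b := by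
    filter_upwards [isOpen_ne.mem_nhds hv] with w hw using etaD_zero hx hw b
  rw [this.fderiv_eq]
  simp

lemma norm_etaD_le (n : ℕ) (hx : ‖x‖ < 1) (hv : v ≠ 0) (hu : |pos n x v| ≤ half x v) {b : V}
    (hb : ‖b‖ = 1) : ‖etaD n x v b‖ ≤ 20 := by
  match n, hu with
  | 0, _ => rw [etaD_zero hx hv, hb]; norm_num
  | 1, hu => exact norm_etaD_one_le hx hv hu hb
  | n + 2, hu => exact norm_etaD_le_of_two_le (by omega) hx hv hu hb

lemma etaDD_decomposition (n : ℕ) (hx : ‖x‖ < 1) (hv : v ≠ 0) (hu : |pos n x v| ≤ half x v)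
    {a b : V} (ha : ‖a‖ = 1) (hb : ‖b‖ = 1) : ∃ K : ℝ, |K| ≤ 400 * (half x v)⁻¹ ^ 2 ∧
      ‖etaDD n x v a b - K • midN n x v‖ ≤ 400 * (half x v)⁻¹ := by
  match n, hu with
  | 0, _ =>
    have := half_pos hx v
    refine ⟨0, by simp; positivity, ?_⟩
    rw [etaDD_zero hx hv, zero_smul, sub_zero, norm_zero]
    positivity
  | 1, hu => exact etaD_one_decomposition hx hv hu ha hb
  | n + 2, hu => exact etaDD_decomposition_of_two_le (by omega) hx hv hu ha hb

/-! ### The trajectory consists of rotated chords -/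

section

variable {V : Type*} [NormedAddCommGroup V] [InnerProductSpace ℝ V] {x v : V}

/-- The end point of the chord with number `n`. -/
noncomputable def hitN (n : ℕ) (x v : V) : V := midN n x v + half x v • dirN n x v

lemma inner_midN_dirN (n : ℕ) (hx : ‖x‖ < 1) (hv : v ≠ 0) :
    inner ℝ (midN n x v) (dirN n x v) = (0 : ℝ) := by
  have h1 : inner ℝ (dir v) (mid x v) = (0 : ℝ) := by rw [real_inner_comm, inner_mid_dir hv]
  simp only [midN, dirN, inner_add_left, inner_sub_right, real_inner_smul_left,
    real_inner_smul_right, inner_mid_dir hv, h1, real_inner_self_eq_norm_sq, norm_dir hv,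
    norm_mid_sq_eq hx hv]
  ring

lemma norm_dirN (n : ℕ) (hx : ‖x‖ < 1) (hv : v ≠ 0) : ‖dirN n x v‖ = 1 := by
  have h : ‖dirN n x v‖ ^ 2 = 1 := by
    have h1 : inner ℝ (dir v) (mid x v) = (0 : ℝ) := by rw [real_inner_comm, inner_mid_dir hv]
    rw [dirN, norm_sub_sq_real, norm_smul, norm_smul, mul_pow, mul_pow, norm_dir hv,
      norm_mid_sq_eq hx hv, real_inner_smul_left, real_inner_smul_right, h1, Real.norm_eq_abs,
      Real.norm_eq_abs, sq_abs, sq_abs]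
    linear_combination rotCos_sq_add n (half x v)
  exact (pow_eq_one_iff_of_nonneg (norm_nonneg _) two_ne_zero).1 h

lemma norm_midN_sq (n : ℕ) (hx : ‖x‖ < 1) (hv : v ≠ 0) :
    ‖midN n x v‖ ^ 2 = 1 - half x v ^ 2 := by
  rw [midN, norm_add_sq_real, norm_smul, norm_smul, mul_pow, mul_pow, norm_dir hv,
    norm_mid_sq_eq hx hv, real_inner_smul_left, real_inner_smul_right, inner_mid_dir hv,
    Real.norm_eq_abs, Real.norm_eq_abs, sq_abs, sq_abs]
  linear_combination (1 - half x v ^ 2) * rotCos_sq_add n (half x v)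

lemma norm_midN_add_sq (n : ℕ) (hx : ‖x‖ < 1) (hv : v ≠ 0) (r : ℝ) :
    ‖midN n x v + r • dirN n x v‖ ^ 2 = 1 - half x v ^ 2 + r ^ 2 := by
  rw [norm_add_sq_real, norm_midN_sq n hx hv, real_inner_smul_right, inner_midN_dirN n hx hv,
    norm_smul, norm_dirN n hx hv, Real.norm_eq_abs, mul_one, sq_abs]
  ring

lemma norm_etaN_sq (n : ℕ) (hx : ‖x‖ < 1) (hv : v ≠ 0) :
    ‖etaN n x v‖ ^ 2 = 1 - half x v ^ 2 + pos n x v ^ 2 := by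
  rw [etaN_eq, norm_midN_add_sq n hx hv]

lemma norm_hitN (n : ℕ) (hx : ‖x‖ < 1) (hv : v ≠ 0) : ‖hitN n x v‖ = 1 := by
  refine (pow_eq_one_iff_of_nonneg (norm_nonneg _) two_ne_zero).1 ?_
  rw [hitN, norm_midN_add_sq n hx hv]
  ring

lemma dirN_succ (n : ℕ) (x v : V) :
    dirN (n + 1) x v = dirN n x v - (2 * half x v) • hitN n x v := by
  rw [hitN, midN, dirN, dirN, rotCos_succ, rotSin_succ]
  module

lemma hitN_eq_succ (n : ℕ) (x v : V) :
    hitN n x v = midN (n + 1) x v - half x v • dirN (n + 1) x v := by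
  rw [hitN, midN, midN, dirN, dirN, rotCos_succ, rotSin_succ]
  module

lemma pos_succ (n : ℕ) (x v : V) : pos (n + 1) x v = pos n x v - 2 * half x v := by
  rw [pos, pos]; push_cast; ring

/-- Reflecting at `hitN` instead of prolonging the chord through it changes the position along the
normal at `hitN`. The factor vanishes where `pos n = half`, so adjacent branches agree there and
their gradients differ by a normal vector. -/
lemma etaN_succ (n : ℕ) (x v : V) : etaN (n + 1) x v =
    etaN n x v - (2 * half x v * (pos n x v - half x v)) • hitN n x v := by
  have h : etaN (n + 1) x v = hitN n x v + (pos n x v - half x v) • dirN (n + 1) x v := by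
    rw [hitN_eq_succ, etaN_eq, pos_succ]; module
  rw [h, dirN_succ, etaN_eq, hitN]
  module

lemma inner_hitN_dirN (n : ℕ) (hx : ‖x‖ < 1) (hv : v ≠ 0) :
    inner ℝ (hitN n x v) (dirN n x v) = half x v := by
  rw [hitN, inner_add_left, inner_midN_dirN n hx hv, real_inner_smul_left,
    real_inner_self_eq_norm_sq, norm_dirN n hx hv]
  ring

lemma inner_hitN_dirN_succ (n : ℕ) (hx : ‖x‖ < 1) (hv : v ≠ 0) :
    inner ℝ (hitN n x v) (dirN (n + 1) x v) = -half x v := by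
  rw [hitN_eq_succ, inner_sub_left, inner_midN_dirN _ hx hv, real_inner_smul_left,
    real_inner_self_eq_norm_sq, norm_dirN _ hx hv]
  ring

lemma dirN_zero (x v : V) : dirN 0 x v = dir v := by simp [dirN]

lemma midN_zero (x v : V) : midN 0 x v = mid x v := by simp [midN]

/-- Two chords can carry the position at time `1` only if they are equal or adjacent. -/
lemma eq_or_adjacent {n k : ℕ} (hx : ‖x‖ < 1) (hn : |pos n x v| ≤ half x v)
    (hk : |pos k x v| ≤ half x v) :
    n = k ∨ (n = k + 1 ∧ pos k x v = half x v) ∨ (k = n + 1 ∧ pos n x v = half x v) := by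
  have hc := half_pos hx v
  rw [abs_le] at hn hk
  have hr : pos n x v - pos k x v = 2 * ((k : ℝ) - n) * half x v := by rw [pos, pos]; ring
  have h1 : (k : ℝ) - n ≤ 1 := by
    by_contra! h
    nlinarith
  have h2 : (n : ℝ) - k ≤ 1 := by
    by_contra! h
    nlinarith
  have h1' : k ≤ n + 1 := by exact_mod_cast (by linarith : (k : ℝ) ≤ n + 1)
  have h2' : n ≤ k + 1 := by exact_mod_cast (by linarith : (n : ℝ) ≤ k + 1)
  have h3 : n = k ∨ n = k + 1 ∨ k = n + 1 := by omega
  rcases h3 with h | rfl | rfl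
  · exact .inl h
  · refine .inr (.inl ⟨rfl, ?_⟩)
    push_cast at hr
    linarith
  · refine .inr (.inr ⟨rfl, ?_⟩)
    push_cast at hr
    linarith

lemma etaN_eq_of_abs_pos_le {n k : ℕ} (hx : ‖x‖ < 1) (hn : |pos n x v| ≤ half x v)
    (hk : |pos k x v| ≤ half x v) : etaN n x v = etaN k x v := by
  rcases eq_or_adjacent hx hn hk with rfl | ⟨rfl, h⟩ | ⟨rfl, h⟩
  · rfl
  · rw [etaN_succ, h]; simp
  · rw [etaN_succ, h]; simp

end

/-! ### The recursively defined trajectory runs through the rotated chords. -/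

variable {d : ℕ} {x v : E d}

/-- In terms of the speed `N`, the half-length `c` of the chord and the starting position `U`
measured from its midpoint, `‖p + t • w‖² - 1 = (U + t N)² - c²`. -/
lemma exitTime_eq {p w : E d} {c U N : ℝ} (hN : 0 < N) (hw : ‖w‖ = N)
    (hpw : inner ℝ p w = U * N) (hp : ‖p‖ ^ 2 = 1 - c ^ 2 + U ^ 2) (hU : |U| ≤ c) :
    exitTime p w = (c - U) / N := by
  have h : {t : ℝ | 0 ≤ t ∧ ‖p + t • w‖ ≤ 1} = Icc 0 ((c - U) / N) := by
    ext t
    rw [mem_ofPred_eq, mem_Icc]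
    refine and_congr_right fun ht => ?_
    have hc : 0 ≤ c := (abs_nonneg U).trans hU
    have e : ‖p + t • w‖ ^ 2 = 1 - c ^ 2 + (U + t * N) ^ 2 := by
      rw [norm_add_sq_real, real_inner_smul_right, hpw, norm_smul, hw, Real.norm_eq_abs, mul_pow,
        sq_abs, hp]
      ring
    have h0 : 0 ≤ c + U := by linarith [(abs_le.1 hU).1]
    rw [le_div_iff₀ hN, ← sq_le_one_iff₀ (norm_nonneg _), e]
    constructor
    · intro h
      have h2 : (U + t * N) ^ 2 ≤ c ^ 2 := by linarith
      linarith [(abs_le.1 (abs_le_of_sq_le_sq h2 hc)).2]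
    · intro h
      have : (U + t * N) ^ 2 ≤ c ^ 2 :=
        sq_le_sq' (by linarith [mul_nonneg ht hN.le]) (by linarith)
      linarith
  rw [exitTime, h, csSup_Icc]
  exact div_nonneg (by linarith [(abs_le.1 hU).2]) hN.le

lemma exitTime_start (hx : ‖x‖ < 1) (hv : v ≠ 0) :
    exitTime x v = (half x v - along x v) / ‖v‖ := by
  refine exitTime_eq (norm_pos_iff.2 hv) rfl ?_ ?_ (abs_along_lt hx v).le
  · nth_rw 1 [← norm_smul_dir v]
    rw [real_inner_smul_right, along]; ring
  · rw [half_sq hx]; ring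

lemma exitTime_hitN (n : ℕ) (hx : ‖x‖ < 1) (hv : v ≠ 0) :
    exitTime (hitN n x v) (‖v‖ • dirN (n + 1) x v) = 2 * half x v / ‖v‖ := by
  have hc := half_pos hx v
  rw [exitTime_eq (c := half x v) (U := -half x v) (norm_pos_iff.2 hv)]
  · ring
  · rw [norm_smul, norm_dirN _ hx hv, norm_norm, mul_one]
  · rw [real_inner_smul_right, inner_hitN_dirN_succ n hx hv]; ring
  · rw [norm_hitN n hx hv]; ring
  · rw [abs_neg, abs_of_pos hc]

lemma bounce_succ (n : ℕ) (hx : ‖x‖ < 1) (hv : v ≠ 0) :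
    bounce x v (n + 1) = (hitN n x v, ‖v‖ • dirN (n + 1) x v) := by
  have hN : ‖v‖ ≠ 0 := norm_ne_zero_iff.2 hv
  have key : ∀ n : ℕ, reflect (hitN n x v) (‖v‖ • dirN n x v) = ‖v‖ • dirN (n + 1) x v := by
    intro n
    rw [reflect, real_inner_smul_right, inner_hitN_dirN n hx hv, dirN_succ]
    module
  induction n with
  | zero =>
    have h1 : x + exitTime x v • v = hitN 0 x v := by
      nth_rw 2 [← norm_smul_dir v]
      rw [exitTime_start hx hv, smul_smul, div_mul_cancel₀ _ hN, hitN, midN_zero, dirN_zero, mid]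
      module
    have h2 : reflect (hitN 0 x v) v = ‖v‖ • dirN (0 + 1) x v := by
      rw [← key 0, dirN_zero, norm_smul_dir]
    simp only [bounce]
    rw [h1, h2]
  | succ n ih =>
    rw [bounce, ih]
    have h1 : hitN n x v + exitTime (hitN n x v) (‖v‖ • dirN (n + 1) x v) •
        (‖v‖ • dirN (n + 1) x v) = hitN (n + 1) x v := by
      rw [exitTime_hitN n hx hv, smul_smul, div_mul_cancel₀ _ hN, hitN_eq_succ n, hitN]
      module
    simp only [h1, key]

lemma bounceTime_succ (n : ℕ) (hx : ‖x‖ < 1) (hv : v ≠ 0) :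
    bounceTime x v (n + 1) = (half x v + ‖v‖ - pos n x v) / ‖v‖ := by
  induction n with
  | zero =>
    rw [bounceTime, Finset.sum_range_one, bounce, exitTime_start hx hv, pos]
    push_cast
    ring
  | succ n ih =>
    rw [bounceTime, Finset.sum_range_succ, ← bounceTime, ih, bounce_succ n hx hv,
      exitTime_hitN n hx hv, pos_succ]
    ring

lemma one_lt_bounceTime_succ (n : ℕ) (hx : ‖x‖ < 1) (hv : v ≠ 0) :
    1 < bounceTime x v (n + 1) ↔ pos n x v < half x v := by
  rw [bounceTime_succ n hx hv, one_lt_div (norm_pos_iff.2 hv)]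
  constructor <;> intro h <;> linarith

lemma abs_pos_zero_right (hx : ‖x‖ < 1) : |pos 0 x (0 : E d)| ≤ half x (0 : E d) := by
  have := half_pos hx (0 : E d)
  simp only [pos, along, dir]
  simpa using this.le

lemma eta_zero (x : E d) : eta x 0 = x := by
  have h0 : exitTime x 0 = 0 := by
    rw [exitTime]
    by_cases h : ‖x‖ ≤ 1
    · have : {t : ℝ | 0 ≤ t ∧ ‖x + t • (0 : E d)‖ ≤ 1} = Ici 0 := by ext t; simp [h]
      rw [this]
      -- At rest the set of times is unbounded, and its real supremum is `0` by convention.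
      exact Real.sSup_of_not_bddAbove (not_bddAbove_Ici 0)
    · have : {t : ℝ | 0 ≤ t ∧ ‖x + t • (0 : E d)‖ ≤ 1} = ∅ := by ext t; simp [h]
      rw [this, Real.sSup_empty]
  have hb : ∀ n, bounce x 0 n = (x, 0) := by
    intro n
    induction n with
    | zero => rfl
    | succ n ih => simp [bounce, ih, reflect]
  simp [eta, hb]

lemma exists_eta_eq (hx : ‖x‖ < 1) (v : E d) :
    ∃ n, |pos n x v| ≤ half x v ∧ eta x v = etaN n x v := by
  rcases eq_or_ne v 0 with rfl | hv
  · exact ⟨0, abs_pos_zero_right hx, by rw [eta_zero, etaN_zero, add_zero]⟩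
  have hc := half_pos hx v
  have hN := norm_pos_iff.2 hv
  -- Each reflection lowers `pos` by `2c > 0`, so only finitely many occur before time `1`.
  -- Minimality of `numBounces` then gives `pos < c` on the last chord and `pos ≥ c` on the one
  -- before, that is, `pos ≥ -c` on the last.
  have hne : {n : ℕ | 1 < bounceTime x v (n + 1)}.Nonempty := by
    obtain ⟨n, hn⟩ := exists_nat_gt ((along x v + ‖v‖) / (2 * half x v))
    refine ⟨n, (one_lt_bounceTime_succ n hx hv).2 ?_⟩
    rw [div_lt_iff₀ (by positivity)] at hn
    rw [pos]
    linarith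
  have h1 : pos (numBounces x v) x v < half x v :=
    (one_lt_bounceTime_succ _ hx hv).1 (Nat.sInf_mem hne)
  have h2 : ∀ k < numBounces x v, half x v ≤ pos k x v := fun k hk => by
    have := Nat.notMem_of_lt_sInf hk
    rw [mem_ofPred_eq, one_lt_bounceTime_succ k hx hv] at this
    exact not_lt.1 this
  refine ⟨numBounces x v, ?_, ?_⟩
  · rw [abs_le]
    refine ⟨?_, h1.le⟩
    rcases hn : numBounces x v with _ | k
    · rw [pos]
      push_cast
      linarith [(abs_lt.1 (abs_along_lt hx v)).1]
    · have := h2 k (by omega)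
      rw [pos_succ]
      linarith
  · rw [eta]
    rcases hn : numBounces x v with _ | k
    · simp [bounceTime, bounce, etaN_zero]
    · rw [bounce_succ k hx hv, bounceTime_succ k hx hv, etaN_eq, hitN_eq_succ, pos_succ, smul_smul]
      have : (1 - (half x v + ‖v‖ - pos k x v) / ‖v‖) * ‖v‖ = pos k x v - half x v := by
        field_simp
        ring
      simp only [this]
      module

/-- Holds for closed branches: at an impact exactly at time `1` either of the two adjacent formulas
is valid. -/
lemma eta_eq_etaN {n : ℕ} (hx : ‖x‖ < 1) (h : |pos n x v| ≤ half x v) :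
    eta x v = etaN n x v := by
  obtain ⟨k, hk, e⟩ := exists_eta_eq hx v
  rw [e, etaN_eq_of_abs_pos_le hx hk h]

/-! ### Pointwise Lipschitz bounds -/

/-- The pointwise Lipschitz constant of `g` at `v` is at most `L`. -/
def PointLip {V W : Type*} [NormedAddCommGroup V] [NormedAddCommGroup W] (g : V → W) (v : V)
    (L : ℝ) : Prop :=
  ∀ r, L < r → ∀ᶠ w in 𝓝 v, ‖g w - g v‖ ≤ r * ‖w - v‖

section

variable {V W : Type*} [NormedAddCommGroup V] [NormedAddCommGroup W] {g : V → W} {v : V} {L : ℝ}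

lemma PointLip.mono {L' : ℝ} (h : PointLip g v L) (hL : L ≤ L') : PointLip g v L' :=
  fun r hr => h r (hL.trans_lt hr)

lemma PointLip.continuousAt (h : PointLip g v L) : ContinuousAt g v := by
  rw [ContinuousAt, tendsto_iff_norm_sub_tendsto_zero]
  have h1 : Tendsto (fun w => (L + 1) * ‖w - v‖) (𝓝 v) (𝓝 0) := by
    have : ContinuousAt (fun w => (L + 1) * ‖w - v‖) v := by fun_prop
    simpa [ContinuousAt] using this
  exact squeeze_zero' (.of_forall fun _ => norm_nonneg _) (h (L + 1) (lt_add_one L)) h1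

lemma eventually_of_cover {X : Type*} {l : Filter X} {n : ℕ} {A : ℕ → Prop} {P : ℕ → X → Prop}
    {Q : X → Prop} (hc : ∀ᶠ z in l, ∃ k ≤ n, A k ∧ P k z)
    (h : ∀ k, A k → ∀ᶠ z in l, P k z → Q z) : ∀ᶠ z in l, Q z := by
  have h1 : ∀ᶠ z in l, ∀ k ∈ Finset.range (n + 1), A k → P k z → Q z := by
    rw [Filter.eventually_all_finset]
    intro k _
    by_cases hk : A k
    · filter_upwards [h k hk] with z hz _ using hz
    · exact .of_forall fun z h => absurd h hk
  filter_upwards [hc, h1] with z ⟨k, hk, hA, hP⟩ hz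
  exact hz k (Finset.mem_range.2 (by omega)) hA hP

variable [NormedSpace ℝ V]

/-- A mean value inequality on the segment from `v` to `w`, without any differentiability. -/
lemma norm_sub_le_of_pointLip (h : ∀ v, PointLip g v L) (v w : V) :
    ‖g w - g v‖ ≤ L * ‖w - v‖ := by
  have key : ∀ r, L < r → ‖g w - g v‖ ≤ r * ‖w - v‖ := by
    intro r hr
    set γ : ℝ → V := fun t => v + t • (w - v) with hγ
    have hγc : Continuous γ := by fun_prop
    have hcont : Continuous g := continuous_iff_continuousAt.2 fun v => (h v).continuousAt
    -- The midpoint `(L + r) / 2` leaves strict room both above `L` and below the slope `r` of the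
    -- comparison function.
    have hslope : ∀ t ∈ Ico (0 : ℝ) 1, ∀ s, (L + r) / 2 * ‖w - v‖ < s →
        ∃ᶠ z in 𝓝[>] t, slope (norm ∘ fun t => g (γ t) - g v) t z < s := by
      intro t _ s hs
      refine Eventually.frequently ?_
      have h1 := ((hγc.tendsto t).mono_left (nhdsWithin_le_nhds (s := Ioi t))).eventually
        (h (γ t) ((L + r) / 2) (by linarith))
      filter_upwards [h1, self_mem_nhdsWithin] with z hz hzt
      have hzt' : 0 < z - t := sub_pos.2 hzt
      refine lt_of_le_of_lt ?_ hs
      rw [slope_def_field, div_le_iff₀ hzt']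
      have e : γ z - γ t = (z - t) • (w - v) := by simp only [hγ]; module
      rw [e, norm_smul, Real.norm_of_nonneg hzt'.le] at hz
      calc ‖g (γ z) - g v‖ - ‖g (γ t) - g v‖ ≤ ‖g (γ z) - g v - (g (γ t) - g v)‖ :=
            norm_sub_norm_le _ _
        _ = ‖g (γ z) - g (γ t)‖ := by rw [sub_sub_sub_cancel_right]
        _ ≤ (L + r) / 2 * ‖w - v‖ * (z - t) := by linarith
    rcases eq_or_ne w v with rfl | hwv
    · simp
    have hpos : 0 < ‖w - v‖ := norm_pos_iff.2 (sub_ne_zero.2 hwv)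
    have := image_norm_le_of_liminf_right_slope_norm_lt_deriv_boundary
      (f := fun t => g (γ t) - g v) (f' := fun _ => (L + r) / 2 * ‖w - v‖) (a := 0) (b := 1)
      (B := fun t => r * ‖w - v‖ * t) (B' := fun _ => r * ‖w - v‖)
      ((hcont.comp hγc).sub continuous_const).continuousOn hslope (by simp [hγ])
      (by fun_prop)
      (fun t _ => by
        simpa using ((hasDerivAt_id t).const_mul (r * ‖w - v‖)).hasDerivWithinAt)
      (fun t _ _ => by gcongr; linarith) (right_mem_Icc.2 zero_le_one)
    simpa [hγ] using this
  refine le_of_forall_pos_le_add fun ε hε => ?_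
  rcases eq_or_ne w v with rfl | hwv
  · simpa using hε.le
  have hpos : 0 < ‖w - v‖ := norm_pos_iff.2 (sub_ne_zero.2 hwv)
  refine (key (L + ε / ‖w - v‖) (by have := div_pos hε hpos; linarith)).trans_eq ?_
  field_simp

lemma lipschitzWith_of_pointLip {K : NNReal} (h : ∀ v, PointLip g v K) : LipschitzWith K g :=
  LipschitzWith.of_dist_le_mul fun w v => by
    rw [dist_eq_norm, dist_eq_norm]
    exact norm_sub_le_of_pointLip h v w

variable [NormedSpace ℝ W]

lemma PointLip.norm_fderiv_le (h : PointLip g v L) (hL : 0 ≤ L) : ‖fderiv ℝ g v‖ ≤ L := by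
  by_cases hd : DifferentiableAt ℝ g v
  · exact le_of_forall_gt_imp_ge_of_dense fun r hr =>
      hd.hasFDerivAt.le_of_lip' (hL.trans hr.le) (h r hr)
  · rw [fderiv_zero_of_not_differentiableAt hd, norm_zero]
    exact hL

lemma hasFDerivAt_of_cover {n : ℕ} {A : ℕ → Prop} {s : ℕ → Set V} {g' : V →L[ℝ] W}
    (hc : ∀ᶠ w in 𝓝 v, ∃ k ≤ n, A k ∧ w ∈ s k)
    (h : ∀ k, A k → HasFDerivWithinAt g g' (s k) v) : HasFDerivAt g g' v := by
  rw [hasFDerivAt_iff_isLittleO, Asymptotics.isLittleO_iff]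
  intro ε hε
  refine eventually_of_cover hc fun k hk => ?_
  have := h k hk
  rw [hasFDerivWithinAt_iff_isLittleO, Asymptotics.isLittleO_iff] at this
  exact eventually_nhdsWithin_iff.1 (this hε)

/-- Differentiability within each of finitely many sets covering a neighborhood suffices, even if
the derivatives disagree. This handles the interfaces. -/
lemma pointLip_of_cover {n : ℕ} {A : ℕ → Prop} {s : ℕ → Set V} {g' : ℕ → V →L[ℝ] W}
    (hc : ∀ᶠ w in 𝓝 v, ∃ k ≤ n, A k ∧ w ∈ s k)
    (h : ∀ k, A k → HasFDerivWithinAt g (g' k) (s k) v ∧ ‖g' k‖ ≤ L) : PointLip g v L := by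
  intro r hr
  refine eventually_of_cover hc fun k hk => ?_
  obtain ⟨h1, h2⟩ := h k hk
  rw [hasFDerivWithinAt_iff_isLittleO, Asymptotics.isLittleO_iff] at h1
  refine (eventually_nhdsWithin_iff.1 (h1 (sub_pos.2 hr))).mono fun w hw hws => ?_
  have h3 := hw hws
  have h4 : ‖g' k (w - v)‖ ≤ L * ‖w - v‖ :=
    (g' k).le_of_opNorm_le h2 _
  calc ‖g w - g v‖ = ‖(g w - g v - g' k (w - v)) + g' k (w - v)‖ := by rw [sub_add_cancel]
    _ ≤ (r - L) * ‖w - v‖ + L * ‖w - v‖ := norm_add_le_of_le h3 h4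
    _ = r * ‖w - v‖ := by ring

end

/-! ### Smoothness of the branches and the cover by them -/

section

variable {V : Type*} [NormedAddCommGroup V] [InnerProductSpace ℝ V] {x v : V}

lemma contDiff_rot (n : ℕ) : ContDiff ℝ ∞ (rotCos n) ∧ ContDiff ℝ ∞ (rotSin n) := by
  induction n with
  | zero => exact ⟨contDiff_const, contDiff_const⟩
  | succ n ih =>
    obtain ⟨h1, h2⟩ := ih
    rw [show rotCos (n + 1) = fun c => (1 - 2 * c ^ 2) * rotCos n c -
      2 * c * (1 - c ^ 2) * rotSin n c from funext (rotCos_succ n), show rotSin (n + 1) = fun c =>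
      (1 - 2 * c ^ 2) * rotSin n c + 2 * c * rotCos n c from funext (rotSin_succ n)]
    exact ⟨by fun_prop, by fun_prop⟩

lemma contDiffAt_dir (hv : v ≠ 0) : ContDiffAt ℝ ∞ (fun z : V × V => dir z.2) (x, v) := by
  have h : ContDiffAt ℝ ∞ (fun z : V × V => ‖z.2‖) (x, v) :=
    contDiffAt_snd.norm ℝ hv
  exact (h.inv (norm_ne_zero_iff.2 hv)).smul contDiffAt_snd

lemma contDiffAt_along (hv : v ≠ 0) :
    ContDiffAt ℝ ∞ (fun z : V × V => along z.1 z.2) (x, v) :=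
  contDiffAt_fst.inner ℝ (contDiffAt_dir hv)

lemma contDiffAt_half (hx : ‖x‖ < 1) (hv : v ≠ 0) :
    ContDiffAt ℝ ∞ (fun z : V × V => half z.1 z.2) (x, v) := by
  refine ContDiffAt.sqrt ?_ ?_
  · exact (contDiffAt_const.sub (contDiffAt_fst.norm_sq ℝ)).add ((contDiffAt_along hv).pow 2)
  · rw [← half_sq hx]
    exact (pow_pos (half_pos hx v) 2).ne'

lemma contDiffAt_pos (n : ℕ) (hx : ‖x‖ < 1) (hv : v ≠ 0) :
    ContDiffAt ℝ ∞ (fun z : V × V => pos n z.1 z.2) (x, v) :=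
  ((contDiffAt_along hv).add (contDiffAt_snd.norm ℝ hv)).sub
    (contDiffAt_const.mul (contDiffAt_half hx hv))

lemma contDiffAt_etaN (n : ℕ) (hx : ‖x‖ < 1) (hv : v ≠ 0 ∨ n = 0) :
    ContDiffAt ℝ ∞ (fun z : V × V => etaN n z.1 z.2) (x, v) := by
  rcases hv with hv | rfl
  · have hc := contDiffAt_half hx hv
    have hu := contDiffAt_pos n hx hv
    have hp := contDiffAt_dir (x := x) hv
    have hC := (contDiff_rot n).1.contDiffAt.comp (x, v) hc
    have hS := (contDiff_rot n).2.contDiffAt.comp (x, v) hc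
    have hm : ContDiffAt ℝ ∞ (fun z : V × V => mid z.1 z.2) (x, v) :=
      contDiffAt_fst.sub ((contDiffAt_along hv).smul hp)
    exact ((hC.sub (hu.mul hS)).smul hm).add
      (((hu.mul hC).add ((contDiffAt_const.sub (hc.pow 2)).mul hS)).smul hp)
  · simp_rw [etaN_zero]
    fun_prop

/-- For `v = 0` the position is `-2nc`, which is in `[-c, c]` only for `n = 0`. So the singularity
of `dir` at `0` matters only for the branch `x + v`, which does not see it. -/
lemma ne_zero_or_of_abs_pos_le {n : ℕ} (hx : ‖x‖ < 1) (h : |pos n x v| ≤ half x v) :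
    v ≠ 0 ∨ n = 0 := by
  by_contra! hn
  obtain ⟨rfl, hn⟩ := hn
  have hc := half_pos hx (0 : V)
  have h1 : (1 : ℝ) ≤ n := by exact_mod_cast Nat.one_le_iff_ne_zero.2 hn
  have h2 := (abs_le.1 h).1
  have h3 : along x (0 : V) = 0 := by simp [along, dir]
  rw [pos, h3, norm_zero] at h2
  nlinarith

lemma norm_etaN_sq_of_abs_pos_le {n : ℕ} (hx : ‖x‖ < 1) (h : |pos n x v| ≤ half x v) :
    ‖etaN n x v‖ ^ 2 = 1 - half x v ^ 2 + pos n x v ^ 2 := by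
  rcases eq_or_ne v 0 with rfl | hv
  · have hn := (ne_zero_or_of_abs_pos_le hx h).resolve_left (by simp)
    subst hn
    rw [etaN_zero, half_sq hx]
    simp [pos, along, dir]
  · exact norm_etaN_sq n hx hv

lemma etaN_mem_closedBall {n : ℕ} (hx : ‖x‖ < 1) (h : |pos n x v| ≤ half x v) :
    etaN n x v ∈ Metric.closedBall (0 : V) 1 := by
  rw [mem_closedBall_zero_iff, ← sq_le_one_iff₀ (norm_nonneg _), norm_etaN_sq_of_abs_pos_le hx h]
  have := sq_le_sq' (abs_le.1 h).1 (abs_le.1 h).2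
  linarith

lemma abs_pos_zero_le (hx : ‖x‖ < 1) (h : ‖x + v‖ ≤ 1) : |pos 0 x v| ≤ half x v := by
  rcases eq_or_ne v 0 with rfl | hv
  · have := half_pos hx (0 : V)
    simp only [pos, along, dir]
    simpa using this.le
  · have h1 := norm_etaN_sq 0 hx hv
    rw [etaN_zero] at h1
    refine abs_le_of_sq_le_sq ?_ (half_pos hx v).le
    nlinarith [norm_nonneg (x + v)]

/-- Near a given initial state, every initial state belongs to one of the branches that contain the
given one. -/
lemma eventually_exists_branch {n : ℕ} (hx : ‖x‖ < 1) (h : |pos n x v| ≤ half x v) :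
    ∀ᶠ z in 𝓝 (x, v), ∃ k ≤ n + 1, |pos k x v| ≤ half x v ∧ |pos k z.1 z.2| ≤ half z.1 z.2 := by
  have hc := half_pos hx v
  have hx' : ∀ᶠ z : V × V in 𝓝 (x, v), ‖z.1‖ < 1 :=
    (continuous_fst.norm.tendsto (x, v)).eventually_lt_const hx
  rcases eq_or_ne v 0 with rfl | hv
  · have hn := (ne_zero_or_of_abs_pos_le hx h).resolve_left (by simp)
    subst hn
    have h1 : ∀ᶠ z : V × V in 𝓝 (x, (0 : V)), ‖z.1 + z.2‖ < 1 := by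
      have : Continuous fun z : V × V => ‖z.1 + z.2‖ := by fun_prop
      exact (this.tendsto (x, 0)).eventually_lt_const (by simpa using hx)
    filter_upwards [hx', h1] with z hz hz1
    exact ⟨0, by omega, h, abs_pos_zero_le hz hz1.le⟩
  have hcc : ContinuousAt (fun z : V × V => half z.1 z.2) (x, v) :=
    (contDiffAt_half hx hv).continuousAt
  have hpc : ∀ n, ContinuousAt (fun z : V × V => pos n z.1 z.2) (x, v) := fun n =>
    (contDiffAt_pos n hx hv).continuousAt
  -- Near an interface `-c < pos n < 3c`, an interval split at `c` into the ranges of the branches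
  -- `n` and `n + 1`.
  have key : ∀ n : ℕ, pos n x v = half x v → ∀ᶠ z in 𝓝 (x, v), ∃ k, (k = n ∨ k = n + 1) ∧
      |pos k x v| ≤ half x v ∧ |pos k z.1 z.2| ≤ half z.1 z.2 := by
    intro n hn
    have e1 : ∀ᶠ z : V × V in 𝓝 (x, v), pos n z.1 z.2 < 3 * half z.1 z.2 :=
      (hpc n).eventually_lt (continuousAt_const.mul hcc) (by rw [hn]; linarith)
    have e2 : ∀ᶠ z : V × V in 𝓝 (x, v), -half z.1 z.2 < pos n z.1 z.2 :=
      ContinuousAt.eventually_lt hcc.fun_neg (hpc n) (by rw [hn]; linarith)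
    filter_upwards [e1, e2] with z h1 h2
    rcases le_total (pos n z.1 z.2) (half z.1 z.2) with h3 | h3
    · exact ⟨n, .inl rfl, by rw [hn, abs_of_pos hc], abs_le.2 ⟨h2.le, h3⟩⟩
    · refine ⟨n + 1, .inr rfl, ?_, ?_⟩
      · rw [pos_succ, hn, abs_le]; constructor <;> linarith
      · rw [pos_succ, abs_le]; constructor <;> linarith
  rcases (abs_le.1 h).2.eq_or_lt with hn | hn
  · filter_upwards [key n hn] with z ⟨k, hk, hz⟩ using ⟨k, by omega, hz⟩
  rcases (abs_le.1 h).1.eq_or_lt with hn' | hn'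
  · rcases n with _ | n
    · rw [pos] at hn'
      push_cast at hn'
      have := (abs_lt.1 (abs_along_lt hx v)).1
      have := norm_nonneg v
      linarith
    · rw [pos_succ] at hn'
      filter_upwards [key n (by linarith)] with z ⟨k, hk, hz⟩ using ⟨k, by omega, hz⟩
  · have e1 := (hpc n).eventually_lt hcc hn
    have e2 := hcc.neg.eventually_lt (hpc n) hn'
    filter_upwards [e1, e2] with z h1 h2
    exact ⟨n, by omega, h, abs_le.2 ⟨h2.le, h1.le⟩⟩

lemma eventually_exists_branch_right {n : ℕ} (hx : ‖x‖ < 1) (h : |pos n x v| ≤ half x v) :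
    ∀ᶠ w in 𝓝 v, ∃ k ≤ n + 1, |pos k x v| ≤ half x v ∧ |pos k x w| ≤ half x w :=
  ((Continuous.prodMk_right x).tendsto v).eventually (eventually_exists_branch hx h)

end

/-! ### Derivatives of a branch and their jump at an interface. -/

section

variable {V : Type*} [NormedAddCommGroup V] [InnerProductSpace ℝ V] {x v : V}

lemma contDiffAt_etaN_right (n : ℕ) (hx : ‖x‖ < 1) (hv : v ≠ 0 ∨ n = 0) :
    ContDiffAt ℝ ∞ (etaN n x) v :=
  (contDiffAt_etaN n hx hv).comp v (f := fun w => (x, w)) (contDiffAt_const.prodMk contDiffAt_id)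

lemma differentiableAt_etaN (n : ℕ) (hx : ‖x‖ < 1) (hv : v ≠ 0 ∨ n = 0) :
    DifferentiableAt ℝ (etaN n x) v :=
  (contDiffAt_etaN_right n hx hv).differentiableAt (by simp)

lemma differentiableAt_fderiv_etaN (n : ℕ) (hx : ‖x‖ < 1) (hv : v ≠ 0 ∨ n = 0) :
    DifferentiableAt ℝ (fderiv ℝ (etaN n x)) v :=
  ((contDiffAt_etaN_right n hx hv).fderiv_right (m := 1) (by norm_cast)).differentiableAt (by simp)

lemma continuousAt_fderiv_etaN (n : ℕ) (hx : ‖x‖ < 1) (hv : v ≠ 0 ∨ n = 0) :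
    ContinuousAt (fun z : V × V => fderiv ℝ (etaN n z.1) z.2) (x, v) := by
  have h : ContDiffAt ℝ ∞ (Function.uncurry fun (z : V × V) (w : V) => etaN n z.1 w)
      ((x, v), v) :=
    (contDiffAt_etaN n hx hv).comp ((x, v), v) (f := fun p : (V × V) × V => (p.1.1, p.2))
      (contDiffAt_fst.fst.prodMk contDiffAt_snd)
  exact (ContDiffAt.fderiv (m := 0) (n := ∞) h contDiffAt_snd (by simp)).continuousAt

lemma fderiv_etaN_zero (x v : V) : fderiv ℝ (etaN 0 x) v = ContinuousLinearMap.id ℝ V := by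
  rw [show etaN 0 x = fun v => x + v from funext (etaN_zero x), fderiv_const_add, fderiv_fun_id]

lemma norm_fderiv_etaN_le {n : ℕ} (hx : ‖x‖ < 1) (h : |pos n x v| ≤ half x v) :
    ‖fderiv ℝ (etaN n x) v‖ ≤ 20 := by
  rcases ne_zero_or_of_abs_pos_le hx h with hv | rfl
  · refine ContinuousLinearMap.opNorm_le_of_unit_norm (by norm_num) fun b hb => ?_
    rw [(hasDirDeriv_etaN n hx hv).fderiv_apply]
    exact norm_etaD_le n hx hv h hb
  · rw [fderiv_etaN_zero]
    exact ContinuousLinearMap.norm_id_le.trans (by norm_num)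

lemma fderiv_fderiv_etaN_apply (n : ℕ) (hx : ‖x‖ < 1) (hv : v ≠ 0) (a b : V) :
    fderiv ℝ (fderiv ℝ (etaN n x)) v a b = etaDD n x v a b := by
  have h1 := (differentiableAt_fderiv_etaN n hx (.inl hv)).hasFDerivAt.clm_apply
    (hasFDerivAt_const b v)
  have h2 : (fun w => fderiv ℝ (etaN n x) w b) =ᶠ[𝓝 v] fun w => etaD n x w b := by
    filter_upwards [isOpen_ne.mem_nhds hv] with w hw
    exact (hasDirDeriv_etaN n hx hw).fderiv_apply b
  have h3 := congrArg (fun L => L a) (h1.fderiv.symm.trans h2.fderiv_eq)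
  rw [(hasDirDeriv_etaD n hx hv b).fderiv_apply a] at h3
  simpa using h3

/-- Adjacent branches differ by a multiple of the common normal where they meet. -/
lemma fderiv_etaN_succ_apply {n : ℕ} (hx : ‖x‖ < 1) (hv : v ≠ 0) (h : pos n x v = half x v)
    (a : V) : ∃ r : ℝ, fderiv ℝ (etaN (n + 1) x) v a =
      fderiv ℝ (etaN n x) v a + r • etaN n x v := by
  have hc := hasDirDeriv_half hx hv
  have hu := hasDirDeriv_pos n hx hv
  have hC := hasDirDeriv_rotCos n hx hv
  have hS := hasDirDeriv_rotSin n hx hv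
  have hp := hasDirDeriv_dir hv
  have hm := hasDirDeriv_mid (x := x) hv
  have hy := ((hC.smul hm).add ((((HasDirDeriv.const 1 v).sub (hc.mul hc)).mul hS).smul hp)).add
    (hc.smul ((hC.smul hp).sub (hS.smul hm)))
  simp only [← sq (half x _)] at hy
  have h1 := (hasDirDeriv_etaN n hx hv).sub (((hc.const_mul 2).mul (hu.sub hc)).smul hy)
  have e : etaN (n + 1) x = fun w => etaN n x w -
      (2 * half x w * (pos n x w - half x w)) • hitN n x w := funext (etaN_succ n x)
  have h2 := h1.fderiv_apply a
  change fderiv ℝ (fun w => etaN n x w -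
      (2 * half x w * (pos n x w - half x w)) • hitN n x w) v a = _ at h2
  have h3 : etaN n x v = hitN n x v := by rw [etaN_eq, hitN, h]
  rw [← e] at h2
  -- On the interface the factor `pos n - half` is zero, so only its own derivative survives in the
  -- product rule, times the normal.
  refine ⟨-(2 * half x v * (posD n x v a - halfD x v a)), ?_⟩
  rw [h2, (hasDirDeriv_etaN n hx hv).fderiv_apply, h3, hitN, midN, dirN, h, sub_self, mul_zero,
    mul_zero]
  module

end

/-! ### Composition with a function that satisfies the Neumann condition -/

/-- `φ'` and `φ''` are the first two derivatives of `φ` on the closed unit ball; they are bounded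
by `M`, and the radial derivative vanishes linearly at the boundary. -/
structure NeumannBounds {V : Type*} [NormedAddCommGroup V] [NormedSpace ℝ V] (φ : V → ℝ)
    (φ' : V → V →L[ℝ] ℝ) (φ'' : V → V →L[ℝ] V →L[ℝ] ℝ) (M : ℝ) : Prop where
  hasDeriv : ∀ y ∈ Metric.closedBall (0 : V) 1,
    HasFDerivWithinAt φ (φ' y) (Metric.closedBall 0 1) y
  hasDeriv₂ : ∀ y ∈ Metric.closedBall (0 : V) 1,
    HasFDerivWithinAt φ' (φ'' y) (Metric.closedBall 0 1) y
  norm_le : ∀ y ∈ Metric.closedBall (0 : V) 1, ‖φ' y‖ ≤ M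
  norm_le₂ : ∀ y ∈ Metric.closedBall (0 : V) 1, ‖φ'' y‖ ≤ M
  radial : ∀ y ∈ Metric.closedBall (0 : V) 1, |φ' y y| ≤ M * (1 - ‖y‖ ^ 2)

section

variable {V : Type*} [NormedAddCommGroup V] [InnerProductSpace ℝ V] {x v : V} {φ : V → ℝ}
  {φ' : V → V →L[ℝ] ℝ} {φ'' : V → V →L[ℝ] V →L[ℝ] ℝ} {M : ℝ}

lemma NeumannBounds.nonneg (hφ : NeumannBounds φ φ' φ'' M) : 0 ≤ M :=
  (norm_nonneg _).trans (hφ.norm_le 0 (by simp))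

/-- The gradient in `v` of `φ (etaN n x v)`. -/
noncomputable def gradN (φ' : V → V →L[ℝ] ℝ) (n : ℕ) (x v : V) : V →L[ℝ] ℝ :=
  (φ' (etaN n x v)).comp (fderiv ℝ (etaN n x) v)

/-- The second derivative in `v` of `φ (etaN n x v)`. -/
noncomputable def hessN (φ' : V → V →L[ℝ] ℝ) (φ'' : V → V →L[ℝ] V →L[ℝ] ℝ) (n : ℕ) (x v : V) :
    V →L[ℝ] V →L[ℝ] ℝ :=
  ((ContinuousLinearMap.compL ℝ V V ℝ) (φ' (etaN n x v))).comp
      (fderiv ℝ (fderiv ℝ (etaN n x)) v) +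
    ((ContinuousLinearMap.compL ℝ V V ℝ).flip (fderiv ℝ (etaN n x) v)).comp
      ((φ'' (etaN n x v)).comp (fderiv ℝ (etaN n x) v))

/-- The set of velocities for which the position at time `1` is on the chord with number `n`. -/
def branch (n : ℕ) (x : V) : Set V := {v | |pos n x v| ≤ half x v}

lemma hasFDerivWithinAt_comp_etaN (hφ : NeumannBounds φ φ' φ'' M) {n : ℕ} (hx : ‖x‖ < 1)
    (h : v ∈ branch n x) :
    HasFDerivWithinAt (fun w => φ (etaN n x w)) (gradN φ' n x v) (branch n x) v :=
  (hφ.hasDeriv _ (etaN_mem_closedBall hx h)).comp v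
    (differentiableAt_etaN n hx (ne_zero_or_of_abs_pos_le hx h)).hasFDerivAt.hasFDerivWithinAt
    fun _ hw => etaN_mem_closedBall hx hw

lemma hasFDerivWithinAt_gradN (hφ : NeumannBounds φ φ' φ'' M) {n : ℕ} (hx : ‖x‖ < 1)
    (h : v ∈ branch n x) :
    HasFDerivWithinAt (gradN φ' n x) (hessN φ' φ'' n x v) (branch n x) v := by
  have hv := ne_zero_or_of_abs_pos_le hx h
  have h1 : HasFDerivWithinAt (fun w => φ' (etaN n x w))
      ((φ'' (etaN n x v)).comp (fderiv ℝ (etaN n x) v)) (branch n x) v :=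
    (hφ.hasDeriv₂ _ (etaN_mem_closedBall hx h)).comp v
      (differentiableAt_etaN n hx hv).hasFDerivAt.hasFDerivWithinAt
      fun _ hw => etaN_mem_closedBall hx hw
  exact h1.clm_comp (differentiableAt_fderiv_etaN n hx hv).hasFDerivAt.hasFDerivWithinAt

lemma norm_gradN_le (hφ : NeumannBounds φ φ' φ'' M) {n : ℕ} (hx : ‖x‖ < 1)
    (h : v ∈ branch n x) : ‖gradN φ' n x v‖ ≤ M * 20 :=
  (ContinuousLinearMap.opNorm_comp_le _ _).trans (mul_le_mul
    (hφ.norm_le _ (etaN_mem_closedBall hx h)) (norm_fderiv_etaN_le hx h) (norm_nonneg _) hφ.nonneg)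

/-- This is where the Neumann condition gains one power of `c`: the part of order `c⁻²` is along
`midN`, and `φ'` along `midN` is only of order `c`. -/
lemma abs_deriv_fderiv_fderiv_etaN_le (hφ : NeumannBounds φ φ' φ'' M) {n : ℕ} (hx : ‖x‖ < 1)
    (h : v ∈ branch n x) {a b : V} (ha : ‖a‖ = 1) (hb : ‖b‖ = 1) :
    |φ' (etaN n x v) (fderiv ℝ (fderiv ℝ (etaN n x)) v a b)| ≤ 1200 * M * (half x v)⁻¹ := by
  have hc := half_pos hx v
  have hc1 := half_le_one x v
  have hM := hφ.nonneg
  have hmem := etaN_mem_closedBall hx h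
  have hφ1 := hφ.norm_le _ hmem
  by_cases hn : v = 0 ∨ n = 0
  · have hn : n = 0 := by
      rcases hn with rfl | hn
      · exact (ne_zero_or_of_abs_pos_le hx h).resolve_left (by simp)
      · exact hn
    subst hn
    have e : fderiv ℝ (etaN 0 x) = fun _ => ContinuousLinearMap.id ℝ V :=
      funext (fderiv_etaN_zero x)
    rw [e, fderiv_fun_const]
    simp only [Pi.zero_apply, _root_.zero_apply, map_zero, abs_zero]
    positivity
  push Not at hn
  obtain ⟨K, hK, hR⟩ := etaDD_decomposition n hx hn.1 h ha hb
  rw [fderiv_fderiv_etaN_apply n hx hn.1]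
  -- `midN = etaN - pos • dirN`. The radial part is at most `M (1 - ‖etaN‖²) = M (c² - pos²)`, and
  -- the other part is at most `|pos| M ≤ c M`.
  have h1 : |φ' (etaN n x v) (midN n x v)| ≤ M * half x v ^ 2 + half x v * M := by
    have e : midN n x v = etaN n x v - pos n x v • dirN n x v := by rw [etaN_eq]; abel
    have h2 : |φ' (etaN n x v) (dirN n x v)| ≤ M := by
      rw [← Real.norm_eq_abs]
      refine ((φ' (etaN n x v)).le_of_opNorm_le hφ1 _).trans_eq ?_
      rw [norm_dirN n hx hn.1, mul_one]
    have h3 : |φ' (etaN n x v) (etaN n x v)| ≤ M * half x v ^ 2 := by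
      refine (hφ.radial _ hmem).trans ?_
      gcongr
      rw [norm_etaN_sq n hx hn.1]
      nlinarith [sq_nonneg (pos n x v)]
    rw [e, map_sub, map_smul, smul_eq_mul]
    exact abs_sub_le_of_le h3 (abs_mul_le_of_le h h2)
  have e : etaDD n x v a b = K • midN n x v + (etaDD n x v a b - K • midN n x v) := by abel
  rw [e, map_add, map_smul, smul_eq_mul]
  have h2 : |φ' (etaN n x v) (etaDD n x v a b - K • midN n x v)| ≤ M * (400 * (half x v)⁻¹) := by
    rw [← Real.norm_eq_abs]
    exact ((φ' (etaN n x v)).le_of_opNorm_le hφ1 _).trans (by gcongr)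
  refine (abs_add_le_of_le (abs_mul_le_of_le hK h1) h2).trans ?_
  have hi : half x v * (half x v)⁻¹ = 1 := mul_inv_cancel₀ hc.ne'
  have hi1 : 1 ≤ (half x v)⁻¹ := (one_le_inv₀ hc).2 hc1
  have e2 : 400 * (half x v)⁻¹ ^ 2 * (M * half x v ^ 2 + half x v * M) =
      400 * M * (half x v * (half x v)⁻¹) ^ 2 + 400 * M * (half x v)⁻¹ *
        (half x v * (half x v)⁻¹) := by ring
  rw [e2, hi]
  nlinarith

lemma norm_hessN_le (hφ : NeumannBounds φ φ' φ'' M) {n : ℕ} (hx : ‖x‖ < 1)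
    (h : v ∈ branch n x) : ‖hessN φ' φ'' n x v‖ ≤ 1600 * M * (half x v)⁻¹ := by
  have hc := half_pos hx v
  have hc1 := half_le_one x v
  have hM := hφ.nonneg
  have hD := norm_fderiv_etaN_le hx h
  refine ContinuousLinearMap.opNorm_le_of_unit_norm (by positivity) fun a ha => ?_
  refine ContinuousLinearMap.opNorm_le_of_unit_norm (by positivity) fun b hb => ?_
  have h1 := abs_deriv_fderiv_fderiv_etaN_le hφ hx h ha hb
  have hDa : ∀ a : V, ‖a‖ = 1 → ‖fderiv ℝ (etaN n x) v a‖ ≤ 20 := fun a ha =>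
    ((fderiv ℝ (etaN n x) v).le_of_opNorm_le hD a).trans (by rw [ha, mul_one])
  have h2 : ‖φ'' (etaN n x v) (fderiv ℝ (etaN n x) v a) (fderiv ℝ (etaN n x) v b)‖ ≤
      M * 20 * 20 := by
    refine (ContinuousLinearMap.le_opNorm₂ _ _ _).trans ?_
    gcongr
    exacts [hφ.norm_le₂ _ (etaN_mem_closedBall hx h), hDa a ha, hDa b hb]
  have e : hessN φ' φ'' n x v a b = φ' (etaN n x v) (fderiv ℝ (fderiv ℝ (etaN n x)) v a b) +
      φ'' (etaN n x v) (fderiv ℝ (etaN n x) v a) (fderiv ℝ (etaN n x) v b) := by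
    simp [hessN]
  rw [e]
  refine (norm_add_le_of_le h1 h2).trans ?_
  have hi1 : 1 ≤ (half x v)⁻¹ := (one_le_inv₀ hc).2 hc1
  nlinarith

/-- Adjacent branches have gradients that differ by a normal vector, on which `φ'` vanishes at the
boundary. -/
lemma gradN_eq (hφ : NeumannBounds φ φ' φ'' M) {n k : ℕ} (hx : ‖x‖ < 1) (hn : v ∈ branch n x)
    (hk : v ∈ branch k x) : gradN φ' n x v = gradN φ' k x v := by
  have key : ∀ n : ℕ, v ∈ branch n x → v ∈ branch (n + 1) x → pos n x v = half x v →
      gradN φ' (n + 1) x v = gradN φ' n x v := by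
    intro n hn hn1 h
    have hv := (ne_zero_or_of_abs_pos_le hx hn1).resolve_right (by omega)
    have hmem := etaN_mem_closedBall hx hn
    ext a
    obtain ⟨r, hr⟩ := fderiv_etaN_succ_apply hx hv h a
    have h0 : φ' (etaN n x v) (etaN n x v) = 0 := by
      have := hφ.radial _ hmem
      rw [norm_etaN_sq n hx hv, h] at this
      rw [← abs_nonpos_iff]
      linarith
    rw [gradN, gradN, ContinuousLinearMap.comp_apply, ContinuousLinearMap.comp_apply, hr,
      etaN_eq_of_abs_pos_le hx hn1 hn, map_add, map_smul, h0, smul_zero, add_zero]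
  rcases eq_or_adjacent hx hn hk with rfl | ⟨rfl, h⟩ | ⟨rfl, h⟩
  · rfl
  · exact key k hk hn h
  · exact (key n hn hk h).symm

end

/-! ### Gluing the branches: regularity of `eta` and of its compositions. -/

section

variable {d : ℕ} {x v : E d} {φ : E d → ℝ} {φ' : E d → E d →L[ℝ] ℝ}
  {φ'' : E d → E d →L[ℝ] E d →L[ℝ] ℝ} {M : ℝ}

lemma exists_mem_branch (hx : ‖x‖ < 1) (v : E d) : ∃ n, v ∈ branch n x :=
  let ⟨n, h, _⟩ := exists_eta_eq hx v
  ⟨n, h⟩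

lemma eta_mem_closedBall (hx : ‖x‖ < 1) (v : E d) :
    eta x v ∈ Metric.closedBall (0 : E d) 1 := by
  obtain ⟨n, h, e⟩ := exists_eta_eq hx v
  rw [e]
  exact etaN_mem_closedBall hx h

lemma pointLip_eta (hx : ‖x‖ < 1) (v : E d) : PointLip (eta x) v 20 := by
  obtain ⟨n, hn⟩ := exists_mem_branch hx v
  refine pointLip_of_cover (s := fun k => branch k x) (g' := fun k => fderiv ℝ (etaN k x) v)
    (eventually_exists_branch_right hx hn) fun k hk => ⟨?_, norm_fderiv_etaN_le hx hk⟩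
  exact (differentiableAt_etaN k hx (ne_zero_or_of_abs_pos_le hx hk)).hasFDerivAt.hasFDerivWithinAt
    |>.congr (fun w hw => eta_eq_etaN hx hw) (eta_eq_etaN hx hk)

/-- Valid at every `v`, the interfaces included, where `eta x` itself may fail to be differentiable.
-/
lemma hasFDerivAt_comp_eta (hφ : NeumannBounds φ φ' φ'' M) {n : ℕ} (hx : ‖x‖ < 1)
    (hn : v ∈ branch n x) : HasFDerivAt (fun w => φ (eta x w)) (gradN φ' n x v) v := by
  refine hasFDerivAt_of_cover (s := fun k => branch k x)
    (eventually_exists_branch_right hx hn) fun k hk => ?_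
  rw [gradN_eq hφ hx hn hk]
  exact (hasFDerivWithinAt_comp_etaN hφ hx hk).congr (fun w hw => by rw [eta_eq_etaN hx hw])
    (by rw [eta_eq_etaN hx hk])

lemma fderiv_comp_eta (hφ : NeumannBounds φ φ' φ'' M) {n : ℕ} (hx : ‖x‖ < 1)
    (hn : v ∈ branch n x) : fderiv ℝ (fun w => φ (eta x w)) v = gradN φ' n x v :=
  (hasFDerivAt_comp_eta hφ hx hn).fderiv

lemma differentiable_comp_eta (hφ : NeumannBounds φ φ' φ'' M) (hx : ‖x‖ < 1) :
    Differentiable ℝ fun w => φ (eta x w) := fun v =>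
  let ⟨_, hn⟩ := exists_mem_branch hx v
  (hasFDerivAt_comp_eta hφ hx hn).differentiableAt

lemma norm_fderiv_comp_eta_le (hφ : NeumannBounds φ φ' φ'' M) (hx : ‖x‖ < 1) (v : E d) :
    ‖fderiv ℝ (fun w => φ (eta x w)) v‖ ≤ M * 20 := by
  obtain ⟨n, hn⟩ := exists_mem_branch hx v
  rw [fderiv_comp_eta hφ hx hn]
  exact norm_gradN_le hφ hx hn

lemma pointLip_fderiv_comp_eta (hφ : NeumannBounds φ φ' φ'' M) (hx : ‖x‖ < 1) (v : E d) :
    PointLip (fderiv ℝ fun w => φ (eta x w)) v (1600 * M * (half x v)⁻¹) := by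
  obtain ⟨n, hn⟩ := exists_mem_branch hx v
  refine pointLip_of_cover (s := fun k => branch k x) (g' := fun k => hessN φ' φ'' k x v)
    (eventually_exists_branch_right hx hn) fun k hk => ⟨?_, norm_hessN_le hφ hx hk⟩
  exact (hasFDerivWithinAt_gradN hφ hx hk).congr (fun w hw => fderiv_comp_eta hφ hx hw)
    (fderiv_comp_eta hφ hx hk)

/-- Joint continuity in `(x, v)` is needed for the measurability of derivatives with a parameter. -/
lemma continuousAt_of_branches {W : Type*} [TopologicalSpace W] {f : E d × E d → W}
    {F : ℕ → E d × E d → W} (hx : ‖x‖ < 1)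
    (hf : ∀ (n : ℕ) (x v : E d), ‖x‖ < 1 → v ∈ branch n x → f (x, v) = F n (x, v))
    (hF : ∀ n : ℕ, v ∈ branch n x → ContinuousAt (F n) (x, v)) : ContinuousAt f (x, v) := by
  obtain ⟨n, hn⟩ := exists_mem_branch hx v
  have hx' : ∀ᶠ z : E d × E d in 𝓝 (x, v), ‖z.1‖ < 1 :=
    (continuous_fst.norm.tendsto (x, v)).eventually_lt_const hx
  intro U hU
  rw [mem_map]
  refine eventually_of_cover (eventually_exists_branch hx hn) fun k hk => ?_
  have h1 : F k ⁻¹' U ∈ 𝓝 (x, v) := hF k hk (hf k x v hx hk ▸ hU)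
  filter_upwards [h1, hx'] with z hz hz1 hzk
  change f (z.1, z.2) ∈ U
  rw [hf k z.1 z.2 hz1 hzk]
  exact hz

lemma continuousAt_eta (hx : ‖x‖ < 1) (v : E d) :
    ContinuousAt (fun z : E d × E d => eta z.1 z.2) (x, v) :=
  continuousAt_of_branches (F := fun n z => etaN n z.1 z.2) hx
    (fun _ _ _ hx hn => eta_eq_etaN hx hn)
    fun n hn => (contDiffAt_etaN n hx (ne_zero_or_of_abs_pos_le hx hn)).continuousAt

lemma continuousAt_fderiv_comp_eta (hφ : NeumannBounds φ φ' φ'' M) (hx : ‖x‖ < 1) (v : E d) :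
    ContinuousAt (fun z : E d × E d => fderiv ℝ (fun w => φ (eta z.1 w)) z.2) (x, v) := by
  have h : ContinuousAt (fun z : E d × E d => φ' (eta z.1 z.2)) (x, v) := by
    have h1 : ContinuousWithinAt φ' (Metric.closedBall 0 1) (eta x v) :=
      (hφ.hasDeriv₂ _ (eta_mem_closedBall hx v)).continuousWithinAt
    have hx' : ∀ᶠ z : E d × E d in 𝓝 (x, v), ‖z.1‖ < 1 :=
      (continuous_fst.norm.tendsto (x, v)).eventually_lt_const hx
    exact Tendsto.comp h1 (tendsto_nhdsWithin_iff.2 ⟨continuousAt_eta hx v,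
      hx'.mono fun z hz => eta_mem_closedBall hz z.2⟩)
  refine continuousAt_of_branches
    (F := fun n z => (φ' (eta z.1 z.2)).comp (fderiv ℝ (etaN n z.1) z.2)) hx
    (fun n x v hx hn => ?_) fun n hn =>
      h.clm_comp (continuousAt_fderiv_etaN n hx (ne_zero_or_of_abs_pos_le hx hn))
  simp only
  rw [fderiv_comp_eta hφ hx hn, gradN, eta_eq_etaN hx hn]

end

/-! ### Test functions satisfy the Neumann bounds -/

lemma uniqueDiffOn_closedBall_one (d : ℕ) :
    UniqueDiffOn ℝ (Metric.closedBall (0 : E d) 1) :=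
  uniqueDiffOn_convex (convex_closedBall 0 1)
    ⟨0, Metric.ball_subset_interior_closedBall (Metric.mem_ball_self one_pos)⟩

lemma exists_neumannBounds {d : ℕ} {φ : E d → ℝ}
    (h : ContDiffOn ℝ ∞ φ (Metric.closedBall 0 1))
    (hN : ∀ x ∈ Metric.sphere (0 : E d) 1, fderivWithin ℝ φ (Metric.closedBall 0 1) x x = 0) :
    ∃ (φ' : E d → E d →L[ℝ] ℝ) (φ'' : E d → E d →L[ℝ] E d →L[ℝ] ℝ) (M : ℝ),
      NeumannBounds φ φ' φ'' M := by
  set B := Metric.closedBall (0 : E d) 1 with hB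
  have hu : UniqueDiffOn ℝ B := uniqueDiffOn_closedBall_one d
  have hcomp : IsCompact B := isCompact_closedBall 0 1
  set φ' := fderivWithin ℝ φ B with hφ'
  set φ'' := fderivWithin ℝ φ' B with hφ''
  have h1 : ContDiffOn ℝ ∞ φ' B := h.fderivWithin hu (by simp)
  have h2 : ContDiffOn ℝ ∞ φ'' B := h1.fderivWithin hu (by simp)
  obtain ⟨M₁, hM₁⟩ := hcomp.exists_bound_of_continuousOn h1.continuousOn
  obtain ⟨M₂, hM₂⟩ := hcomp.exists_bound_of_continuousOn (f := φ'') h2.continuousOn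
  have hd1 : ∀ y ∈ B, HasFDerivWithinAt φ (φ' y) B y := fun y hy =>
    (h.differentiableOn (by simp) y hy).hasFDerivWithinAt
  have hd2 : ∀ y ∈ B, HasFDerivWithinAt φ' (φ'' y) B y := fun y hy =>
    (h1.differentiableOn (by simp) y hy).hasFDerivWithinAt
  have h0 : (0 : E d) ∈ B := Metric.mem_closedBall_self zero_le_one
  have hM1 : 0 ≤ M₁ := (norm_nonneg _).trans (hM₁ 0 h0)
  have hM2 : 0 ≤ M₂ := (norm_nonneg _).trans (hM₂ 0 h0)
  refine ⟨φ', φ'', M₁ + M₂, hd1, hd2, fun y hy => (hM₁ y hy).trans (by linarith),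
    fun y hy => (hM₂ y hy).trans (by linarith), fun y hy => ?_⟩
  have hy1 : ‖y‖ ≤ 1 := mem_closedBall_zero_iff.1 hy
  rcases eq_or_ne y 0 with rfl | hy0
  · simp only [map_zero, abs_zero, norm_zero]
    linarith
  have hyn : 0 < ‖y‖ := norm_pos_iff.2 hy0
  have hs : ‖‖y‖⁻¹ • y‖ = 1 := norm_smul_inv_norm (𝕜 := ℝ) hy0
  have hsB : ‖y‖⁻¹ • y ∈ B := mem_closedBall_zero_iff.2 hs.le
  -- `z ↦ φ'(z) z` is Lipschitz on the ball with constant `M₁ + M₂` and vanishes on the sphere; it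
  -- is compared at `y` and at the radial projection of `y`, at distance `1 - ‖y‖ ≤ 1 - ‖y‖²`.
  have key := (convex_closedBall (0 : E d) 1).norm_image_sub_le_of_norm_hasFDerivWithin_le
    (f := fun z => φ' z z) (C := M₁ + M₂)
    (fun z hz => (hd2 z hz).clm_apply (hasFDerivWithinAt_id z B)) (fun z hz => ?_) hsB hy
  · rw [hN _ (mem_sphere_zero_iff_norm.2 hs), sub_zero, Real.norm_eq_abs] at key
    refine key.trans ?_
    have e : y - ‖y‖⁻¹ • y = (1 - ‖y‖⁻¹) • y := by module
    have e2 : ‖y - ‖y‖⁻¹ • y‖ = 1 - ‖y‖ := by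
      rw [e, norm_smul, Real.norm_eq_abs, abs_of_nonpos]
      · field_simp
        ring
      · linarith [(one_le_inv₀ hyn).2 hy1]
    rw [e2]
    gcongr
    nlinarith
  · have hz1 : ‖z‖ ≤ 1 := mem_closedBall_zero_iff.1 hz
    refine ContinuousLinearMap.opNorm_le_bound _ (by linarith) fun a => ?_
    simp only [_root_.add_apply, ContinuousLinearMap.comp_apply,
      ContinuousLinearMap.flip_apply, ContinuousLinearMap.id_apply]
    rw [add_mul]
    refine norm_add_le_of_le ((φ' z).le_of_opNorm_le (hM₁ z hz) a) ?_
    refine ((φ'' z).le_opNorm₂ a z).trans ?_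
    calc ‖φ'' z‖ * ‖a‖ * ‖z‖ ≤ M₂ * ‖a‖ * 1 := by gcongr; exact hM₂ z hz
      _ = M₂ * ‖a‖ := mul_one _

lemma IsTestFunction.exists_neumannBounds {d : ℕ} {T : ℝ} {ψ : ℝ → E d → ℝ}
    (h : IsTestFunction T ψ) {t : ℝ} (ht : t ∈ Ico 0 T) :
    ∃ (φ' : E d → E d →L[ℝ] ℝ) (φ'' : E d → E d →L[ℝ] E d →L[ℝ] ℝ) (M : ℝ),
      NeumannBounds (ψ t) φ' φ'' M :=
  SpecularBall.exists_neumannBounds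
    (h.smooth.comp (f := fun y : E d => (t, y)) (contDiff_const.prodMk contDiff_id).contDiffOn
      fun _ hy => ⟨ht, hy⟩) (h.neumann t ht)

/-! ### Lipschitz functions have regular derivatives -/

section

variable {d : ℕ} {V : Type*} [NormedAddCommGroup V] [NormedSpace ℝ V] [FiniteDimensional ℝ V]
  {g : E d → V} {K : NNReal}

/-- Rademacher's theorem, with the integration by parts for scalar Lipschitz functions applied to `ℓ
∘ g` for every continuous linear functional `ℓ`. -/
lemma hasRegularDeriv_of_lipschitz (hg : LipschitzWith K g) : HasRegularDeriv g := by
  have hae := hg.ae_differentiableAt (μ := (volume : Measure (E d)))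
  have hmeas : AEStronglyMeasurable (fderiv ℝ g) (volume : Measure (E d)) := by
    borelize V
    exact (measurable_fderiv ℝ g).aestronglyMeasurable
  have hloc : LocallyIntegrable (fderiv ℝ g) (volume : Measure (E d)) :=
    (locallyIntegrable_const (K : ℝ)).mono hmeas (.of_forall fun v => by
      rw [Real.norm_of_nonneg K.coe_nonneg]
      exact norm_fderiv_le_of_lipschitz ℝ hg)
  refine ⟨hae, hg.continuous.locallyIntegrable, hloc, fun φ hφ hφc a => ?_⟩
  have hφ1 : ContDiff ℝ 1 φ := hφ.of_le (by simp)
  obtain ⟨D, hD⟩ := hφ1.lipschitzWith_of_hasCompactSupport hφc (by simp)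
  have hcd : Continuous fun v => fderiv ℝ φ v a :=
    (hφ1.continuous_fderiv (by simp)).clm_apply continuous_const
  have hcs : HasCompactSupport fun v => fderiv ℝ φ v a :=
    (hφc.fderiv ℝ).comp_left (g := fun L : E d →L[ℝ] ℝ => L a) rfl
  have hi1 : Integrable (fun v => fderiv ℝ φ v a • g v) (volume : Measure (E d)) :=
    (hcd.smul hg.continuous).integrable_of_hasCompactSupport (hcs.smul_right)
  have hloc' : LocallyIntegrable (fun v => fderiv ℝ g v a) (volume : Measure (E d)) := by
    refine (locallyIntegrable_const ((K : ℝ) * ‖a‖)).mono ?_ (.of_forall fun v => ?_)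
    · exact (ContinuousLinearMap.apply ℝ V a).continuous.comp_aestronglyMeasurable hmeas
    · rw [Real.norm_of_nonneg (by positivity)]
      exact (fderiv ℝ g v).le_of_opNorm_le (norm_fderiv_le_of_lipschitz ℝ hg) a
  have hi2 : Integrable (fun v => φ v • fderiv ℝ g v a) (volume : Measure (E d)) :=
    hloc'.integrable_smul_left_of_hasCompactSupport hφ1.continuous hφc
  refine (SeparatingDual.eq_iff_forall_dual_eq (R := ℝ)).2 fun ℓ => ?_
  rw [map_neg, ← ℓ.integral_comp_comm hi1, ← ℓ.integral_comp_comm hi2]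
  have hℓ : LipschitzWith (‖ℓ‖₊ * K) fun v => ℓ (g v) := ℓ.lipschitz.comp hg
  have key := hℓ.integral_lineDeriv_mul_eq (μ := (volume : Measure (E d))) hD hφc a
  have e1 : ∫ v, ℓ (φ v • fderiv ℝ g v a) = ∫ v, lineDeriv ℝ (fun v => ℓ (g v)) v a * φ v := by
    refine integral_congr_ae ?_
    filter_upwards [hae] with v hv
    have h1 : HasFDerivAt (fun v => ℓ (g v)) (ℓ.comp (fderiv ℝ g v)) v :=
      ℓ.hasFDerivAt.comp v hv.hasFDerivAt
    rw [(h1.hasLineDerivAt a).lineDeriv, map_smul, smul_eq_mul, mul_comm]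
    rfl
  have e2 : ∀ v, lineDeriv ℝ φ v (-a) = -fderiv ℝ φ v a := fun v => by
    rw [(hφ1.differentiable (by simp) v).lineDeriv_eq_fderiv, map_neg]
  rw [e1, key, ← integral_neg]
  refine integral_congr_ae (.of_forall fun v => ?_)
  simp only [e2, map_smul, smul_eq_mul, neg_mul, neg_neg]

end

/-! ### The optimal Lipschitz constant -/

section

variable {d : ℕ} {V : Type*} [NormedAddCommGroup V] [NormedSpace ℝ V] [FiniteDimensional ℝ V]
  {g : E d → V} {K : NNReal}

/-- By Fubini almost every line in direction `w - v` meets the points of non-differentiability in a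
null set, and there the fundamental theorem of calculus applies. Other lines follow by continuity, a
set of full measure being dense. -/
lemma norm_sub_le_of_norm_fderiv_le (hg : LipschitzWith K g) {M : ℝ}
    (hM : ∀ v, ‖fderiv ℝ g v‖ ≤ M) (v w : E d) : ‖g w - g v‖ ≤ M * ‖w - v‖ := by
  have hM0 : 0 ≤ M := (norm_nonneg _).trans (hM 0)
  set a := w - v with ha
  have h1 : ∀ᵐ u : E d, ∀ᵐ t : ℝ, DifferentiableAt ℝ g (u + t • a) := by
    rw [Measure.ae_ae_comm (p := fun (u : E d) (t : ℝ) => DifferentiableAt ℝ g (u + t • a))]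
    · refine .of_forall fun t => ?_
      exact (measurePreserving_add_right volume (t • a)).quasiMeasurePreserving.ae
        hg.ae_differentiableAt
    · exact (measurableSet_of_differentiableAt ℝ g).preimage (by fun_prop :
        Measurable fun z : E d × ℝ => z.1 + z.2 • a)
  have h2 : ∀ᵐ u : E d, ‖g (u + a) - g u‖ ≤ M * ‖a‖ := by
    filter_upwards [h1] with u hu
    refine NormedSpace.norm_le_dual_bound ℝ _ (by positivity) fun ℓ => ?_
    set f : ℝ → ℝ := fun t => ℓ (g (u + t • a)) with hf
    have hline : LipschitzWith ‖a‖₊ fun t : ℝ => u + t • a := by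
      refine LipschitzWith.of_dist_le_mul fun s t => ?_
      rw [dist_add_left, dist_eq_norm, ← sub_smul, norm_smul, mul_comm, dist_eq_norm]
      rfl
    have hfl : LipschitzWith (‖ℓ‖₊ * (K * ‖a‖₊)) f := ℓ.lipschitz.comp (hg.comp hline)
    have hac : AbsolutelyContinuousOnInterval f 0 1 :=
      hfl.lipschitzOnWith.absolutelyContinuousOnInterval
    have hint := hac.integral_deriv_eq_sub
    have hb : ∀ᵐ t : ℝ, t ∈ Set.uIoc (0 : ℝ) 1 → ‖deriv f t‖ ≤ M * ‖a‖ * ‖ℓ‖ := by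
      filter_upwards [hu] with t ht _
      have hγ : HasDerivAt (fun t : ℝ => u + t • a) a t := by
        simpa using ((hasDerivAt_id t).smul_const a).const_add u
      have hd : HasDerivAt f (ℓ (fderiv ℝ g (u + t • a) a)) t :=
        ℓ.hasFDerivAt.comp_hasDerivAt t (ht.hasFDerivAt.comp_hasDerivAt t hγ)
      rw [hd.deriv]
      calc ‖ℓ (fderiv ℝ g (u + t • a) a)‖ ≤ ‖ℓ‖ * ‖fderiv ℝ g (u + t • a) a‖ := ℓ.le_opNorm _
        _ ≤ ‖ℓ‖ * (M * ‖a‖) := by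
          gcongr
          exact (fderiv ℝ g (u + t • a)).le_of_opNorm_le (hM _) a
        _ = M * ‖a‖ * ‖ℓ‖ := by ring
    have := intervalIntegral.norm_integral_le_of_norm_le_const_ae hb
    rw [hint] at this
    simpa [hf] using this
  have hcl : IsClosed {u : E d | ‖g (u + a) - g u‖ ≤ M * ‖a‖} := by
    have := hg.continuous
    exact isClosed_le (by fun_prop) continuous_const
  have hall : {u : E d | ‖g (u + a) - g u‖ ≤ M * ‖a‖} = univ := by
    rw [← hcl.closure_eq]
    exact (Measure.dense_of_ae h2).closure_eq
  have := hall.ge (mem_univ v)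
  rw [mem_ofPred_eq, ha, add_sub_cancel] at this
  exact this

/-- The supremum of the derivative of a Lipschitz function is a countable supremum of difference
quotients. -/
lemma iSup_enorm_fderiv_eq (hg : LipschitzWith K g) : ⨆ v, ‖fderiv ℝ g v‖ₑ =
    ⨆ n : ℕ, ⨆ m : ℕ, edist (g (TopologicalSpace.denseSeq (E d) n))
      (g (TopologicalSpace.denseSeq (E d) m)) /
      edist (TopologicalSpace.denseSeq (E d) n) (TopologicalSpace.denseSeq (E d) m) := by
  set s := TopologicalSpace.denseSeq (E d) with hs
  apply le_antisymm
  -- If finite, the countable supremum is a Lipschitz constant on a dense set, hence everywhere, and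
  -- therefore bounds the derivative.
  · set Λ := ⨆ n : ℕ, ⨆ m : ℕ, edist (g (s n)) (g (s m)) / edist (s n) (s m) with hΛ
    refine iSup_le fun v => ?_
    rcases eq_or_ne Λ ⊤ with h | h
    · rw [h]; exact le_top
    have h1 : ∀ n m, edist (g (s n)) (g (s m)) ≤ Λ * edist (s n) (s m) := fun n m => by
      rcases eq_or_ne (s n) (s m) with e | e
      · rw [e, edist_self]; exact zero_le
      · rw [← ENNReal.div_le_iff (edist_pos.2 e).ne' (edist_ne_top _ _)]
        exact le_iSup₂ (f := fun n m => edist (g (s n)) (g (s m)) / edist (s n) (s m)) n m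
    have h2 : LipschitzWith Λ.toNNReal g := fun v w => by
      rw [ENNReal.coe_toNNReal h]
      refine (TopologicalSpace.denseRange_denseSeq (E d)).induction_on₂
        (p := fun v w => edist (g v) (g w) ≤ Λ * edist v w) ?_ h1 v w
      refine isClosed_le ?_ ?_
      · exact (hg.continuous.comp continuous_fst).edist (hg.continuous.comp continuous_snd)
      · exact (ENNReal.continuous_const_mul h).comp (continuous_fst.edist continuous_snd)
    have h3 : ‖fderiv ℝ g v‖₊ ≤ Λ.toNNReal := norm_fderiv_le_of_lipschitz ℝ h2
    rw [enorm_eq_nnnorm, ← ENNReal.coe_toNNReal h]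
    exact_mod_cast h3
  · set M := ⨆ v, ‖fderiv ℝ g v‖ₑ with hM
    have hMK : M ≤ K := iSup_le fun v => by
      rw [enorm_eq_nnnorm]
      exact_mod_cast (norm_fderiv_le_of_lipschitz ℝ hg : ‖fderiv ℝ g v‖ ≤ K)
    have hMt : M ≠ ⊤ := (hMK.trans_lt ENNReal.coe_lt_top).ne
    have hb : ∀ v, ‖fderiv ℝ g v‖ ≤ M.toReal := fun v => by
      rw [← toReal_enorm]
      exact ENNReal.toReal_mono hMt (le_iSup (fun v => ‖fderiv ℝ g v‖ₑ) v)
    refine iSup₂_le fun n m => ENNReal.div_le_of_le_mul ?_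
    have := norm_sub_le_of_norm_fderiv_le hg hb (s m) (s n)
    rw [edist_dist, edist_dist, dist_eq_norm, dist_eq_norm, ← ENNReal.ofReal_toReal hMt,
      ← ENNReal.ofReal_mul ENNReal.toReal_nonneg]
    exact ENNReal.ofReal_le_ofReal this

end

/-! ### Measurability -/

section

variable {d : ℕ} {W : Type*} [NormedAddCommGroup W] [NormedSpace ℝ W] [FiniteDimensional ℝ W]
  {g : E d → E d → W}

lemma aestronglyMeasurable_fderiv_of_continuousAt
    (hg : ∀ x ∈ Metric.ball (0 : E d) 1, ∀ v, ContinuousAt (fun z : E d × E d => g z.1 z.2) (x, v))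
    (ν : Measure (E d)) [SFinite ν] :
    AEStronglyMeasurable (fun z : E d × E d => fderiv ℝ (g z.1) z.2)
      ((volume.restrict (Metric.ball 0 1)).prod ν) := by
  borelize W
  have hm : MeasurableSet (Metric.ball (0 : E d) 1 ×ˢ (univ : Set (E d))) :=
    measurableSet_ball.prod .univ
  have e : (volume.restrict (Metric.ball (0 : E d) 1)).prod ν =
      (volume.prod ν).restrict (Metric.ball (0 : E d) 1 ×ˢ univ) := by
    rw [← Measure.prod_restrict, Measure.restrict_univ]
  rw [e]
  refine AEMeasurable.aestronglyMeasurable ?_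
  refine aemeasurable_restrict_of_measurable_subtype hm ?_
  have hc : Continuous (Function.uncurry fun (x : Metric.ball (0 : E d) 1) (v : E d) => g x v) :=
    continuous_iff_continuousAt.2 fun z => ContinuousAt.comp (f := fun z :
      Metric.ball (0 : E d) 1 × E d => ((z.1 : E d), z.2)) (hg z.1 z.1.2 z.2) (by fun_prop)
  have h := measurable_fderiv_with_param ℝ hc
  exact h.comp (f := fun z : ↥(Metric.ball (0 : E d) 1 ×ˢ (univ : Set (E d))) =>
    ((⟨z.1.1, z.2.1⟩ : Metric.ball (0 : E d) 1), z.1.2)) (by fun_prop)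

/-- The supremum over the uncountable set of all `v` becomes countable by `iSup_enorm_fderiv_eq`. -/
lemma aemeasurable_iSup_enorm_fderiv
    (hg : ∀ x ∈ Metric.ball (0 : E d) 1, ∀ v, ContinuousAt (fun z : E d × E d => g z.1 z.2) (x, v))
    (hL : ∀ x ∈ Metric.ball (0 : E d) 1, ∃ K, LipschitzWith K (g x)) :
    AEMeasurable (fun x => ⨆ v, ‖fderiv ℝ (g x) v‖ₑ)
      ((volume : Measure (E d)).restrict (Metric.ball 0 1)) := by
  have hc : ∀ v, ContinuousOn (fun x => g x v) (Metric.ball (0 : E d) 1) := fun v x hx =>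
    (ContinuousAt.comp (f := fun x : E d => (x, v)) (hg x hx v)
      (by fun_prop)).continuousWithinAt
  have h : AEMeasurable (fun x => ⨆ n : ℕ, ⨆ m : ℕ,
      edist (g x (TopologicalSpace.denseSeq (E d) n)) (g x (TopologicalSpace.denseSeq (E d) m)) /
      edist (TopologicalSpace.denseSeq (E d) n) (TopologicalSpace.denseSeq (E d) m))
      ((volume : Measure (E d)).restrict (Metric.ball 0 1)) := by
    refine AEMeasurable.iSup fun n => AEMeasurable.iSup fun m => AEMeasurable.div_const ?_ _
    have : ContinuousOn (fun x => edist (g x (TopologicalSpace.denseSeq (E d) n))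
        (g x (TopologicalSpace.denseSeq (E d) m))) (Metric.ball (0 : E d) 1) := fun x hx =>
      Tendsto.edist (hc _ x hx) (hc _ x hx)
    exact this.aemeasurable measurableSet_ball
  refine h.congr ?_
  filter_upwards [ae_restrict_mem measurableSet_ball] with x hx
  obtain ⟨K, hK⟩ := hL x hx
  exact (iSup_enorm_fderiv_eq hK).symm

end

/-! ### Integrability from weak type bounds -/

section

variable {α : Type*} [MeasurableSpace α] {μ : Measure α}

/-- Layer cake formula: levels below `1` are controlled by the finite total mass, levels above by
the integrability of `t ^ (p - r - 1)` at infinity. -/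
lemma lintegral_rpow_lt_top_of_meas_le [IsFiniteMeasure μ] {f : α → ℝ} (f_nn : 0 ≤ᵐ[μ] f)
    (hf : AEMeasurable f μ) {C : ℝ≥0∞} (hC : C ≠ ⊤) {p r : ℝ} (hp : 0 < p) (hpr : p < r)
    (h : ∀ t : ℝ, 1 ≤ t → μ {a | t ≤ f a} ≤ C * ENNReal.ofReal (t ^ (-r))) :
    ∫⁻ a, ENNReal.ofReal (f a ^ p) ∂μ < ⊤ := by
  rw [lintegral_rpow_eq_lintegral_meas_le_mul μ f_nn hf hp]
  refine ENNReal.mul_lt_top ENNReal.ofReal_lt_top ?_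
  have hU : Ioi (0 : ℝ) = Ioc 0 1 ∪ Ioi 1 := (Ioc_union_Ioi_eq_Ioi zero_le_one).symm
  rw [hU]
  refine (lintegral_union_le _ _ _).trans_lt (ENNReal.add_lt_top.2 ⟨?_, ?_⟩)
  · calc ∫⁻ t in Ioc 0 1, μ {a | t ≤ f a} * ENNReal.ofReal (t ^ (p - 1))
        ≤ ∫⁻ t in Ioc (0 : ℝ) 1, μ univ * ENNReal.ofReal (t ^ (p - 1)) :=
          lintegral_mono fun t => by gcongr; exact subset_univ _
      _ = μ univ * ∫⁻ t in Ioc (0 : ℝ) 1, ENNReal.ofReal (t ^ (p - 1)) :=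
          lintegral_const_mul' _ _ (measure_ne_top _ _)
      _ < ⊤ := by
          refine ENNReal.mul_lt_top (measure_lt_top _ _) ?_
          have h1 : IntervalIntegrable (fun t : ℝ => t ^ (p - 1)) volume 0 1 :=
            intervalIntegral.intervalIntegrable_rpow' (by linarith)
          exact ((intervalIntegrable_iff_integrableOn_Ioc_of_le zero_le_one).1 h1).lintegral_lt_top
  · calc ∫⁻ t in Ioi 1, μ {a | t ≤ f a} * ENNReal.ofReal (t ^ (p - 1))
        ≤ ∫⁻ t in Ioi (1 : ℝ), C * ENNReal.ofReal (t ^ (p - r - 1)) := by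
          refine setLIntegral_mono' measurableSet_Ioi fun t ht => ?_
          have ht : (1 : ℝ) < t := ht
          refine (mul_le_mul_left (h t ht.le) _).trans (le_of_eq ?_)
          rw [mul_assoc, ← ENNReal.ofReal_mul (by positivity),
            ← Real.rpow_add (by linarith)]
          congr 3
          ring
      _ = C * ∫⁻ t in Ioi (1 : ℝ), ENNReal.ofReal (t ^ (p - r - 1)) :=
          lintegral_const_mul' _ _ hC
      _ < ⊤ := by
          refine ENNReal.mul_lt_top hC.lt_top ?_
          exact (integrableOn_Ioi_rpow_of_lt (by linarith : p - r - 1 < -1)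
            zero_lt_one).lintegral_lt_top

lemma memLp_of_meas_le [IsFiniteMeasure μ] {ε : Type*} [TopologicalSpace ε] [ContinuousENorm ε]
    {g : α → ε} (hg : AEStronglyMeasurable g μ) {f : α → ℝ} (f_nn : 0 ≤ᵐ[μ] f)
    (hf : AEMeasurable f μ) {K : ℝ} (hK : 0 ≤ K)
    (hgf : ∀ᵐ a ∂μ, ‖g a‖ₑ ≤ ENNReal.ofReal (K * f a)) {C : ℝ≥0∞} (hC : C ≠ ⊤)
    {p : ℝ≥0∞} {r : ℝ} (hpr : p < ENNReal.ofReal r)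
    (h : ∀ t : ℝ, 1 ≤ t → μ {a | t ≤ f a} ≤ C * ENNReal.ofReal (t ^ (-r))) :
    MemLp g p μ := by
  rcases eq_or_ne p 0 with rfl | hp
  · exact memLp_zero_iff_aestronglyMeasurable.2 hg
  have hpt : p ≠ ⊤ := (hpr.trans_le le_top).ne
  have hp0 : 0 < p.toReal := ENNReal.toReal_pos hp hpt
  refine ⟨hg, (eLpNorm_lt_top_iff_lintegral_rpow_enorm_lt_top hp hpt).2 ?_⟩
  calc ∫⁻ a, ‖g a‖ₑ ^ p.toReal ∂μ
      ≤ ∫⁻ a, ENNReal.ofReal (K ^ p.toReal) * ENNReal.ofReal (f a ^ p.toReal) ∂μ := by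
        refine lintegral_mono_ae ?_
        filter_upwards [hgf, f_nn] with a ha h0
        have h0 : 0 ≤ f a := h0
        rw [← ENNReal.ofReal_mul (by positivity), ← Real.mul_rpow hK h0,
          ← ENNReal.ofReal_rpow_of_nonneg (by positivity) hp0.le]
        gcongr
    _ = ENNReal.ofReal (K ^ p.toReal) * ∫⁻ a, ENNReal.ofReal (f a ^ p.toReal) ∂μ :=
        lintegral_const_mul' _ _ ENNReal.ofReal_ne_top
    _ < ⊤ := ENNReal.mul_lt_top ENNReal.ofReal_lt_top
        (lintegral_rpow_lt_top_of_meas_le f_nn hf hC hp0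
          ((ENNReal.lt_ofReal_iff_toReal_lt hpt).1 hpr) h)

end

/-! ### Volume of the points close to a tangential boundary hit -/

section

open scoped Pointwise

variable {d : ℕ}

/-- Scaling gives the volume `(1 - r ^ d) |A|`, and Bernoulli's inequality gives `1 - r ^ d ≤ d (1 -
r)`. -/
lemma measure_diff_smul_le {A : Set (E d)} (hA : volume A ≠ ⊤) (hm : MeasurableSet A) {r : ℝ}
    (hr0 : 0 < r) (hr1 : r ≤ 1) (hrA : r • A ⊆ A) :
    volume (A \ r • A) ≤ ENNReal.ofReal (d * (1 - r)) * volume A := by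
  have hrm : MeasurableSet (r • A) := hm.const_smul₀ r
  have hfin : volume (r • A) ≠ ⊤ := ((measure_mono hrA).trans_lt hA.lt_top).ne
  rw [measure_sdiff hrA hrm.nullMeasurableSet hfin, Measure.addHaar_smul, finrank_euclideanSpace,
    Fintype.card_fin, abs_of_nonneg (by positivity)]
  refine tsub_le_iff_right.2 ?_
  rw [← add_mul, ← ENNReal.ofReal_add (mul_nonneg (by positivity) (by linarith)) (by positivity)]
  have h1 : 1 + (d : ℝ) * (r - 1) ≤ r ^ d := by
    have := one_add_mul_le_pow (a := r - 1) (by linarith) d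
    rwa [add_sub_cancel] at this
  have h2 : (1 : ℝ≥0∞) ≤ ENNReal.ofReal (d * (1 - r) + r ^ d) := by
    rw [← ENNReal.ofReal_one]
    exact ENNReal.ofReal_le_ofReal (by linarith)
  calc volume A = 1 * volume A := (one_mul _).symm
    _ ≤ _ := by gcongr

/-- In an orthonormal basis starting with `p` the slab lies in a box with one side `2a` and the
others `2`. -/
lemma volume_slab_le [NeZero d] {p : E d} (hp : ‖p‖ = 1) {a : ℝ} (ha : 0 ≤ a) :
    volume {x : E d | ‖x‖ < 1 ∧ |inner ℝ x p| ≤ a} ≤ ENNReal.ofReal (2 ^ d * a) := by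
  have hon : Orthonormal ℝ (({0} : Set (Fin d)).domRestrict fun _ => p) := by
    refine ⟨fun i => hp, fun i j hij => absurd ?_ hij⟩
    exact Subsingleton.elim i j
  obtain ⟨b, hb⟩ := hon.exists_orthonormalBasis_extension_of_card_eq (by simp)
  have hb0 : b 0 = p := hb 0 rfl
  set c : Fin d → ℝ := fun i => if i = 0 then a else 1 with hc
  have hsub : {x : E d | ‖x‖ < 1 ∧ |inner ℝ x p| ≤ a} ⊆
      (fun x => (WithLp.ofLp (b.repr x) : Fin d → ℝ)) ⁻¹' Icc (-c) c := by
    rintro x ⟨hx, hxa⟩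
    have key : ∀ i, |b.repr x i| ≤ c i := fun i => by
      rw [b.repr_apply_apply]
      by_cases hi : i = 0
      · rw [hi, hb0, real_inner_comm]; simpa [hc] using hxa
      · simp only [hc, hi, if_false]
        refine (abs_real_inner_le_norm _ _).trans ?_
        rw [b.orthonormal.1 i, one_mul]
        exact hx.le
    exact ⟨fun i => (abs_le.1 (key i)).1, fun i => (abs_le.1 (key i)).2⟩
  have hmp : MeasurePreserving (fun x => (WithLp.ofLp (b.repr x) : Fin d → ℝ)) :=
    (PiLp.volume_preserving_ofLp (Fin d)).comp b.measurePreserving_repr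
  refine (measure_mono hsub).trans ?_
  rw [hmp.measure_preimage measurableSet_Icc.nullMeasurableSet, Real.volume_Icc_pi,
    ← ENNReal.ofReal_prod_of_nonneg fun i _ => ?_]
  · refine ENNReal.ofReal_le_ofReal (le_of_eq ?_)
    calc ∏ i, (c i - (-c) i) = ∏ i, 2 * c i :=
          Finset.prod_congr rfl fun i _ => by simp [two_mul]
      _ = 2 ^ d * a := by
          rw [Finset.prod_mul_distrib]
          simp [hc, Finset.prod_ite_eq']
  · have : 0 ≤ c i := by simp only [hc]; split_ifs <;> simp [ha]
    simpa using by linarith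

lemma volume_ball_lt_top : volume (Metric.ball (0 : E d) 1) < ⊤ := measure_ball_lt_top

lemma volume_half_le [NeZero d] {v : E d} (hv : v ≠ 0) {δ : ℝ} (hδ : 0 < δ) :
    volume {x ∈ Metric.ball (0 : E d) 1 | half x v ≤ δ} ≤
      (8 * volume (Metric.ball (0 : E d) 1) + ENNReal.ofReal (d * 2 ^ d * 2)) *
        ENNReal.ofReal (δ ^ 3) := by
  -- For `δ ≥ 1/2` the volume of the whole ball suffices, as `8 δ³ ≥ 1`.
  rcases le_or_gt (1 / 2) δ with h | h
  · calc volume {x ∈ Metric.ball (0 : E d) 1 | half x v ≤ δ}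
        ≤ 1 * volume (Metric.ball (0 : E d) 1) := by
          rw [one_mul]; exact measure_mono (sep_subset _ _)
      _ ≤ (8 * ENNReal.ofReal (δ ^ 3)) * volume (Metric.ball (0 : E d) 1) := by
          gcongr
          rw [← ENNReal.ofReal_ofNat, ← ENNReal.ofReal_mul (by norm_num), ← ENNReal.ofReal_one]
          refine ENNReal.ofReal_le_ofReal ?_
          have : (1 / 2 : ℝ) ^ 3 ≤ δ ^ 3 := by gcongr
          linarith
      _ = 8 * volume (Metric.ball (0 : E d) 1) * ENNReal.ofReal (δ ^ 3) := by ring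
      _ ≤ _ := by gcongr; exact le_self_add
  set p := dir v
  have hp : ‖p‖ = 1 := norm_dir hv
  -- The slab is replaced by a truncated cone, which shrinks into itself, so that its part in the
  -- shell is `A \ (1 - δ²) • A`. The factor `2` makes up for `‖x‖ ≥ 1/2`.
  set A : Set (E d) := {x | ‖x‖ < 1 ∧ |inner ℝ x p| ≤ 2 * δ * ‖x‖}
  have hm : MeasurableSet A := by
    have h1 : Measurable fun x : E d => |inner ℝ x p| := by fun_prop
    have h2 : Measurable fun x : E d => 2 * δ * ‖x‖ := by fun_prop
    exact (measurableSet_lt measurable_norm measurable_const).inter (measurableSet_le h1 h2)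
  have hAs : A ⊆ {x : E d | ‖x‖ < 1 ∧ |inner ℝ x p| ≤ 2 * δ} := fun x hx =>
    ⟨hx.1, hx.2.trans (mul_le_of_le_one_right (by positivity) hx.1.le)⟩
  have hA : volume A ≤ ENNReal.ofReal (2 ^ d * (2 * δ)) :=
    (measure_mono hAs).trans (volume_slab_le hp (by positivity))
  have hr0 : 0 < 1 - δ ^ 2 := by nlinarith
  have hr1 : 1 - δ ^ 2 ≤ 1 := by nlinarith
  have hrA : (1 - δ ^ 2) • A ⊆ A := by
    rintro _ ⟨x, hx, rfl⟩
    have hn : ‖(1 - δ ^ 2) • x‖ = (1 - δ ^ 2) * ‖x‖ := norm_smul_of_nonneg hr0.le x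
    refine ⟨?_, ?_⟩
    · change ‖(1 - δ ^ 2) • x‖ < 1
      rw [hn]
      exact (mul_le_of_le_one_left (norm_nonneg x) hr1).trans_lt hx.1
    · change |inner ℝ ((1 - δ ^ 2) • x) p| ≤ 2 * δ * ‖(1 - δ ^ 2) • x‖
      rw [hn, real_inner_smul_left, abs_mul, abs_of_pos hr0]
      calc (1 - δ ^ 2) * |inner ℝ x p| ≤ (1 - δ ^ 2) * (2 * δ * ‖x‖) := by gcongr; exact hx.2
        _ = _ := by ring
  have hsub : {x ∈ Metric.ball (0 : E d) 1 | half x v ≤ δ} ⊆ A \ (1 - δ ^ 2) • A := by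
    rintro x ⟨hx, hxδ⟩
    have hx1 : ‖x‖ < 1 := by simpa using hx
    have hsq := half_sq hx1 v
    have hle : half x v ^ 2 ≤ δ ^ 2 := by gcongr; exact (half_pos hx1 v).le
    have hn0 := norm_nonneg x
    have hal : along x v ^ 2 ≤ δ ^ 2 := by nlinarith
    have hn : 1 - δ ^ 2 ≤ ‖x‖ ^ 2 := by nlinarith [sq_nonneg (along x v)]
    have hn2 : 1 / 2 ≤ ‖x‖ := by nlinarith
    refine ⟨⟨hx1, ?_⟩, ?_⟩
    · calc |inner ℝ x p| ≤ δ := abs_le_of_sq_le_sq hal hδ.le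
        _ ≤ 2 * δ * ‖x‖ := by nlinarith
    · rintro ⟨y, hy, rfl⟩
      have hy1 : ‖y‖ < 1 := hy.1
      have hny : ‖(1 - δ ^ 2) • y‖ = (1 - δ ^ 2) * ‖y‖ := norm_smul_of_nonneg hr0.le y
      have hn' : 1 - δ ^ 2 ≤ ‖(1 - δ ^ 2) • y‖ ^ 2 := hn
      rw [hny] at hn'
      have h3 : (1 - δ ^ 2) * ‖y‖ < 1 - δ ^ 2 := mul_lt_of_lt_one_right hr0 hy1
      have h4 : 0 ≤ (1 - δ ^ 2) * ‖y‖ := by positivity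
      nlinarith
  calc volume {x ∈ Metric.ball (0 : E d) 1 | half x v ≤ δ} ≤ volume (A \ (1 - δ ^ 2) • A) :=
        measure_mono hsub
    _ ≤ ENNReal.ofReal (d * (1 - (1 - δ ^ 2))) * volume A :=
        measure_diff_smul_le (hA.trans_lt ENNReal.ofReal_lt_top).ne hm hr0 hr1 hrA
    _ ≤ ENNReal.ofReal (d * (1 - (1 - δ ^ 2))) * ENNReal.ofReal (2 ^ d * (2 * δ)) := by gcongr
    _ = ENNReal.ofReal (d * 2 ^ d * 2) * ENNReal.ofReal (δ ^ 3) := by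
        rw [← ENNReal.ofReal_mul (by rw [sub_sub_cancel]; positivity), ← ENNReal.ofReal_mul (by positivity)]
        congr 1
        ring
    _ ≤ _ := by gcongr; exact le_add_self

lemma volume_shell_le {δ : ℝ} (hδ : 0 < δ) :
    volume {x ∈ Metric.ball (0 : E d) 1 | √(1 - ‖x‖ ^ 2) ≤ δ} ≤
      (4 + ENNReal.ofReal d) * volume (Metric.ball (0 : E d) 1) * ENNReal.ofReal (δ ^ 2) := by
  set A := Metric.ball (0 : E d) 1
  rcases le_or_gt (1 / 2) δ with h | h
  · calc volume {x ∈ A | √(1 - ‖x‖ ^ 2) ≤ δ} ≤ 1 * volume A := by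
          rw [one_mul]; exact measure_mono (sep_subset _ _)
      _ ≤ (4 * ENNReal.ofReal (δ ^ 2)) * volume A := by
          gcongr
          rw [← ENNReal.ofReal_ofNat, ← ENNReal.ofReal_mul (by norm_num), ← ENNReal.ofReal_one]
          refine ENNReal.ofReal_le_ofReal ?_
          have : (1 / 2 : ℝ) ^ 2 ≤ δ ^ 2 := by gcongr
          linarith
      _ = 4 * volume A * ENNReal.ofReal (δ ^ 2) := by ring
      _ ≤ _ := by gcongr; exact le_self_add
  have hr0 : 0 < 1 - δ ^ 2 := by nlinarith
  have hr1 : 1 - δ ^ 2 ≤ 1 := by nlinarith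
  have hrA : (1 - δ ^ 2) • A = Metric.ball 0 (1 - δ ^ 2) := by
    rw [smul_unitBall_of_pos hr0]
  have hsub : {x ∈ A | √(1 - ‖x‖ ^ 2) ≤ δ} ⊆ A \ (1 - δ ^ 2) • A := by
    rintro x ⟨hx, hxδ⟩
    refine ⟨hx, ?_⟩
    rw [hrA, mem_ball_zero_iff, not_lt]
    have hx1 : ‖x‖ < 1 := mem_ball_zero_iff.1 hx
    have := (Real.sqrt_le_left hδ.le).1 hxδ
    nlinarith [norm_nonneg x]
  calc volume {x ∈ A | √(1 - ‖x‖ ^ 2) ≤ δ} ≤ volume (A \ (1 - δ ^ 2) • A) := measure_mono hsub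
    _ ≤ ENNReal.ofReal (d * (1 - (1 - δ ^ 2))) * volume A :=
        measure_diff_smul_le volume_ball_lt_top.ne measurableSet_ball hr0 hr1
          (by rw [hrA]; exact Metric.ball_subset_ball hr1)
    _ = ENNReal.ofReal d * volume A * ENNReal.ofReal (δ ^ 2) := by
        rw [sub_sub_cancel, ENNReal.ofReal_mul (by positivity)]
        ring
    _ ≤ _ := by gcongr; exact le_add_self

lemma measurable_half : Measurable fun z : E d × E d => half z.1 z.2 := by
  unfold half along dir
  fun_prop

lemma volume_restrict_half_le [NeZero d] {v : E d} (hv : v ≠ 0) {t : ℝ} (ht : 1 ≤ t) :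
    volume.restrict (Metric.ball (0 : E d) 1) {x | t ≤ (half x v)⁻¹} ≤
      (8 * volume (Metric.ball (0 : E d) 1) + ENNReal.ofReal (d * 2 ^ d * 2)) *
        ENNReal.ofReal (t ^ (-3 : ℝ)) := by
  have ht0 : 0 < t := by linarith
  rw [Measure.restrict_apply' measurableSet_ball]
  have hsub : {x : E d | t ≤ (half x v)⁻¹} ∩ Metric.ball 0 1 ⊆
      {x ∈ Metric.ball (0 : E d) 1 | half x v ≤ t⁻¹} := by
    rintro x ⟨hx, hxb⟩
    exact ⟨hxb, (le_inv_comm₀ ht0 (half_pos (mem_ball_zero_iff.1 hxb) v)).1 hx⟩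
  refine (measure_mono hsub).trans ((volume_half_le hv (inv_pos.2 ht0)).trans_eq ?_)
  rw [Real.rpow_neg ht0.le, inv_pow, show (3 : ℝ) = (3 : ℕ) by norm_num, Real.rpow_natCast]

lemma volume_restrict_shell_le {t : ℝ} (ht : 1 ≤ t) :
    volume.restrict (Metric.ball (0 : E d) 1) {x | t ≤ (√(1 - ‖x‖ ^ 2))⁻¹} ≤
      (4 + ENNReal.ofReal d) * volume (Metric.ball (0 : E d) 1) *
        ENNReal.ofReal (t ^ (-2 : ℝ)) := by
  have ht0 : 0 < t := by linarith
  rw [Measure.restrict_apply' measurableSet_ball]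
  have hsub : {x : E d | t ≤ (√(1 - ‖x‖ ^ 2))⁻¹} ∩ Metric.ball 0 1 ⊆
      {x ∈ Metric.ball (0 : E d) 1 | √(1 - ‖x‖ ^ 2) ≤ t⁻¹} := by
    rintro x ⟨hx, hxb⟩
    have hx1 : ‖x‖ < 1 := mem_ball_zero_iff.1 hxb
    have h0 : 0 < √(1 - ‖x‖ ^ 2) := Real.sqrt_pos.2 (by nlinarith [norm_nonneg x])
    exact ⟨hxb, (le_inv_comm₀ ht0 h0).1 hx⟩
  refine (measure_mono hsub).trans ((volume_shell_le (inv_pos.2 ht0)).trans_eq ?_)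
  rw [Real.rpow_neg ht0.le, inv_pow, show (2 : ℝ) = (2 : ℕ) by norm_num, Real.rpow_natCast]

/-- The bound in `x` is uniform in `v ≠ 0`, and the finite measure `ν` does not charge `v = 0`. -/
lemma prod_half_le [NeZero d] {ν : Measure (E d)} [IsFiniteMeasure ν] (hν : ν ≪ volume) {t : ℝ}
    (ht : 1 ≤ t) :
    ((volume.restrict (Metric.ball (0 : E d) 1)).prod ν) {z | t ≤ (half z.1 z.2)⁻¹} ≤
      (8 * volume (Metric.ball (0 : E d) 1) + ENNReal.ofReal (d * 2 ^ d * 2)) * ν univ *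
        ENNReal.ofReal (t ^ (-3 : ℝ)) := by
  have hinv : Measurable fun z : E d × E d => (half z.1 z.2)⁻¹ := measurable_half.inv
  rw [Measure.prod_apply_symm (measurableSet_le measurable_const hinv), mul_right_comm,
    ← lintegral_const]
  have h0 : ∀ᵐ v ∂ν, v ≠ 0 :=
    hν.ae_le (compl_mem_ae_iff.2 (measure_singleton 0))
  refine lintegral_mono_ae ?_
  filter_upwards [h0] with v hv
  exact volume_restrict_half_le hv ht

end

/-! ### Lipschitz and integrability statements for `eta` and its compositions. -/

section

variable {d : ℕ} {φ : E d → ℝ} {φ' : E d → E d →L[ℝ] ℝ} {φ'' : E d → E d →L[ℝ] E d →L[ℝ] ℝ}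
  {M : ℝ} {x v : E d}

lemma lipschitzWith_eta (hx : ‖x‖ < 1) : LipschitzWith 20 (eta x) :=
  lipschitzWith_of_pointLip fun v => pointLip_eta hx v

lemma lipschitzWith_comp_eta (hφ : NeumannBounds φ φ' φ'' M) (hx : ‖x‖ < 1) :
    LipschitzWith (M * 20).toNNReal fun w => φ (eta x w) :=
  lipschitzWith_of_nnnorm_fderiv_le (𝕜 := ℝ) (differentiable_comp_eta hφ hx) fun v => by
    rw [← NNReal.coe_le_coe, coe_nnnorm, Real.coe_toNNReal _ (by linarith [hφ.nonneg])]
    exact norm_fderiv_comp_eta_le hφ hx v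

/-- Taking the supremum over `v` gives up the term `along²`, which confines `x` to a slab; this
lowers the critical exponent from `3` to `2`. -/
lemma inv_half_le (hx : ‖x‖ < 1) (v : E d) : (half x v)⁻¹ ≤ (√(1 - ‖x‖ ^ 2))⁻¹ := by
  have h0 : 0 < √(1 - ‖x‖ ^ 2) := Real.sqrt_pos.2 (by nlinarith [norm_nonneg x])
  refine inv_anti₀ h0 (Real.sqrt_le_sqrt ?_)
  linarith [sq_nonneg (along x v)]

lemma lipschitzWith_fderiv_comp_eta (hφ : NeumannBounds φ φ' φ'' M) (hx : ‖x‖ < 1) :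
    LipschitzWith (1600 * M * (√(1 - ‖x‖ ^ 2))⁻¹).toNNReal (fderiv ℝ fun w => φ (eta x w)) := by
  have hM := hφ.nonneg
  refine lipschitzWith_of_pointLip fun v => ?_
  rw [Real.coe_toNNReal _ (by positivity)]
  refine (pointLip_fderiv_comp_eta hφ hx v).mono ?_
  exact mul_le_mul_of_nonneg_left (inv_half_le hx v) (by positivity)

lemma norm_fderiv_fderiv_comp_eta_le (hφ : NeumannBounds φ φ' φ'' M) (hx : ‖x‖ < 1) (v : E d) :
    ‖fderiv ℝ (fderiv ℝ fun w => φ (eta x w)) v‖ ≤ 1600 * M * (half x v)⁻¹ := by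
  have hM := hφ.nonneg
  have := half_pos hx v
  exact (pointLip_fderiv_comp_eta hφ hx v).norm_fderiv_le (by positivity)

lemma memLp_fderiv_eta : MemLp (fun z : E d × E d => fderiv ℝ (eta z.1) z.2) ⊤
    ((volume.restrict (Metric.ball 0 1)).prod volume) := by
  refine memLp_top_of_bound (aestronglyMeasurable_fderiv_of_continuousAt
    (fun x hx v => continuousAt_eta (mem_ball_zero_iff.1 hx) v) _) 20 ?_
  filter_upwards [Measure.quasiMeasurePreserving_fst.ae
    (ae_restrict_mem (measurableSet_ball (x := (0 : E d)) (ε := 1)))] with z hz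
  exact (pointLip_eta (mem_ball_zero_iff.1 hz) z.2).norm_fderiv_le (by norm_num)

lemma memLp_fderiv_fderiv_comp_eta [NeZero d] (hφ : NeumannBounds φ φ' φ'' M)
    {ν : Measure (E d)} [IsFiniteMeasure ν] (hν : ν ≪ volume) {p : ℝ≥0∞} (hp : p < 3) :
    MemLp (fun z : E d × E d => fderiv ℝ (fderiv ℝ fun w => φ (eta z.1 w)) z.2) p
      ((volume.restrict (Metric.ball 0 1)).prod ν) := by
  have hM := hφ.nonneg
  have : IsFiniteMeasure (volume.restrict (Metric.ball (0 : E d) 1)) :=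
    ⟨by rw [Measure.restrict_apply_univ]; exact volume_ball_lt_top⟩
  refine memLp_of_meas_le (f := fun z : E d × E d => (half z.1 z.2)⁻¹)
    (K := 1600 * M) (r := 3) (aestronglyMeasurable_fderiv_of_continuousAt
      (g := fun x => fderiv ℝ fun w => φ (eta x w))
      (fun x hx v => continuousAt_fderiv_comp_eta hφ (mem_ball_zero_iff.1 hx) v) _)
    (.of_forall fun z => inv_nonneg.2 (Real.sqrt_nonneg _)) measurable_half.inv.aemeasurable
    (by positivity) ?_ ?_ (by simpa using hp) fun t ht => prod_half_le hν ht
  · filter_upwards [Measure.quasiMeasurePreserving_fst.ae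
      (ae_restrict_mem (measurableSet_ball (x := (0 : E d)) (ε := 1)))] with z hz
    rw [← ofReal_norm]
    exact ENNReal.ofReal_le_ofReal
      (norm_fderiv_fderiv_comp_eta_le hφ (mem_ball_zero_iff.1 hz) z.2)
  · exact ENNReal.mul_ne_top (ENNReal.add_ne_top.2 ⟨ENNReal.mul_ne_top (by norm_num)
      volume_ball_lt_top.ne, ENNReal.ofReal_ne_top⟩) (measure_ne_top _ _)

lemma memLp_iSup_fderiv_fderiv_comp_eta (hφ : NeumannBounds φ φ' φ'' M) {p : ℝ≥0∞} (hp : p < 2) :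
    MemLp (fun x : E d => ⨆ v : E d, ‖fderiv ℝ (fderiv ℝ fun w => φ (eta x w)) v‖ₑ) p
      (volume.restrict (Metric.ball 0 1)) := by
  have hM := hφ.nonneg
  have : IsFiniteMeasure (volume.restrict (Metric.ball (0 : E d) 1)) :=
    ⟨by rw [Measure.restrict_apply_univ]; exact volume_ball_lt_top⟩
  have hmeas : Measurable fun x : E d => (√(1 - ‖x‖ ^ 2))⁻¹ := by fun_prop
  refine memLp_of_meas_le (f := fun x : E d => (√(1 - ‖x‖ ^ 2))⁻¹)
    (K := 1600 * M) (r := 2) (aemeasurable_iSup_enorm_fderiv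
      (g := fun x => fderiv ℝ fun w => φ (eta x w))
      (fun x hx v => continuousAt_fderiv_comp_eta hφ (mem_ball_zero_iff.1 hx) v)
      fun x hx => ⟨_, lipschitzWith_fderiv_comp_eta hφ
        (mem_ball_zero_iff.1 hx)⟩).aestronglyMeasurable
    (.of_forall fun z => inv_nonneg.2 (Real.sqrt_nonneg _)) hmeas.aemeasurable
    (by positivity) ?_ ?_ (by simpa using hp) fun t ht => volume_restrict_shell_le ht
  · filter_upwards [ae_restrict_mem (measurableSet_ball (x := (0 : E d)) (ε := 1))] with x hx
    rw [enorm_eq_self]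
    refine iSup_le fun v => ?_
    rw [← ofReal_norm]
    refine ENNReal.ofReal_le_ofReal
      ((norm_fderiv_fderiv_comp_eta_le hφ (mem_ball_zero_iff.1 hx) v).trans ?_)
    exact mul_le_mul_of_nonneg_left (inv_half_le (mem_ball_zero_iff.1 hx) v) (by positivity)
  · exact ENNReal.mul_ne_top (ENNReal.add_ne_top.2 ⟨by norm_num, ENNReal.ofReal_ne_top⟩)
      volume_ball_lt_top.ne

end

end SpecularBall

theorem mainTheorem6 (d : ℕ) [NeZero d] :
    ((∀ x ∈ Metric.ball (0 : SpecularBall.E d) 1,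
        SpecularBall.HasRegularDeriv (SpecularBall.eta x)) ∧
      MemLp (fun z : SpecularBall.E d × SpecularBall.E d =>
          fderiv ℝ (SpecularBall.eta z.1) z.2) ⊤
        ((volume.restrict (Metric.ball 0 1)).prod volume)) ∧
    ∀ (T : ℝ), 0 < T → ∀ ψ : ℝ → SpecularBall.E d → ℝ, SpecularBall.IsTestFunction T ψ →
      ∀ t ∈ Ico 0 T,
        (∀ x ∈ Metric.ball (0 : SpecularBall.E d) 1,
          SpecularBall.HasRegularDeriv (fun v => ψ t (SpecularBall.eta x v)) ∧
          SpecularBall.HasRegularDeriv (fderiv ℝ fun v => ψ t (SpecularBall.eta x v))) ∧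
        (∀ (s ν : ℝ), 0 < s → s < 1 → 0 < ν →
          ∀ F : SpecularBall.E d → ℝ, SpecularBall.IsEquilibrium s ν F →
          ∀ p : ℝ≥0∞, p < 3 →
            MemLp (fun z : SpecularBall.E d × SpecularBall.E d =>
                SpecularBall.hessian ψ t z.1 z.2) p
              ((volume.restrict (Metric.ball 0 1)).prod
                (volume.withDensity fun v => ENNReal.ofReal (F v)))) ∧
        (∀ δ : ℝ, 0 < δ →
          MemLp (fun x : SpecularBall.E d =>
              ⨆ v : SpecularBall.E d, ‖SpecularBall.hessian ψ t x v‖ₑ)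
            (ENNReal.ofReal (2 - δ)) (volume.restrict (Metric.ball 0 1))) := by
  have hball : ∀ x ∈ Metric.ball (0 : SpecularBall.E d) 1, ‖x‖ < 1 := fun x hx =>
    mem_ball_zero_iff.1 hx
  refine ⟨⟨fun x hx => SpecularBall.hasRegularDeriv_of_lipschitz
    (SpecularBall.lipschitzWith_eta (hball x hx)), SpecularBall.memLp_fderiv_eta⟩, ?_⟩
  intro T _ ψ hψ t ht
  obtain ⟨φ', φ'', M, hφ⟩ := hψ.exists_neumannBounds ht
  refine ⟨fun x hx => ⟨SpecularBall.hasRegularDeriv_of_lipschitz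
    (SpecularBall.lipschitzWith_comp_eta hφ (hball x hx)),
    SpecularBall.hasRegularDeriv_of_lipschitz
    (SpecularBall.lipschitzWith_fderiv_comp_eta hφ (hball x hx))⟩, ?_, ?_⟩
  · intro s ν _ _ _ F hF p hp
    have := isFiniteMeasure_withDensity_ofReal hF.integrable.2
    exact SpecularBall.memLp_fderiv_fderiv_comp_eta hφ (withDensity_absolutelyContinuous _ _) hp
  · intro δ hδ
    -- For `δ ≥ 2` the exponent is `0`, which is still below `2`.
    refine SpecularBall.memLp_iSup_fderiv_fderiv_comp_eta hφ ?_
    rw [← ENNReal.ofReal_ofNat]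
    exact (ENNReal.ofReal_lt_ofReal_iff (by norm_num)).2 (by linarith)
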